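/- \textbf{Definitions.} A \emph{promise problem} is a pair $(L_{\mathrm{yes}},L_{\mathrm{no}})$ of disjoint sets of binary strings (a language $L$ is the case $L_{\mathrm{yes}}=L$, $L_{\mathrm{no}}=\{0,1\}^*\setminus L$). It is in $\mathsf{PSPACE}$ if some deterministic Turing machine, on every input $x\in L_{\mathrm{yes}}\cup L_{\mathrm{no}}$, halts after using at most $p(|x|)$ tape cells, for a fixed polynomial $p$, accepting if $x\in L_{\mathrm{yes}}$ and rejecting if $x\in L_{\mathrm{no}}$. A promise problem $Q$ is $\mathsf{PSPACE}$\emph{-hard} if for every promise problem $L$ in $\mathsf{PSPACE}$ there is a polynomial-time computable function $f$ on binary strings with $f(L_{\mathrm{yes}})\subseteq Q_{\mathrm{yes}}$ and $f(L_{\mathrm{no}})\subseteq Q_{\mathrm{no}}$. A \emph{succinct encoding} of a $2^m\times 2^m$ matrix $A$, with rows and columns indexed by $\{0,1\}^m$, is (the binary description of) a Boolean circuit with $m$ input bits which, given a row index $i$, outputs a list of pairs $(j,v)$ whose members with $v\neq 0$ are exactly the pairs $(j,A_{ij})$ with $A_{ij}\ne 0$. (Thus $m$, the size of the circuit and the number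 of nonzero entries in each row are at most polynomial in the length of the description.) For a polynomial $g$ with nonnegative integer coefficients, $\mathrm{GappedSuccinctDet}_g$ is the following promise problem. The input, of length $n$, is a succinct encoding of a symmetric positive semidefinite matrix $A$ whose entries all lie in $\{0,1,2\}$, and whose smallest eigenvalue $\lambda_{\min}(A)$ is promised to be either $0$ or at least $2^{-g(n)}$. The YES instances are those with $\lambda_{\min}(A)=0$, the NO instances those with $\lambda_{\min}(A)\ge 2^{-g(n)}$. \textbf{Theorem.} There is a polynomial $g$ such that $\mathrm{GappedSuccinctDet}_g$ is $\mathsf{PSPACE}$-hard. -/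

import Mathlib

namespace GappedSuccinct

/-! ### Promise problems, polynomial space, polynomial-time reductions -/

/-- A promise problem over binary strings. A language `S` is the case `no = yesᶜ`. -/
structure PromiseProblem where
  yes : Set (List Bool)
  no : Set (List Bool)
  disjoint : Disjoint yes no

/-- The initial configuration of the machine `M` on the binary input `x`. -/
def initCfg (M : Turing.TM2ComputableAux Bool Bool) (x : List Bool) : M.tm.Cfg :=
  Turing.initList M.tm (x.map M.inputAlphabet.invFun)

/-- The space occupied by a configuration: the total number of cells in use on all tapes (stacks),
including the input and the output one. -/
def cfgSpace (tm : Turing.FinTM2) (c : Turing.TM2.Cfg tm.Γ tm.Λ tm.σ) : ℕ :=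
  letI := tm.kFin
  ∑ k : tm.K, (c.stk k).length

/-- On input `x`, the deterministic machine `M` halts with the single bit `b` as its output, and no
configuration that it passes through occupies more than `s` cells. -/
def AnswersInSpace (M : Turing.TM2ComputableAux Bool Bool) (x : List Bool) (b : Bool) (s : ℕ) :
    Prop :=
  Nonempty (Turing.TM2Outputs M.tm (x.map M.inputAlphabet.invFun)
      (some ([b].map M.outputAlphabet.invFun))) ∧
    ∀ c : M.tm.Cfg, StateTransition.Reaches M.tm.step (initCfg M x) c → cfgSpace M.tm c ≤ s

/-- `L` is decided by a deterministic Turing machine in polynomial space. Nothing is asked of the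
machine on inputs outside the promise. -/
def InPSPACE (L : PromiseProblem) : Prop :=
  ∃ (M : Turing.TM2ComputableAux Bool Bool) (p : Polynomial ℕ),
    (∀ k, Finite (M.tm.Γ k)) ∧
    (∀ x ∈ L.yes, AnswersInSpace M x true (p.eval x.length)) ∧
    (∀ x ∈ L.no, AnswersInSpace M x false (p.eval x.length))

/-- `f` is computed by a deterministic Turing machine with finite tape alphabets in polynomial
time. -/
def PolyTime (f : List Bool → List Bool) : Prop :=
  ∃ M : Turing.TM2ComputableInPolyTime (id : List Bool → List Bool) (id : List Bool → List Bool) f,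
    ∀ k, Finite (M.tm.Γ k)

/-- Polynomial-time many-one (Karp) reducibility between promise problems. -/
def PolyTimeReduces (L Q : PromiseProblem) : Prop :=
  ∃ f : List Bool → List Bool, PolyTime f ∧
    (∀ x ∈ L.yes, f x ∈ Q.yes) ∧ (∀ x ∈ L.no, f x ∈ Q.no)

/-- Every promise problem in `PSPACE`, in particular every language in it, reduces to `Q`. -/
def PSPACEHard (Q : PromiseProblem) : Prop :=
  ∀ L : PromiseProblem, InPSPACE L → PolyTimeReduces L Q

/-! ### Boolean circuits -/

/-- A gate of a Boolean circuit; the arguments are numbers of earlier wires. -/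
inductive Gate where
  | const (b : Bool)
  | not (i : ℕ)
  | and (i j : ℕ)
  | or (i j : ℕ)

/-- The value of a gate, given the values of the earlier wires. -/
def Gate.eval (w : List Bool) : Gate → Bool
  | .const b => b
  | .not i => !(w.getD i false)
  | .and i j => w.getD i false && w.getD j false
  | .or i j => w.getD i false || w.getD j false

/-- All arguments of the gate are among the first `n` wires. -/
def Gate.ArgsBelow (n : ℕ) : Gate → Prop
  | .const _ => True
  | .not i => i < n
  | .and i j => i < n ∧ j < n
  | .or i j => i < n ∧ j < n

/-- A Boolean circuit with `arity` input bits. Wires `0, …, arity - 1` carry the input, wire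
`arity + t` carries the value of the `t`-th gate, and `outputs` lists the output wires. -/
structure Circuit where
  arity : ℕ
  gates : List Gate
  outputs : List ℕ

namespace Circuit

/-- Every gate refers to earlier wires only, and every output wire exists. -/
def WellFormed (C : Circuit) : Prop :=
  (∀ (t : ℕ) (ht : t < C.gates.length), (C.gates[t]).ArgsBelow (C.arity + t)) ∧
    ∀ o ∈ C.outputs, o < C.arity + C.gates.length

/-- The values of all wires on input `x`. -/
def wires (C : Circuit) (x : Fin C.arity → Bool) : List Bool :=
  C.gates.foldl (fun w g => w ++ [g.eval w]) (List.ofFn x)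

/-- The output bits on input `x`. -/
def eval (C : Circuit) (x : Fin C.arity → Bool) : List Bool :=
  C.outputs.map fun o => (C.wires x).getD o false

end Circuit

/-! ### Encoding circuits by binary strings -/

/-- Unary code of a natural number. Wire numbers never exceed the size of a circuit, so that unary
codes are at most polynomially longer than binary ones. -/
def encodeNat (n : ℕ) : List Bool :=
  List.replicate n true ++ [false]

/-- Code of a list: each item is preceded by `true`, the end is marked by `false`. -/
def encodeList {α : Type} (e : α → List Bool) : List α → List Bool
  | [] => [false]
  | a :: l => true :: (e a ++ encodeList e l)

/-- Code of a gate: a two-bit tag followed by the arguments. -/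
def Gate.encode : Gate → List Bool
  | .const b => [false, false, b]
  | .not i => [false, true] ++ encodeNat i
  | .and i j => [true, false] ++ (encodeNat i ++ encodeNat j)
  | .or i j => [true, true] ++ (encodeNat i ++ encodeNat j)

/-- Code of a circuit. -/
def Circuit.encode (C : Circuit) : List Bool :=
  encodeNat C.arity ++ (encodeList Gate.encode C.gates ++ encodeList encodeNat C.outputs)

/-- A code can be read off the beginning of a longer string in only one way. -/
def PrefixInjective {α : Type} (e : α → List Bool) : Prop :=
  ∀ a b s t, e a ++ s = e b ++ t → a = b ∧ s = t

theorem encodeNat_prefixInjective : PrefixInjective encodeNat := by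
  intro a
  induction a with
  | zero =>
    intro b s t h
    cases b with
    | zero => simpa [encodeNat] using h
    | succ b => simp [encodeNat, List.replicate_succ] at h
  | succ a ih =>
    intro b s t h
    cases b with
    | zero => simp [encodeNat, List.replicate_succ] at h
    | succ b =>
      have h' : encodeNat a ++ s = encodeNat b ++ t := by
        simpa [encodeNat, List.replicate_succ] using h
      obtain ⟨h1, h2⟩ := ih b s t h'
      exact ⟨by rw [h1], h2⟩

theorem encodeList_prefixInjective {α : Type} {e : α → List Bool} (he : PrefixInjective e) :
    PrefixInjective (encodeList e) := by
  intro a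
  induction a with
  | nil =>
    intro b s t h
    cases b with
    | nil => simpa [encodeList] using h
    | cons y b => simp [encodeList] at h
  | cons x a ih =>
    intro b s t h
    cases b with
    | nil => simp [encodeList] at h
    | cons y b =>
      have h' : e x ++ (encodeList e a ++ s) = e y ++ (encodeList e b ++ t) := by
        simpa [encodeList] using h
      obtain ⟨h1, h2⟩ := he _ _ _ _ h'
      obtain ⟨h3, h4⟩ := ih _ _ _ h2
      exact ⟨by rw [h1, h3], h4⟩

theorem gateEncode_prefixInjective : PrefixInjective Gate.encode := by
  intro a b s t h
  have key2 : ∀ i j i' j' : ℕ, encodeNat i ++ (encodeNat j ++ s) =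
      encodeNat i' ++ (encodeNat j' ++ t) → i = i' ∧ j = j' ∧ s = t := by
    intro i j i' j' h
    obtain ⟨h1, h2⟩ := encodeNat_prefixInjective _ _ _ _ h
    exact ⟨h1, encodeNat_prefixInjective _ _ _ _ h2⟩
  cases a <;> cases b <;> simp [Gate.encode] at h
  · exact ⟨by rw [h.1], h.2⟩
  · obtain ⟨h1, h2⟩ := encodeNat_prefixInjective _ _ _ _ h
    exact ⟨by rw [h1], h2⟩
  · obtain ⟨h1, h2, h3⟩ := key2 _ _ _ _ h
    exact ⟨by rw [h1, h2], h3⟩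
  · obtain ⟨h1, h2, h3⟩ := key2 _ _ _ _ h
    exact ⟨by rw [h1, h2], h3⟩

theorem circuitEncode_injective : Function.Injective Circuit.encode := by
  rintro ⟨m, gs, os⟩ ⟨m', gs', os'⟩ h
  obtain ⟨h1, h2⟩ := encodeNat_prefixInjective _ _ _ _ h
  obtain ⟨h3, h4⟩ := encodeList_prefixInjective gateEncode_prefixInjective _ _ _ _ h2
  obtain ⟨h5, -⟩ := encodeList_prefixInjective encodeNat_prefixInjective os os' [] []
    (by simpa using h4)
  simp only at h1 h3
  rw [h1, h3, h5]

/-! ### Succinctly encoded sparse matrices -/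

namespace Circuit

/-- The matrices encoded by `C` are indexed by binary strings of length `C.arity`, so their size is
`2 ^ C.arity`. -/
abbrev Index (C : Circuit) : Type := Fin C.arity → Bool

/-- On input a row index, the output of the circuit is divided into consecutive slots of
`C.arity + 2` bits: two bits for a value in `{0, 1, 2, 3}` (the low bit first), then the
`C.arity` bits of a column index. -/
def slotValue (C : Circuit) (i : C.Index) (s : ℕ) : ℕ :=
  ((C.eval i).getD (s * (C.arity + 2)) false).toNat +
    2 * ((C.eval i).getD (s * (C.arity + 2) + 1) false).toNat

/-- The column index written in slot `s` of the output on row `i`. -/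
def slotColumn (C : Circuit) (i : C.Index) (s : ℕ) : C.Index :=
  fun b => (C.eval i).getD (s * (C.arity + 2) + 2 + b) false

/-- The number of slots. It bounds the number of nonzero entries in each row, and is at most the
length of the code of `C`. -/
def numSlots (C : Circuit) : ℕ := C.outputs.length / (C.arity + 2)

/-- `C` is a succinct encoding of the sparse matrix `A`: on input a row index `i` it outputs the
nonzero entries of the row `i`, with their columns. Slots with the value `0` are unused. -/
def Represents (C : Circuit) (A : Matrix C.Index C.Index ℕ) : Prop :=
  C.WellFormed ∧ (C.arity + 2) ∣ C.outputs.length ∧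
    ∀ (i j : C.Index) (v : ℕ), v ≠ 0 →
      (A i j = v ↔ ∃ s < C.numSlots, C.slotColumn i s = j ∧ C.slotValue i s = v)

theorem Represents.unique {C : Circuit} {A B : Matrix C.Index C.Index ℕ} (hA : C.Represents A)
    (hB : C.Represents B) : A = B := by
  ext i j
  have h : ∀ v, v ≠ 0 → (A i j = v ↔ B i j = v) := fun v hv =>
    (hA.2.2 i j v hv).trans (hB.2.2 i j v hv).symm
  by_cases h0 : A i j = 0
  · by_contra hne
    exact hne ((h (B i j) (fun hb => hne (h0.trans hb.symm))).2 rfl)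
  · exact ((h _ h0).1 rfl).symm

end Circuit

/-! ### The problem `GappedSuccinctDet` -/

/-- `r` is the smallest eigenvalue of the real matrix `A`. -/
def IsSmallestEigenvalue {ι : Type} [Fintype ι] [DecidableEq ι] (A : Matrix ι ι ℝ) (r : ℝ) :
    Prop :=
  IsLeast {μ : ℝ | Module.End.HasEigenvalue (Matrix.toLin' A) μ} r

/-- The string `w` is a succinct encoding of a symmetric positive semidefinite matrix with entries
in `{0, 1, 2}` and with smallest eigenvalue `r`. -/
def EncodesPSDWithSmallestEigenvalue (w : List Bool) (r : ℝ) : Prop :=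
  ∃ (C : Circuit) (A : Matrix C.Index C.Index ℕ),
    C.encode = w ∧ C.Represents A ∧
    (∀ i j, A i j = 0 ∨ A i j = 1 ∨ A i j = 2) ∧
    A.IsSymm ∧ (A.map (Nat.cast : ℕ → ℝ)).PosSemidef ∧
    IsSmallestEigenvalue (A.map (Nat.cast : ℕ → ℝ)) r

theorem EncodesPSDWithSmallestEigenvalue.unique {w : List Bool} {r r' : ℝ}
    (h : EncodesPSDWithSmallestEigenvalue w r) (h' : EncodesPSDWithSmallestEigenvalue w r') :
    r = r' := by
  obtain ⟨C, A, hC, hA, -, -, -, hr⟩ := h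
  obtain ⟨C', A', hC', hA', -, -, -, hr'⟩ := h'
  obtain rfl : C = C' := circuitEncode_injective (hC.trans hC'.symm)
  obtain rfl : A = A' := hA.unique hA'
  exact IsLeast.unique hr hr'

/-- The promise problem `GappedSuccinctDet` with gap `2 ^ (-g(n))`, where `n` is the length of the
input: given a succinct encoding of a sparse symmetric positive semidefinite matrix with entries in
`{0, 1, 2}` whose smallest eigenvalue is either `0` (YES) or at least `2 ^ (-g(n))` (NO), decide
which is the case. -/
def GappedSuccinctDet (g : Polynomial ℕ) : PromiseProblem where
  yes := {w | EncodesPSDWithSmallestEigenvalue w 0}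
  no := {w | ∃ r : ℝ, EncodesPSDWithSmallestEigenvalue w r ∧ ((2 : ℝ) ^ g.eval w.length)⁻¹ ≤ r}
  disjoint := by
    rw [Set.disjoint_left]
    rintro w hw ⟨r, hr, hle⟩
    have h0 : (0 : ℝ) = r := EncodesPSDWithSmallestEigenvalue.unique hw hr
    have hpos : (0 : ℝ) < ((2 : ℝ) ^ g.eval w.length)⁻¹ := by positivity
    linarith

end GappedSuccinct

/-!
A polynomial-space computation is carried out by a machine whose tapes rotate cyclically, so that
every step rewrites one fixed column only and is then followed by a permutation. Equipped with a
binary timer, its configurations form a forest of exponential size, whose roots are the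
configurations at which the timer would overflow; the computation is the path from the initial
configuration to a root, which is accepting exactly if the machine accepts.

Let `N` be the unsigned incidence matrix of the edges of the forest, together with half-edges at
the initial configuration and at the accepting roots. Then `A = Nᵀ N` is positive semidefinite, and
its entries count the common ends of two edges. If the initial configuration leads to an accepting
root, the alternating sum of the edges along the path, closed off by the two half-edges, lies in the
kernel of `N`. Otherwise alternating sums over the vertices below a given one make up a left inverse
of `N` with entries of absolute value at most `2`, and by Cauchy-Schwarz the smallest eigenvalue of
`A` is at least `1 / (8 E ^ 2)`, where `E` is the number of edges.

The edges that meet a given edge are found locally: follow the step of the machine, undo a rotation,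
or replace the finitely many bits that a step can rewrite. Hence the rows of `A` are computed by
circuits which a loop program can print in polynomial time.
-/

namespace GappedSuccinct

open Function Matrix

/-! ### Smallest eigenvalues -/

section SmallestEigenvalue

variable {ι : Type} [Fintype ι] [DecidableEq ι] {A : Matrix ι ι ℝ} {c : ℝ}

theorem le_of_hasEigenvalue (hc : ∀ z, c * (z ⬝ᵥ z) ≤ z ⬝ᵥ A *ᵥ z) {μ : ℝ}
    (hμ : Module.End.HasEigenvalue (toLin' A) μ) : c ≤ μ := by
  obtain ⟨z, hz⟩ := hμ.exists_hasEigenvector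
  have hAz : A *ᵥ z = μ • z := by simpa using hz.apply_eq_smul
  have hpos : 0 < z ⬝ᵥ z := by simpa using dotProduct_star_self_pos_iff.2 hz.2
  have hle := hc z
  rw [hAz, dotProduct_smul, smul_eq_mul] at hle
  exact le_of_mul_le_mul_right hle hpos

theorem isSmallestEigenvalue_zero (hA : A.PosSemidef) {z : ι → ℝ} (hz : z ≠ 0) (hAz : A *ᵥ z = 0) :
    IsSmallestEigenvalue A 0 := by
  refine ⟨Module.End.hasEigenvalue_of_hasEigenvector (x := z)
    ⟨Module.End.mem_eigenspace_iff.2 (by simpa using hAz), hz⟩, fun μ hμ => ?_⟩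
  refine le_of_hasEigenvalue (fun x => ?_) hμ
  simpa using hA.dotProduct_mulVec_nonneg x

theorem exists_isSmallestEigenvalue_ge [Nonempty ι] (hA : A.IsHermitian)
    (hc : ∀ z, c * (z ⬝ᵥ z) ≤ z ⬝ᵥ A *ᵥ z) : ∃ r, IsSmallestEigenvalue A r ∧ c ≤ r := by
  have hspec : {μ : ℝ | Module.End.HasEigenvalue (toLin' A) μ} = Set.range hA.eigenvalues := by
    rw [← hA.spectrum_real_eq_range_eigenvalues, ← spectrum_toLin']
    ext μ
    exact Module.End.hasEigenvalue_iff_mem_spectrum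
  obtain ⟨i, hi⟩ := Finite.exists_min hA.eigenvalues
  have hleast : IsSmallestEigenvalue A (hA.eigenvalues i) := by
    unfold IsSmallestEigenvalue
    rw [hspec]
    exact ⟨⟨i, rfl⟩, by rintro _ ⟨j, rfl⟩; exact hi j⟩
  exact ⟨_, hleast, le_of_hasEigenvalue hc hleast.1⟩

theorem dotProduct_self_le_of_mul_eq_one {κ : Type} [Fintype κ] {Y : Matrix ι κ ℝ}
    {N : Matrix κ ι ℝ} (hYN : Y * N = 1) (hY : ∀ i k, |Y i k| ≤ c) (z : ι → ℝ) :
    z ⬝ᵥ z ≤ c ^ 2 * Fintype.card ι * Fintype.card κ * (N *ᵥ z ⬝ᵥ N *ᵥ z) := by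
  have hz : ∀ i, z i = ∑ k, Y i k * (N *ᵥ z) k := fun i => by
    conv_lhs => rw [← one_mulVec z, ← hYN, ← mulVec_mulVec]
    rfl
  have hsq : ∀ i, z i * z i ≤ c ^ 2 * Fintype.card κ * (N *ᵥ z ⬝ᵥ N *ᵥ z) := fun i =>
    calc z i * z i = (∑ k, Y i k * (N *ᵥ z) k) ^ 2 := by rw [← hz, sq]
      _ ≤ (∑ k, Y i k ^ 2) * ∑ k, (N *ᵥ z) k ^ 2 := Finset.sum_mul_sq_le_sq_mul_sq _ _ _
      _ ≤ (∑ _k : κ, c ^ 2) * ∑ k, (N *ᵥ z) k ^ 2 := by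
          refine mul_le_mul_of_nonneg_right (Finset.sum_le_sum fun k _ => ?_) (by positivity)
          exact sq_le_sq' (abs_le.1 (hY i k)).1 (abs_le.1 (hY i k)).2
      _ = c ^ 2 * Fintype.card κ * (N *ᵥ z ⬝ᵥ N *ᵥ z) := by
          simp only [Finset.sum_const, Finset.card_univ, nsmul_eq_mul, dotProduct, sq]
          ring
  calc z ⬝ᵥ z ≤ ∑ _i : ι, c ^ 2 * Fintype.card κ * (N *ᵥ z ⬝ᵥ N *ᵥ z) :=
        Finset.sum_le_sum fun i _ => hsq i
    _ = c ^ 2 * Fintype.card ι * Fintype.card κ * (N *ᵥ z ⬝ᵥ N *ᵥ z) := by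
        simp only [Finset.sum_const, Finset.card_univ, nsmul_eq_mul]
        ring

end SmallestEigenvalue

/-! ### Edge graphs of forests -/

/-- A graph with vertex set `V` whose edges are indexed by `E`. The edges whose head is `none` are
half-edges: they have the tail as their only end. -/
structure EdgeGraph (E V : Type) where
  tail : E → V
  head : E → Option V

namespace EdgeGraph

variable {E V : Type} (G : EdgeGraph E V)

open scoped Classical in
/-- The number of common ends of two edges. -/
noncomputable def overlap : Matrix E E ℕ := fun e e' =>
  (if G.tail e = G.tail e' then 1 else 0) + (if G.head e = some (G.tail e') then 1 else 0) +
    ((if G.head e' = some (G.tail e) then 1 else 0) +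
      (if G.head e = G.head e' ∧ G.head e ≠ none then 1 else 0))

open scoped Classical in
/-- The incidence matrix: without signs, so that two consecutive edges have overlap `1` and not
`-1`. -/
noncomputable def incidence : Matrix V E ℝ := fun r e =>
  (if G.tail e = r then 1 else 0) + (if G.head e = some r then 1 else 0)

theorem overlap_isSymm : G.overlap.IsSymm := by
  refine Matrix.ext fun e e' => ?_
  simp only [transpose_apply, overlap]
  grind

theorem overlap_le_two (hG : ∀ e, G.head e ≠ some (G.tail e)) (e e' : E) : G.overlap e e' ≤ 2 := by
  have he := hG e
  have he' := hG e'
  unfold overlap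
  split_ifs <;> grind

theorem vecMul_incidence [Fintype V] (y : V → ℝ) (e : E) :
    (y ᵥ* G.incidence) e = y (G.tail e) + (G.head e).elim 0 y := by
  classical
  simp only [vecMul, dotProduct, incidence, mul_add, Finset.sum_add_distrib, mul_ite, mul_one,
    mul_zero]
  cases G.head e <;> simp

theorem map_overlap_eq [Fintype V] :
    G.overlap.map (Nat.cast : ℕ → ℝ) = G.incidenceᵀ * G.incidence := by
  classical
  ext e e'
  refine Eq.trans ?_ (G.vecMul_incidence (fun r => G.incidence r e) e').symm
  simp only [map_apply, overlap, incidence]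
  cases h : G.head e' <;> (simp [eq_comm]; try grind)

theorem posSemidef_map_overlap [Finite E] [Finite V] :
    (G.overlap.map (Nat.cast : ℕ → ℝ)).PosSemidef := by
  have := Fintype.ofFinite V
  rw [map_overlap_eq, ← conjTranspose_eq_transpose_of_trivial]
  exact posSemidef_conjTranspose_mul_self _

theorem dotProduct_map_overlap_mulVec [Fintype E] [Fintype V] (z : E → ℝ) :
    z ⬝ᵥ G.overlap.map (Nat.cast : ℕ → ℝ) *ᵥ z = G.incidence *ᵥ z ⬝ᵥ G.incidence *ᵥ z := by
  rw [map_overlap_eq, ← mulVec_mulVec, dotProduct_mulVec, vecMul_transpose]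

end EdgeGraph

/-- A forest in which every live vertex `e` that is no root has an edge to `next e`; the rank makes
it acyclic. The vertices double as the names of the edges leaving them, and the dead vertex `half`
as the name of a half-edge at the live vertex `start`. -/
structure Forest (E : Type) where
  live : E → Prop
  root : E → Prop
  accept : E → Prop
  next : E → E
  start : E
  half : E
  rank : E → ℕ
  live_start : live start
  not_root_start : ¬ root start
  rank_start : rank start = 0
  not_live_half : ¬ live half
  live_next : ∀ e, live e → ¬ root e → live (next e)
  rank_next : ∀ e, live e → ¬ root e → rank (next e) = rank e + 1

namespace Forest

variable {E : Type} (F : Forest E)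

/-- One step along an edge. -/
def Step (e e' : E) : Prop := F.live e ∧ ¬ F.root e ∧ F.next e = e'

/-- The roots that are not accepting. -/
def Rejecting (e : E) : Prop := F.root e ∧ ¬ F.accept e

open scoped Classical in
/-- The edges of a forest: from each vertex to its successor, and half-edges at the accepting roots
and at `start`. The edges of the rejecting roots and of the remaining dead indices are half-edges at
private vertices in the second copy of `E`, which turns them into a direct summand `1` of the
overlap matrix. -/
noncomputable def graph : EdgeGraph E (E ⊕ E) where
  tail e :=
    if F.live e then (if F.Rejecting e then .inr e else .inl e)
    else if e = F.half then .inl F.start else .inr e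
  head e := if F.live e ∧ ¬ F.root e then some (.inl (F.next e)) else none

theorem graph_head_ne_tail (e : E) : F.graph.head e ≠ some (F.graph.tail e) := by
  have hrank := F.rank_next e
  simp only [graph]
  split_ifs <;> grind

theorem graph_tail_eq_tail_iff (e e' : E) : F.graph.tail e = F.graph.tail e' ↔
    e = e' ∨ (e = F.start ∧ e' = F.half) ∨ (e = F.half ∧ e' = F.start) := by
  have hstart := F.live_start
  have hroot := F.not_root_start
  have hhalf := F.not_live_half
  simp only [graph, Rejecting]
  split_ifs <;> grind

theorem graph_head_eq_tail_iff (e e' : E) : F.graph.head e = some (F.graph.tail e') ↔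
    F.Step e e' ∧ ¬ F.Rejecting e' := by
  have hlive := F.live_next e
  have hrank := F.rank_next e
  have hstart := F.rank_start
  simp only [graph, Step]
  split_ifs <;> grind

theorem graph_head_eq_head_iff (e e' : E) :
    (F.graph.head e = F.graph.head e' ∧ F.graph.head e ≠ none) ↔
      ∃ w, F.Step e w ∧ F.Step e' w := by
  simp only [graph, Step]
  split_ifs <;> grind

open scoped Classical in
theorem overlap_apply (e e' : E) : F.graph.overlap e e' =
    (if e = e' ∨ (e = F.start ∧ e' = F.half) ∨ (e = F.half ∧ e' = F.start) then 1 else 0) +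
      (if F.Step e e' ∧ ¬ F.Rejecting e' then 1 else 0) +
      ((if F.Step e' e ∧ ¬ F.Rejecting e then 1 else 0) +
        (if ∃ w, F.Step e w ∧ F.Step e' w then 1 else 0)) := by
  simp only [EdgeGraph.overlap, graph_tail_eq_tail_iff, graph_head_eq_tail_iff,
    graph_head_eq_head_iff]

/-- There is a directed path from `e` to `e'`. -/
def Reach : E → E → Prop := Relation.ReflTransGen F.Step

variable {F}

theorem Step.rank_eq {e e' : E} (h : F.Step e e') : F.rank e' = F.rank e + 1 :=
  h.2.2 ▸ F.rank_next e h.1 h.2.1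

theorem Step.live {e e' : E} (h : F.Step e e') : F.live e' := h.2.2 ▸ F.live_next e h.1 h.2.1

theorem Step.overlap_eq_one {e e' : E} (h : F.Step e e') (he' : ¬ F.Rejecting e') :
    F.graph.overlap e e' = 1 := by
  classical
  have hrank := h.rank_eq
  have hhalf := F.not_live_half
  have hne : ¬ (e = e' ∨ (e = F.start ∧ e' = F.half) ∨ (e = F.half ∧ e' = F.start)) := by
    rintro (rfl | ⟨-, rfl⟩ | ⟨rfl, -⟩)
    exacts [by omega, hhalf h.live, hhalf h.1]
  have hback : ¬ F.Step e' e := fun h' => by have := h'.rank_eq; omega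
  have hcommon : ¬ ∃ w, F.Step e w ∧ F.Step e' w := fun ⟨w, hw, hw'⟩ => by
    have := hw.rank_eq; have := hw'.rank_eq; omega
  rw [overlap_apply, if_neg hne, if_pos ⟨h, he'⟩, if_neg (hback ·.1), if_neg hcommon]


theorem Reach.rank_le {e e' : E} (h : F.Reach e e') : F.rank e ≤ F.rank e' := by
  induction h with
  | refl => exact le_rfl
  | tail _ h ih =>
    exact ih.trans (by simp [h.rank_eq])

theorem Reach.live {e e' : E} (h : F.Reach e e') (he : F.live e) : F.live e' := by
  cases h with
  | refl => exact he
  | tail _ h =>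
    exact h.live

theorem Step.reach_iff {e e' v : E} (h : F.Step e e') : F.Reach e v ↔ e = v ∨ F.Reach e' v := by
  refine ⟨fun hr => ?_, ?_⟩
  · rcases Relation.ReflTransGen.cases_head hr with rfl | ⟨w, hw, hr⟩
    · exact .inl rfl
    · obtain rfl : w = e' := hw.2.2.symm.trans h.2.2
      exact .inr hr
  · rintro (rfl | hr)
    · exact .refl
    · exact .head h hr

theorem reach_iff_of_root {e v : E} (h : F.root e) : F.Reach e v ↔ e = v := by
  refine ⟨fun hr => ?_, fun h => h ▸ .refl⟩
  rcases Relation.ReflTransGen.cases_head hr with rfl | ⟨w, hw, -⟩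
  · rfl
  · exact absurd h hw.2.1

theorem exists_incidence_mulVec_eq_single [Fintype E] [DecidableEq E] {e v : E} (h : F.Reach e v)
    (hlive : F.live v) (hroot : F.root v) (hacc : F.accept v) :
    ∃ z : E → ℝ, (∀ u, ¬ F.live u → z u = 0) ∧
      F.graph.incidence *ᵥ z = Pi.single (.inl e) 1 := by
  induction h using Relation.ReflTransGen.head_induction_on with
  | refl =>
    refine ⟨Pi.single v 1, fun u hu => Pi.single_eq_of_ne (by grind) 1, ?_⟩
    ext r
    simp [EdgeGraph.incidence, graph, Rejecting, hlive, hroot, hacc, Pi.single_apply, eq_comm]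
  | @head e e' hstep _ ih =>
    obtain ⟨z, hz, hNz⟩ := ih
    obtain ⟨hlive', hroot', rfl⟩ := hstep
    refine ⟨Pi.single e 1 - z, fun u hu => ?_, ?_⟩
    · rw [Pi.sub_apply, hz u hu, Pi.single_eq_of_ne (by grind), sub_zero]
    · rw [mulVec_sub, hNz]
      ext r
      simp [EdgeGraph.incidence, graph, Rejecting, hlive', hroot', Pi.single_apply, eq_comm]

theorem isSmallestEigenvalue_zero_of_accept [Fintype E] [DecidableEq E] {v : E}
    (h : F.Reach F.start v) (hroot : F.root v) (hacc : F.accept v) :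
    IsSmallestEigenvalue (F.graph.overlap.map (Nat.cast : ℕ → ℝ)) 0 := by
  obtain ⟨z, hz, hNz⟩ := exists_incidence_mulVec_eq_single h (h.live F.live_start) hroot hacc
  have hne : z - Pi.single F.half 1 ≠ 0 := fun h0 => by
    simpa [hz _ F.not_live_half] using congrFun h0 F.half
  refine isSmallestEigenvalue_zero F.graph.posSemidef_map_overlap hne ?_
  have hhalf : F.graph.incidence *ᵥ Pi.single F.half 1 = Pi.single (.inl F.start) 1 := by
    ext r
    simp [EdgeGraph.incidence, graph, F.not_live_half, Pi.single_apply, eq_comm]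
  rw [EdgeGraph.map_overlap_eq, ← mulVec_mulVec, mulVec_sub, hNz, hhalf, sub_self, mulVec_zero]

variable (F)

open scoped Classical in
/-- The alternating sum over the vertices below `v`, as a functional on the vertices. The edges
strictly below `v` cancel in it. -/
noncomputable def below (v : E) : E ⊕ E → ℝ
  | .inl u => if F.Reach u v then (-1) ^ (F.rank v + F.rank u) else 0
  | .inr _ => 0

variable {F}

theorem abs_below_le (v : E) (r : E ⊕ E) : |F.below v r| ≤ 1 := by
  cases r <;> simp only [below]
  · split_ifs <;> simp
  · simp

variable (F) in
open scoped Classical in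
theorem below_vecMul_incidence [Fintype E] {v : E} (hv : F.live v) (e : E) :
    (F.below v ᵥ* F.graph.incidence) e =
      (if e = v ∧ ¬ F.Rejecting v then 1 else 0) +
        (if e = F.half then F.below v (.inl F.start) else 0) := by
  rw [EdgeGraph.vecMul_incidence]
  by_cases hl : F.live e
  · have hhalf : e ≠ F.half := by rintro rfl; exact F.not_live_half hl
    by_cases hr : F.root e
    · by_cases hev : e = v
      · subst hev
        by_cases ha : F.accept e <;>
          simp [graph, Rejecting, hl, hr, ha, hhalf, below, reach_iff_of_root hr, ← two_mul]
      · by_cases ha : F.accept e <;>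
          simp [graph, Rejecting, hl, hr, ha, hhalf, hev, below, reach_iff_of_root hr]
    · have hstep : F.Reach e v ↔ e = v ∨ F.Reach (F.next e) v := Step.reach_iff ⟨hl, hr, rfl⟩
      have hrank := F.rank_next e hl hr
      by_cases hev : e = v
      · subst hev
        have hback : ¬ F.Reach (F.next e) e := fun h => by have := h.rank_le; omega
        simp [graph, Rejecting, hl, hr, hhalf, below, hback, hstep, ← two_mul]
      · by_cases h : F.Reach (F.next e) v <;>
          simp [graph, Rejecting, hl, hr, hhalf, hev, below, h, hstep, hrank, ← add_assoc, pow_succ]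
  · have hev : e ≠ v := by rintro rfl; exact hl hv
    by_cases hhalf : e = F.half
    · subst hhalf
      simp [graph, Rejecting, hl, hev]
    · simp [graph, Rejecting, hl, hev, hhalf, below]

variable (F) in
open scoped Classical in
/-- A left inverse of the incidence matrix, where `v` is the rejecting root that `start` leads to:
`below v` isolates the half-edge at `start`, `below e` the edge `e` up to a multiple of the
half-edge. -/
noncomputable def incidenceInverse (v : E) : Matrix E (E ⊕ E) ℝ := fun e =>
  if e = F.half then F.below v (.inl F.start) • F.below v
  else if F.live e ∧ ¬ F.Rejecting e then
    F.below e - (F.below e (.inl F.start) * F.below v (.inl F.start)) • F.below v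
  else Pi.single (.inr e) 1

theorem abs_incidenceInverse_le (v e : E) (r : E ⊕ E) : |F.incidenceInverse v e r| ≤ 2 := by
  classical
  have hmul : ∀ {a b : ℝ}, |a| ≤ 1 → |b| ≤ 1 → |a * b| ≤ 1 := fun ha hb => by
    rw [abs_mul]
    exact mul_le_one₀ ha (abs_nonneg _) hb
  unfold incidenceInverse
  split_ifs
  · exact (hmul (abs_below_le _ _) (abs_below_le _ _)).trans one_le_two
  · refine (abs_sub _ _).trans ((add_le_add (abs_below_le _ _) ?_).trans one_add_one_eq_two.le)
    exact hmul (hmul (abs_below_le _ _) (abs_below_le _ _)) (abs_below_le _ _)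
  · rw [Pi.single_apply]
    split_ifs <;> simp

theorem incidenceInverse_mul_incidence [Fintype E] [DecidableEq E] {v : E}
    (h : F.Reach F.start v) (hv : F.Rejecting v) :
    F.incidenceInverse v * F.graph.incidence = 1 := by
  classical
  have hlive : F.live v := h.live F.live_start
  have hrow : F.below v ᵥ* F.graph.incidence =
      Pi.single F.half (F.below v (.inl F.start)) := by
    ext e
    simp [below_vecMul_incidence F hlive, hv, Pi.single_apply]
  have hsign : F.below v (.inl F.start) * F.below v (.inl F.start) = 1 := by
    simp [below, h, ← mul_pow]
  ext e e'
  change (F.incidenceInverse v e ᵥ* F.graph.incidence) e' = _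
  unfold incidenceInverse
  split_ifs with hhalf he
  · rw [smul_vecMul, hrow, hhalf]
    simp [Pi.single_apply, one_apply, hsign, eq_comm]
  · rw [sub_vecMul, smul_vecMul, hrow]
    simp only [Pi.sub_apply, Pi.smul_apply, below_vecMul_incidence F he.1, he.2,
      Pi.single_apply, one_apply, smul_eq_mul, mul_ite, mul_assoc, hsign]
    simp only [eq_comm (a := e'), not_false_eq_true, and_true, mul_one, mul_zero]
    ring
  · rw [EdgeGraph.vecMul_incidence]
    simp only [graph, Pi.single_apply, one_apply]
    grind

theorem exists_isSmallestEigenvalue_ge_of_reject [Fintype E] [DecidableEq E] {v : E}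
    (h : F.Reach F.start v) (hv : F.Rejecting v) :
    ∃ r : ℝ, IsSmallestEigenvalue (F.graph.overlap.map (Nat.cast : ℕ → ℝ)) r ∧
      (8 * (Fintype.card E : ℝ) ^ 2)⁻¹ ≤ r := by
  have : Nonempty E := ⟨F.start⟩
  refine exists_isSmallestEigenvalue_ge F.graph.posSemidef_map_overlap.1 fun z => ?_
  rw [EdgeGraph.dotProduct_map_overlap_mulVec, inv_mul_le_iff₀ (by positivity)]
  refine (dotProduct_self_le_of_mul_eq_one (incidenceInverse_mul_incidence h hv)
    (abs_incidenceInverse_le v) z).trans_eq ?_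
  rw [Fintype.card_sum]
  push_cast
  ring

end Forest

/-! ### Binary counters -/

namespace Timer

variable {L : ℕ} (t : Fin L → Bool)

/-- The bits of a counter, the lowest first, extended by `false`. -/
def bit (k : ℕ) : Bool := if h : k < L then t ⟨k, h⟩ else false

/-- The carries into the bits when adding one; `carry t L` signals overflow. -/
def carry : ℕ → Bool
  | 0 => true
  | k + 1 => carry k && bit t k

/-- The borrows from the bits when subtracting one; `borrow t L` signals underflow. -/
def borrow : ℕ → Bool
  | 0 => true
  | k + 1 => borrow k && !bit t k

/-- The successor of a counter, modulo `2 ^ L`. -/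
def inc : Fin L → Bool := fun k => xor (t k) (carry t k)

/-- The predecessor of a counter, modulo `2 ^ L`. -/
def dec : Fin L → Bool := fun k => xor (t k) (borrow t k)

/-- The number represented by the lowest `n` bits. -/
def val (n : ℕ) : ℕ := ∑ k ∈ Finset.range n, (bit t k).toNat * 2 ^ k

theorem val_succ (n : ℕ) : val t (n + 1) = val t n + (bit t n).toNat * 2 ^ n :=
  Finset.sum_range_succ _ _

theorem bit_inc {k : ℕ} (hk : k < L) : bit (inc t) k = xor (bit t k) (carry t k) := by
  simp [bit, hk, inc]

theorem bit_dec {k : ℕ} (hk : k < L) : bit (dec t) k = xor (bit t k) (borrow t k) := by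
  simp [bit, hk, dec]

theorem val_inc {n : ℕ} (hn : n ≤ L) :
    val (inc t) n + (carry t n).toNat * 2 ^ n = val t n + 1 := by
  induction n with
  | zero => simp [val, carry]
  | succ n ih =>
    have hlow := ih (by omega)
    rw [val_succ, val_succ, carry, bit_inc t (show n < L by omega), pow_succ]
    cases bit t n <;> cases hc : carry t n <;> simp [hc] at hlow ⊢ <;> omega

theorem borrow_inc {n : ℕ} (hn : n ≤ L) : borrow (inc t) n = carry t n := by
  induction n with
  | zero => rfl
  | succ n ih =>
    simp only [borrow, carry, bit_inc t (show n < L by omega), ih (by omega)]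
    cases bit t n <;> cases carry t n <;> rfl

theorem carry_dec {n : ℕ} (hn : n ≤ L) : carry (dec t) n = borrow t n := by
  induction n with
  | zero => rfl
  | succ n ih =>
    simp only [borrow, carry, bit_dec t (show n < L by omega), ih (by omega)]
    cases bit t n <;> cases borrow t n <;> rfl

theorem dec_inc : dec (inc t) = t := by
  funext k
  simp only [dec, borrow_inc t k.2.le]
  simp [inc]

theorem inc_dec : inc (dec t) = t := by
  funext k
  simp only [inc, carry_dec t k.2.le]
  simp [dec]

theorem val_lt (n : ℕ) : val t n < 2 ^ n := by
  induction n with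
  | zero => simp [val]
  | succ n ih =>
    rw [val_succ, pow_succ]
    cases bit t n <;> simp <;> omega

theorem val_inc_of_carry_eq_false (h : carry t L = false) : val (inc t) L = val t L + 1 := by
  simpa [h] using val_inc t le_rfl

theorem carry_eq_true_iff : carry t L = true ↔ val t L + 1 = 2 ^ L := by
  have hinc := val_inc t le_rfl
  have hlt := val_lt (inc t) L
  have hlt' := val_lt t L
  cases h : carry t L <;> simp [h] at hinc ⊢ <;> omega

theorem borrow_eq_true_iff (n : ℕ) : borrow t n = true ↔ ∀ k < n, bit t k = false := by
  induction n with
  | zero => simp [borrow]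
  | succ n ih =>
    simp only [borrow, Bool.and_eq_true, ih, Bool.not_eq_true', Nat.forall_lt_succ_right]

theorem borrow_eq_true_iff_eq_zero : borrow t L = true ↔ t = fun _ => false := by
  rw [borrow_eq_true_iff]
  refine ⟨fun h => funext fun k => by simpa [bit] using h k k.2, ?_⟩
  rintro rfl
  simp [bit]

theorem inc_ne {t : Fin L → Bool} (h : carry t L = false) : inc t ≠ t := fun he => by
  simpa [he] using val_inc_of_carry_eq_false t h

end Timer

/-! ### Machines with rotating tapes -/

/-- The possible motions of a track. -/
inductive Shift where
  | stay | left | right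

/-- The column from which the new contents of a column are taken, relative to it. -/
def Shift.offset {d : ℕ} : Shift → Fin (d + 2)
  | stay => 0
  | left => 1
  | right => -1

/-- A machine with `q` control bits and a cyclic tape with columns of `w` bits. In a step, the
control and the column `0` are rewritten by `rule`, and then each of the `w` tracks of the tape may
rotate by one column, depending on the new control. Moving the tape instead of a head keeps all
rewriting local. -/
structure RotMachine where
  q : ℕ
  w : ℕ
  rule : (Fin q → Bool) × (Fin w → Bool) → (Fin q → Bool) × (Fin w → Bool)
  shift : (Fin q → Bool) → Fin w → Shift
  accept : (Fin q → Bool) → Bool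
  start : Fin q → Bool
  code : Bool → Fin w → Bool

namespace RotMachine

variable (M : RotMachine) (d : ℕ)

/-- The tapes with `d + 2` columns. -/
abbrev Tape : Type := Fin (d + 2) → Fin M.w → Bool

/-- The configurations with `d + 2` columns. -/
abbrev Config : Type := (Fin M.q → Bool) × M.Tape d

variable {M d}

/-- The first half of a step: the control and the column `0` are rewritten. -/
def rewrite (c : M.Config d) : M.Config d :=
  ((M.rule (c.1, c.2 0)).1, update c.2 0 (M.rule (c.1, c.2 0)).2)

/-- The rotation of the tracks. -/
def rot (σ : Fin M.w → Shift) (cell : M.Tape d) : M.Tape d :=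
  fun i j => cell (i + (σ j).offset) j

/-- The inverse of `rot`. -/
def unrot (σ : Fin M.w → Shift) (cell : M.Tape d) : M.Tape d :=
  fun i j => cell (i - (σ j).offset) j

theorem rot_unrot (σ : Fin M.w → Shift) (cell : M.Tape d) : rot σ (unrot σ cell) = cell := by
  funext i j; simp [rot, unrot]

theorem unrot_rot (σ : Fin M.w → Shift) (cell : M.Tape d) : unrot σ (rot σ cell) = cell := by
  funext i j; simp [rot, unrot]

/-- The second half of a step: the tracks rotate. -/
def move (c : M.Config d) : M.Config d := (c.1, rot (M.shift c.1) c.2)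

theorem move_injective : Injective (move : M.Config d → M.Config d) :=
  LeftInverse.injective (g := fun c => (c.1, unrot (M.shift c.1) c.2)) fun c => by
    simp [move, unrot_rot]

/-- One step of the machine. -/
def step (c : M.Config d) : M.Config d := move (rewrite c)

variable (M d)

/-- The number of bits of a configuration and the phase. A counter with so many bits does not
overflow before every configuration has been visited. -/
def len : ℕ := 1 + M.q + M.w * (d + 2)

/-- The column `i` of the initial tape with the input `x`. -/
def startCell (x : List Bool) (i : ℕ) : Fin M.w → Bool :=
  if h : i < x.length then M.code x[i] else fun _ => false

/-- The initial configuration with the input `x`. -/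
def init (x : List Bool) : M.Config d := (M.start, fun i => M.startCell x i)

/-! ### The forest of the computations of a machine -/

/-- The indices of the matrix: configurations with the time, where `phase` says whether the
configuration has been rewritten already and only waits for the rotation of the tracks. The vertices
with `aux` serve as the dead vertices of the forest. -/
@[ext]
structure Vertex where
  aux : Bool
  phase : Bool
  config : M.Config d
  timer : Fin (M.len d) → Bool

variable {M d}

/-- The vertex that follows `v`. -/
def next (v : M.Vertex d) : M.Vertex d :=
  if v.phase then ⟨v.aux, false, move v.config, Timer.inc v.timer⟩
  else ⟨v.aux, true, rewrite v.config, v.timer⟩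

variable (M d)

/-- The initial vertex. -/
def startVertex (x : List Bool) : M.Vertex d := ⟨false, false, M.init d x, fun _ => false⟩

/-- The name of the half-edge at the initial vertex. -/
def halfVertex (x : List Bool) : M.Vertex d := ⟨true, false, M.init d x, fun _ => false⟩

/-- The forest of the computations. The timer makes it acyclic: a vertex is a root when its timer
would overflow in the next step. -/
def forest (x : List Bool) : Forest (M.Vertex d) where
  live v := v.aux = false
  root v := v.phase = true ∧ Timer.carry v.timer (M.len d) = true
  accept v := M.accept v.config.1 = true
  next := next
  start := M.startVertex d x
  half := M.halfVertex d x
  rank v := 2 * Timer.val v.timer (M.len d) + v.phase.toNat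
  live_start := rfl
  not_root_start := by simp [startVertex]
  rank_start := by simp [startVertex, Timer.val, Timer.bit]
  not_live_half := by simp [halfVertex]
  live_next v hv _ := by
    unfold next
    split_ifs <;> exact hv
  rank_next v _ hr := by
    unfold next
    split_ifs with h
    · have hval := Timer.val_inc_of_carry_eq_false v.timer (by simpa [h] using hr)
      simp only [hval, h, Bool.toNat_false, Bool.toNat_true]
      ring
    · simp [h]

variable {M d}

theorem exists_reach_iterate (x : List Bool) : ∀ n < 2 ^ M.len d, ∃ t : Fin (M.len d) → Bool,
    Timer.val t (M.len d) = n ∧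
      (M.forest d x).Reach (M.startVertex d x) ⟨false, false, step^[n] (M.init d x), t⟩ := by
  intro n
  induction n with
  | zero => exact fun _ => ⟨fun _ => false, by simp [Timer.val, Timer.bit], .refl⟩
  | succ n ih =>
    intro hn
    obtain ⟨t, ht, hr⟩ := ih (by omega)
    have hc : Timer.carry t (M.len d) = false := by
      rw [← Bool.not_eq_true, Timer.carry_eq_true_iff]
      omega
    have hrewrite : (M.forest d x).Step ⟨false, false, step^[n] (M.init d x), t⟩
        ⟨false, true, rewrite (step^[n] (M.init d x)), t⟩ :=
      ⟨rfl, by simp [forest], by simp [forest, next]⟩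
    have hmove : (M.forest d x).Step ⟨false, true, rewrite (step^[n] (M.init d x)), t⟩
        ⟨false, false, step^[n + 1] (M.init d x), Timer.inc t⟩ :=
      ⟨rfl, by simp [forest, hc], by simp [forest, next, iterate_succ_apply', step]⟩
    exact ⟨Timer.inc t, by rw [Timer.val_inc_of_carry_eq_false t hc, ht],
      (hr.tail hrewrite).tail hmove⟩

theorem iterate_eq_of_isFixedPt {α : Type} [Fintype α] (f : α → α) {a b : α} {n : ℕ}
    (hn : f^[n] a = b) (hb : IsFixedPt f b) {N : ℕ} (hN : Fintype.card α ≤ N) : f^[N] a = b := by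
  obtain ⟨i, j, hij, he⟩ := Fintype.exists_ne_map_eq_of_card_lt
    (fun i : Fin (N + 1) => f^[i] a) (by simpa using Nat.lt_succ_of_le hN)
  wlog hlt : i < j generalizing i j
  · exact this j i hij.symm he.symm (lt_of_le_of_ne (not_lt.1 hlt) hij.symm)
  have hstay : ∀ m, n ≤ m → f^[m] a = b := fun m hm => by
    rw [← Nat.sub_add_cancel hm, iterate_add_apply, hn]
    exact iterate_fixed hb _
  have hperiodic : IsPeriodicPt f (j - i : ℕ) (f^[i] a) := by
    rw [IsPeriodicPt, IsFixedPt, ← iterate_add_apply, Nat.sub_add_cancel (by omega), ← he]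
  have hi : f^[i] a = b := by
    have hle : n ≤ (j - i : ℕ) * n + i :=
      le_add_right (Nat.le_mul_of_pos_left n (by omega))
    rw [← hstay _ hle, iterate_add_apply]
    exact (hperiodic.mul_const n).symm
  rw [← Nat.sub_add_cancel (show (i : ℕ) ≤ N by omega), iterate_add_apply, hi]
  exact iterate_fixed hb _

theorem card_config_lt : Fintype.card (M.Config d) < 2 ^ M.len d := by
  have hcard : Fintype.card (M.Config d) = 2 ^ (M.q + M.w * (d + 2)) := by
    simp [pow_add, pow_mul]
  rw [hcard, len, add_assoc]
  exact Nat.pow_lt_pow_right one_lt_two (by omega)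

theorem exists_reach_root_of_fixed {x : List Bool} {n : ℕ} {c : M.Config d}
    (hn : step^[n] (M.init d x) = c) (hc : step c = c) : ∃ v : M.Vertex d,
      (M.forest d x).root v ∧ (M.forest d x).Reach (M.startVertex d x) v ∧ v.config.1 = c.1 := by
  have hcard := card_config_lt (M := M) (d := d)
  obtain ⟨t, ht, hreach⟩ := exists_reach_iterate (M := M) (d := d) x (2 ^ M.len d - 1) (by omega)
  rw [iterate_eq_of_isFixedPt step hn hc (Nat.le_sub_one_of_lt hcard)] at hreach
  refine ⟨⟨false, true, rewrite c, t⟩, ⟨rfl, (Timer.carry_eq_true_iff t).2 (by omega)⟩,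
    hreach.tail ⟨rfl, by simp [forest], by simp [forest, next]⟩, ?_⟩
  exact (congrArg Prod.fst hc : (step c).1 = c.1)

/-! ### The rows of the overlap matrix -/

variable (M) in
/-- The part of a vertex that a step may change by rewriting. -/
@[ext]
structure LocalPart where
  aux : Bool
  phase : Bool
  ctrl : Fin M.q → Bool
  col : Fin M.w → Bool

namespace LocalPart

/-- The local part of the other vertex with the same configuration. -/
def flip (p : M.LocalPart) : M.LocalPart := { p with aux := !p.aux }

/-- The rewriting steps, seen on the local parts. -/
def Step (p u : M.LocalPart) : Prop :=
  p.aux = false ∧ p.phase = false ∧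
    u = ⟨false, true, (M.rule (p.ctrl, p.col)).1, (M.rule (p.ctrl, p.col)).2⟩

/-- The local part belongs to a rejecting root; `last` tells whether the timer is maximal. -/
def Rejecting (last : Bool) (p : M.LocalPart) : Prop :=
  (p.phase = true ∧ last = true) ∧ ¬ M.accept p.ctrl = true

/-- Two vertices that differ in the local part only have the same successor; `last` tells whether
their timer is maximal. -/
def CommonNext (last : Bool) (p u : M.LocalPart) : Prop :=
  p.aux = false ∧ u.aux = false ∧
    ((p.phase = false ∧ u.phase = false ∧ M.rule (p.ctrl, p.col) = M.rule (u.ctrl, u.col)) ∨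
      (p.phase = true ∧ u = p ∧ last = false))

open scoped Classical in
/-- The entry of the matrix at two indices that differ in the local part only. The flags tell
whether their timer is maximal, and whether they are, up to `aux`, the initial vertex. -/
noncomputable def entry (last start : Bool) (p u : M.LocalPart) : ℕ :=
  (if u = p ∨ (start = true ∧ u = p.flip) then 1 else 0) +
    (if p.Step u ∧ ¬ u.Rejecting last then 1 else 0) +
    ((if u.Step p ∧ ¬ p.Rejecting last then 1 else 0) +
      (if p.CommonNext last u then 1 else 0))

theorem entry_le_two (last start : Bool) (p u : M.LocalPart) : entry last start p u ≤ 2 := by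
  unfold entry flip Step CommonNext
  split_ifs <;> grind

/-- The vertex with the local part `p` has a successor with the control `q`, reached by a rotation;
`last` tells whether its timer is maximal. -/
def HasForward (last : Bool) (q : Fin M.q → Bool) (p : M.LocalPart) : Prop :=
  p.aux = false ∧ p.phase = true ∧ p.ctrl = q ∧ last = false

/-- The vertex with the local part `p` has a predecessor with the control `q`, from which it is
reached by a rotation; `zero` tells whether its timer is zero. -/
def HasBackward (zero : Bool) (q : Fin M.q → Bool) (p : M.LocalPart) : Prop :=
  p.aux = false ∧ p.phase = false ∧ p.ctrl = q ∧ zero = false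

end LocalPart

namespace Vertex

/-- The local part of a vertex. -/
def localPart (v : M.Vertex d) : M.LocalPart := ⟨v.aux, v.phase, v.config.1, v.config.2 0⟩

/-- The vertex with the local part replaced. -/
def setLocal (v : M.Vertex d) (u : M.LocalPart) : M.Vertex d :=
  ⟨u.aux, u.phase, (u.ctrl, update v.config.2 0 u.col), v.timer⟩

/-- The vertex reached from `v` by a rotation, if the control is `q`. -/
def forward (v : M.Vertex d) (q : Fin M.q → Bool) : M.Vertex d :=
  ⟨false, false, (v.config.1, rot (M.shift q) v.config.2), Timer.inc v.timer⟩

/-- The vertex from which `v` is reached by a rotation, if the control is `q`. -/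
def backward (v : M.Vertex d) (q : Fin M.q → Bool) : M.Vertex d :=
  ⟨false, true, (v.config.1, unrot (M.shift q) v.config.2), Timer.dec v.timer⟩

/-- The timer is maximal. -/
def isLast (v : M.Vertex d) : Bool := Timer.carry v.timer (M.len d)

/-- The timer is zero. -/
def isFirst (v : M.Vertex d) : Bool := Timer.borrow v.timer (M.len d)

/-- The vertex is, up to `aux`, the initial one. -/
def isStart (x : List Bool) (v : M.Vertex d) : Bool :=
  decide (v.phase = false ∧ v.config = M.init d x ∧ v.isFirst = true)

@[simp]
theorem setLocal_localPart (v : M.Vertex d) : v.setLocal v.localPart = v := by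
  simp [setLocal, localPart]

@[simp]
theorem localPart_setLocal (v : M.Vertex d) (u : M.LocalPart) : (v.setLocal u).localPart = u := by
  simp [setLocal, localPart]

@[simp]
theorem setLocal_setLocal (v : M.Vertex d) (u u' : M.LocalPart) :
    (v.setLocal u).setLocal u' = v.setLocal u' := by
  simp [setLocal]

theorem setLocal_injective (v : M.Vertex d) : Injective v.setLocal :=
  LeftInverse.injective v.localPart_setLocal

end Vertex

end RotMachine

namespace RotMachine

variable {M : RotMachine} {d : ℕ} (x : List Bool)

theorem Vertex.swap_start_half_iff (e e' : M.Vertex d) :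
    ((e = (M.forest d x).start ∧ e' = (M.forest d x).half) ∨
      (e = (M.forest d x).half ∧ e' = (M.forest d x).start)) ↔
      e.isStart x = true ∧ e' = e.setLocal e.localPart.flip := by
  change (e = M.startVertex d x ∧ e' = M.halfVertex d x) ∨
    (e = M.halfVertex d x ∧ e' = M.startVertex d x) ↔ _
  obtain ⟨a, b, c, t⟩ := e
  obtain ⟨a', b', c', t'⟩ := e'
  cases a <;> simp [isStart, isFirst, startVertex, halfVertex, setLocal, localPart,
    LocalPart.flip, Timer.borrow_eq_true_iff_eq_zero] <;> grind

theorem next_eq_setLocal {v : M.Vertex d} (hp : v.phase = false) :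
    next v = v.setLocal ⟨v.aux, true, (M.rule (v.config.1, v.config.2 0)).1,
      (M.rule (v.config.1, v.config.2 0)).2⟩ := by
  simp [next, hp, Vertex.setLocal, rewrite]

theorem next_eq_forward {v : M.Vertex d} (ha : v.aux = false) (hp : v.phase = true) :
    next v = v.forward v.config.1 := by
  simp [next, ha, hp, Vertex.forward, move]

theorem backward_next {v : M.Vertex d} (ha : v.aux = false) (hp : v.phase = true) :
    (next v).backward (next v).config.1 = v := by
  obtain ⟨a, b, c, t⟩ := v
  simp only at ha hp
  subst ha hp
  simp [next, Vertex.backward, move, unrot_rot, Timer.dec_inc]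

theorem next_backward {v : M.Vertex d} (ha : v.aux = false) (hp : v.phase = false) :
    next (v.backward v.config.1) = v := by
  obtain ⟨a, b, c, t⟩ := v
  simp only at ha hp
  subst ha hp
  simp [next, Vertex.backward, move, rot_unrot, Timer.inc_dec]

theorem next_eq_next_iff (v w : M.Vertex d) : next v = next w ↔
    v.aux = w.aux ∧ ((v.phase = false ∧ w.phase = false ∧ rewrite v.config = rewrite w.config ∧
      v.timer = w.timer) ∨ (v.phase = true ∧ v = w)) := by
  obtain ⟨a, b, c, t⟩ := v
  obtain ⟨a', b', c', t'⟩ := w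
  have hinc : Timer.inc t = Timer.inc t' ↔ t = t' :=
    (LeftInverse.injective (g := Timer.dec) Timer.dec_inc).eq_iff
  cases b <;> cases b' <;> simp [next, hinc, move_injective.eq_iff]

theorem forest_step_setLocal_iff (e : M.Vertex d) (u : M.LocalPart) :
    (M.forest d x).Step e (e.setLocal u) ↔ e.localPart.Step u := by
  constructor
  · rintro ⟨ha, hr, hn⟩
    cases hp : e.phase with
    | false =>
      refine ⟨ha, hp, ?_⟩
      have ha' : e.aux = false := ha
      rw [← e.localPart_setLocal u, ← hn]
      change (next e).localPart = _
      rw [next_eq_setLocal hp, Vertex.localPart_setLocal, ha']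
      rfl
    | true =>
      have hinc : Timer.inc e.timer = e.timer := by
        simpa [forest, next, hp, Vertex.setLocal] using congrArg Vertex.timer hn
      exact absurd hinc (Timer.inc_ne (by simpa [forest, hp] using hr))
  · rintro ⟨ha, hp, rfl⟩
    have ha' : e.aux = false := ha
    exact ⟨ha, fun h => by simp [Vertex.localPart, h.1] at hp,
      (next_eq_setLocal hp).trans (by simp [Vertex.localPart, ha'])⟩

theorem forest_rejecting_iff (e : M.Vertex d) :
    (M.forest d x).Rejecting e ↔ e.localPart.Rejecting e.isLast :=
  Iff.rfl

theorem forest_commonNext_iff (e : M.Vertex d) (u : M.LocalPart) :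
    (∃ w, (M.forest d x).Step e w ∧ (M.forest d x).Step (e.setLocal u) w) ↔
      e.localPart.CommonNext e.isLast u := by
  have hrewrite : rewrite e.config = rewrite (e.setLocal u).config ↔
      M.rule (e.config.1, e.config.2 0) = M.rule (u.ctrl, u.col) := by
    simp [rewrite, Vertex.setLocal, (update_injective e.config.2 0).eq_iff, Prod.ext_iff]
  have hself : e = e.setLocal u ↔ u = e.localPart := by
    rw [← e.setLocal_injective.eq_iff, Vertex.setLocal_localPart, eq_comm]
  calc (∃ w, (M.forest d x).Step e w ∧ (M.forest d x).Step (e.setLocal u) w)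
      ↔ ((M.forest d x).live e ∧ ¬ (M.forest d x).root e) ∧
          ((M.forest d x).live (e.setLocal u) ∧ ¬ (M.forest d x).root (e.setLocal u)) ∧
          next e = next (e.setLocal u) :=
        ⟨fun ⟨_, h, h'⟩ => ⟨⟨h.1, h.2.1⟩, ⟨h'.1, h'.2.1⟩, h.2.2.trans h'.2.2.symm⟩,
          fun ⟨h, h', he⟩ => ⟨next e, ⟨h.1, h.2, rfl⟩, h'.1, h'.2, he.symm⟩⟩
    _ ↔ e.localPart.CommonNext e.isLast u := by
        rw [next_eq_next_iff, hrewrite, hself]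
        simp only [forest, Vertex.setLocal, LocalPart.CommonNext, Vertex.localPart, Vertex.isLast]
        grind

theorem overlap_setLocal (e : M.Vertex d) (u : M.LocalPart) :
    (M.forest d x).graph.overlap e (e.setLocal u) =
      e.localPart.entry e.isLast (e.isStart x) u := by
  classical
  have hself : e = e.setLocal u ↔ u = e.localPart := by
    rw [← e.setLocal_injective.eq_iff, Vertex.setLocal_localPart, eq_comm]
  have htail : (e = e.setLocal u ∨
      (e = (M.forest d x).start ∧ e.setLocal u = (M.forest d x).half) ∨
      (e = (M.forest d x).half ∧ e.setLocal u = (M.forest d x).start)) ↔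
      (u = e.localPart ∨ (e.isStart x = true ∧ u = e.localPart.flip)) := by
    rw [hself, Vertex.swap_start_half_iff, e.setLocal_injective.eq_iff]
  have hforward := forest_step_setLocal_iff x e u
  have hbackward := forest_step_setLocal_iff x (e.setLocal u) e.localPart
  rw [Vertex.setLocal_setLocal, Vertex.setLocal_localPart, Vertex.localPart_setLocal] at hbackward
  have hreject := forest_rejecting_iff x (e.setLocal u)
  rw [Vertex.localPart_setLocal, show (e.setLocal u).isLast = e.isLast from rfl] at hreject
  simp only [Forest.overlap_apply, LocalPart.entry, htail, hforward, hbackward, hreject,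
    forest_rejecting_iff, forest_commonNext_iff]

theorem overlap_forward (e : M.Vertex d) (q : Fin M.q → Bool)
    (h : e.localPart.HasForward e.isLast q) :
    (M.forest d x).graph.overlap e (e.forward q) = 1 := by
  obtain ⟨ha, hp, rfl, hlast⟩ := h
  refine Forest.Step.overlap_eq_one ⟨ha, fun hr => ?_, next_eq_forward ha hp⟩ fun hr => ?_
  · exact Bool.noConfusion (hlast.symm.trans hr.2)
  · exact Bool.noConfusion hr.1.1

theorem overlap_backward (e : M.Vertex d) (q : Fin M.q → Bool)
    (h : e.localPart.HasBackward e.isFirst q) :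
    (M.forest d x).graph.overlap e (e.backward q) = 1 := by
  obtain ⟨ha, hp, rfl, hfirst⟩ := h
  rw [(M.forest d x).graph.overlap_isSymm.apply]
  refine Forest.Step.overlap_eq_one ⟨rfl, fun hr => ?_, next_backward ha hp⟩ fun hr => ?_
  · have hcarry : Timer.borrow e.timer (M.len d) = true :=
      (Timer.carry_dec e.timer le_rfl).symm.trans hr.2
    exact Bool.noConfusion (hfirst.symm.trans hcarry)
  · exact Bool.noConfusion (hp.symm.trans hr.1.1)

theorem exists_of_step {e e' : M.Vertex d} (h : (M.forest d x).Step e e') :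
    (∃ u, e.setLocal u = e' ∧ e'.setLocal e.localPart = e) ∨
      (∃ q, e.forward q = e' ∧ e.localPart.HasForward e.isLast q) ∧
        ∃ q, e'.backward q = e ∧ e'.localPart.HasBackward e'.isFirst q := by
  obtain ⟨ha, hr, rfl⟩ := h
  change e.aux = false at ha
  cases hp : e.phase with
  | false =>
    left
    refine ⟨_, (next_eq_setLocal hp).symm, ?_⟩
    change (next e).setLocal _ = _
    rw [next_eq_setLocal hp, Vertex.setLocal_setLocal, Vertex.setLocal_localPart]
  | true =>
    right
    have hlast : e.isLast = false := by simpa [forest, hp, Vertex.isLast] using hr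
    refine ⟨⟨_, (next_eq_forward ha hp).symm, ha, hp, rfl, hlast⟩, _, backward_next ha hp, ?_⟩
    have hnext : next e = ⟨false, false, move e.config, Timer.inc e.timer⟩ := by
      simp [next, ha, hp]
    change (next e).localPart.HasBackward (next e).isFirst _
    rw [hnext]
    exact ⟨rfl, rfl, rfl, (Timer.borrow_inc e.timer le_rfl).trans hlast⟩

theorem exists_setLocal_of_next_eq {e e' : M.Vertex d} (h : next e = next e') :
    ∃ u, e.setLocal u = e' := by
  obtain ⟨ha, ⟨-, -, hr, ht⟩ | ⟨-, rfl⟩⟩ := (next_eq_next_iff e e').1 h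
  · refine ⟨e'.localPart, ?_⟩
    rw [← e'.setLocal_localPart]
    have hcell : update e.config.2 0 (e'.config.2 0) = update e'.config.2 0 (e'.config.2 0) := by
      simpa [rewrite] using
        congrArg (fun c : M.Config d => update c.2 0 (e'.config.2 0)) hr
    simp [Vertex.setLocal, Vertex.localPart, hcell, ht]
  · exact ⟨_, e.setLocal_localPart⟩

theorem exists_of_overlap_ne_zero {e e' : M.Vertex d}
    (h : (M.forest d x).graph.overlap e e' ≠ 0) :
    (∃ u, e.setLocal u = e') ∨
      (∃ q, e.forward q = e' ∧ e.localPart.HasForward e.isLast q) ∨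
      ∃ q, e.backward q = e' ∧ e.localPart.HasBackward e.isFirst q := by
  classical
  rw [Forest.overlap_apply] at h
  by_cases htail : e = e' ∨ (e = (M.forest d x).start ∧ e' = (M.forest d x).half) ∨
      (e = (M.forest d x).half ∧ e' = (M.forest d x).start)
  · left
    obtain rfl | hswap := htail
    · exact ⟨_, e.setLocal_localPart⟩
    · exact ⟨_, ((Vertex.swap_start_half_iff x e e').1 hswap).2.symm⟩
  by_cases hnext : (M.forest d x).Step e e'
  · exact (exists_of_step x hnext).imp (fun ⟨u, hu, _⟩ => ⟨u, hu⟩) fun hf => Or.inl hf.1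
  by_cases hprev : (M.forest d x).Step e' e
  · exact (exists_of_step x hprev).imp (fun ⟨_, _, hu⟩ => ⟨_, hu⟩) fun hb => Or.inr hb.2
  by_cases hcommon : ∃ w, (M.forest d x).Step e w ∧ (M.forest d x).Step e' w
  · left
    obtain ⟨w, h₁, h₂⟩ := hcommon
    exact exists_setLocal_of_next_eq (h₁.2.2.trans h₂.2.2.symm)
  · exact absurd (by simp [htail, hnext, hprev, hcommon]) h

theorem overlap_eq_iff {k : ℕ} (hk : k ≠ 0) (e e' : M.Vertex d) :
    (M.forest d x).graph.overlap e e' = k ↔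
      (∃ u, e.setLocal u = e' ∧ e.localPart.entry e.isLast (e.isStart x) u = k) ∨
      (∃ q, e.forward q = e' ∧ e.localPart.HasForward e.isLast q ∧ k = 1) ∨
      ∃ q, e.backward q = e' ∧ e.localPart.HasBackward e.isFirst q ∧ k = 1 := by
  constructor
  · rintro rfl
    obtain ⟨u, rfl⟩ | ⟨q, rfl, hq⟩ | ⟨q, rfl, hq⟩ := exists_of_overlap_ne_zero x hk
    · exact Or.inl ⟨u, rfl, (overlap_setLocal x e u).symm⟩
    · exact Or.inr (Or.inl ⟨q, rfl, hq, overlap_forward x e q hq⟩)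
    · exact Or.inr (Or.inr ⟨q, rfl, hq, overlap_backward x e q hq⟩)
  · rintro (⟨u, rfl, rfl⟩ | ⟨q, rfl, hq, rfl⟩ | ⟨q, rfl, hq, rfl⟩)
    · exact overlap_setLocal x e u
    · exact overlap_forward x e q hq
    · exact overlap_backward x e q hq

end RotMachine

/-! ### Simulation of stack machines by machines with rotating tapes -/

section BooleanCodes

/-- One-hot code of an element of a finite type. -/
noncomputable def oneHot {α : Type} [Finite α] (a : α) : Fin (Nat.card α) → Bool :=
  fun i => decide (Finite.equivFin α a = i)

theorem oneHot_injective {α : Type} [Finite α] : Injective (oneHot (α := α)) := fun _ _ h =>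
  (Finite.equivFin α).injective
    (of_decide_eq_true ((congrFun h _).trans (decide_eq_true rfl))).symm |>.symm

variable {K : Type} {Γ : K → Type} [Finite (Σ k, Γ k)]

open scoped Classical in
/-- Code of a family of cells, one for each stack: for each stack and each symbol, a bit tells
whether the cell of the stack holds the symbol. -/
noncomputable def cellCode (c : ∀ k, Option (Γ k)) : Fin (Nat.card (Σ k, Γ k)) → Bool :=
  fun j => decide (c ((Finite.equivFin (Σ k, Γ k)).symm j).1 =
    some ((Finite.equivFin (Σ k, Γ k)).symm j).2)

theorem cellCode_injective : Injective (cellCode (Γ := Γ)) := fun c c' h => by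
  have hbit : ∀ p : Σ k, Γ k, c p.1 = some p.2 ↔ c' p.1 = some p.2 := fun p => by
    obtain ⟨j, rfl⟩ := (Finite.equivFin (Σ k, Γ k)).symm.surjective p
    simpa only [cellCode, decide_eq_decide] using congrFun h j
  exact funext fun k => Option.ext fun a => hbit ⟨k, a⟩

theorem cellCode_none : cellCode (fun k => (none : Option (Γ k))) = fun _ => false := by
  simp [cellCode, funext_iff]

end BooleanCodes

namespace Simulation

attribute [local instance] Turing.FinTM2.kFin Turing.FinTM2.ΛFin Turing.FinTM2.σFin

open Turing

variable (M : TM2ComputableAux Bool Bool)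

/-- The statements that a machine may still have to execute; `none` when it has halted. -/
abbrev Statement : Type := {q // q ∈ TM2.stmts M.tm.m Finset.univ}

open scoped Classical in
/-- A statement of the machine as an element of `Statement`, with a junk value for others. -/
noncomputable def toStatement (q : Option (TM2.Stmt M.tm.Γ M.tm.Λ M.tm.σ)) : Statement M :=
  if h : q ∈ TM2.stmts M.tm.m Finset.univ then ⟨q, h⟩ else ⟨none, Finset.none_mem_insertNone⟩

/-- The control states of the simulating machine. A rotation is determined by the state after the
rewriting, so a pop is remembered by the state that follows it, and a push takes two steps: first
the tape rotates to make room, then the symbol is written. -/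
inductive Control where
  | run (q : Statement M) (v : M.tm.σ) (popped : Option M.tm.K)
  | write (a : Σ k, M.tm.Γ k) (q : Statement M) (v : M.tm.σ)
  | answer (b : Bool)

/-- The contents of the first cells of all stacks. -/
abbrev Cells : Type := ∀ k, Option (M.tm.Γ k)

variable {M}

/-- The control state that is about to execute `q`. -/
noncomputable def exec (q : TM2.Stmt M.tm.Γ M.tm.Λ M.tm.σ) (v : M.tm.σ)
    (popped : Option M.tm.K) : Control M :=
  .run (toStatement M (some q)) v popped

theorem exec_eq {q : TM2.Stmt M.tm.Γ M.tm.Λ M.tm.σ} (hq : some q ∈ TM2.stmts M.tm.m Finset.univ)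
    (v : M.tm.σ) (o : Option M.tm.K) : exec q v o = .run ⟨some q, hq⟩ v o := by
  rw [exec, toStatement, dif_pos hq]

theorem some_mem_stmts (l : M.tm.Λ) : some (M.tm.m l) ∈ TM2.stmts M.tm.m Finset.univ := by
  classical
  exact Finset.some_mem_insertNone.2
    (Finset.mem_biUnion.2 ⟨l, Finset.mem_univ l, TM2.stmts₁_self⟩)

/-- The effect of one step on the control and on the first cells of the stacks. -/
noncomputable def delta : Control M → Cells M → Control M × Cells M
  | .answer b, c => (.answer b, c)
  | .write a q v, c => (.run q v none, update c a.1 (some a.2))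
  | .run q v _, c => match q.1 with
    | none => (.answer (((c M.tm.k₁).map M.outputAlphabet).getD false), c)
    | some (.push k f q') => (.write ⟨k, f v⟩ (toStatement M (some q')) v, c)
    | some (.peek k f q') => (exec q' (f v (c k)) none, c)
    | some (.pop k f q') => (exec q' (f v (c k)) (some k), update c k none)
    | some (.load f q') => (exec q' (f v) none, c)
    | some (.branch f q₁ q₂) => (exec (cond (f v) q₁ q₂) v none, c)
    | some (.goto f) => (exec (M.tm.m (f v)) v none, c)
    | some .halt => (.run (toStatement M none) v none, c)

/-- The rotation of the tape that holds the stack `k`. -/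
def motion : Control M → M.tm.K → Shift
  | .run _ _ (some k'), k => if k = k' then .left else .stay
  | .write a _ _, k => if k = a.1 then .right else .stay
  | _, _ => .stay

/-- The number of pushes in a statement. -/
def pushes : TM2.Stmt M.tm.Γ M.tm.Λ M.tm.σ → ℕ
  | .push _ _ q => pushes q + 1
  | .peek _ _ q => pushes q
  | .pop _ _ q => pushes q
  | .load _ q => pushes q
  | .branch _ q₁ q₂ => pushes q₁ + pushes q₂
  | .goto _ => 0
  | .halt => 0

variable {d : ℕ}

/-- The cells of the tapes that hold the stacks `stk`. -/
def cells (stk : ∀ k, List (M.tm.Γ k)) : Fin (d + 2) → Cells M := fun i k => (stk k)[i.val]?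

theorem cells_zero (stk : ∀ k, List (M.tm.Γ k)) (k : M.tm.K) :
    cells (d := d) stk 0 k = (stk k).head? := by
  simp [cells, List.head?_eq_getElem?]

instance : Nonempty (Control M) := ⟨.answer false⟩

section

variable [∀ k, Finite (M.tm.Γ k)]

instance : Finite (Control M) := by
  refine .of_surjective (α := (Statement M × M.tm.σ × Option M.tm.K) ⊕
    ((Σ k, M.tm.Γ k) × Statement M × M.tm.σ) ⊕ Bool)
    (Sum.elim (fun p => .run p.1 p.2.1 p.2.2)
      (Sum.elim (fun p => .write p.1 p.2.1 p.2.2) .answer)) fun s => ?_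
  cases s with
  | run q v o => exact ⟨.inl (q, v, o), rfl⟩
  | write a q v => exact ⟨.inr (.inl (a, q, v)), rfl⟩
  | answer b => exact ⟨.inr (.inr b), rfl⟩

/-- The control state with a given code. -/
noncomputable def decodeControl : (Fin (Nat.card (Control M)) → Bool) → Control M :=
  invFun oneHot

/-- The cells with a given code. -/
noncomputable def decodeCells : (Fin (Nat.card (Σ k, M.tm.Γ k)) → Bool) → Cells M :=
  invFun cellCode

@[simp]
theorem decodeControl_oneHot (s : Control M) : decodeControl (oneHot s) = s :=
  leftInverse_invFun oneHot_injective s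

@[simp]
theorem decodeCells_cellCode (c : Cells M) : decodeCells (cellCode c) = c :=
  leftInverse_invFun cellCode_injective c

variable (M) in
open scoped Classical in
/-- The machine with rotating tapes that simulates `M`. -/
noncomputable def machine : RotMachine where
  q := Nat.card (Control M)
  w := Nat.card (Σ k, M.tm.Γ k)
  rule b := (oneHot (delta (decodeControl b.1) (decodeCells b.2)).1,
    cellCode (delta (decodeControl b.1) (decodeCells b.2)).2)
  shift b j := motion (decodeControl b) ((Finite.equivFin (Σ k, M.tm.Γ k)).symm j).1
  accept b := decide (decodeControl (M := M) b = .answer true)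
  start := oneHot (exec (M.tm.m M.tm.main) M.tm.initialState none)
  code b := cellCode (update (fun _ => none) M.tm.k₀ (some (M.inputAlphabet.symm b)))

/-- The configuration with given control and cells. -/
noncomputable def config (s : Control M) (g : Fin (d + 2) → Cells M) : (machine M).Config d :=
  (oneHot s, fun i => cellCode (g i))

theorem step_config (s : Control M) (g : Fin (d + 2) → Cells M) :
    RotMachine.step (config s g) = config (delta s (g 0)).1 fun i k =>
      update g 0 (delta s (g 0)).2 (i + (motion (delta s (g 0)).1 k).offset) k := by
  have hrewrite : RotMachine.rewrite (config s g) =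
      config (delta s (g 0)).1 (update g 0 (delta s (g 0)).2) := by
    refine Prod.ext (by simp [RotMachine.rewrite, config, machine]) ?_
    funext i
    by_cases hi : i = 0
    · subst hi
      simp [RotMachine.rewrite, config, machine]
    · simp [RotMachine.rewrite, config, machine, hi]
  rw [RotMachine.step, hrewrite]
  refine Prod.ext rfl ?_
  funext i j
  simp [RotMachine.move, RotMachine.rot, config, machine, cellCode]

theorem step_config_of_stay {s s' : Control M} {g : Fin (d + 2) → Cells M}
    (h : delta s (g 0) = (s', g 0)) (hm : motion s' = fun _ => .stay) :
    RotMachine.step (config s g) = config s' g := by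
  rw [step_config, h]
  simp [hm, Shift.offset]

theorem step_config_of_pop {s s' : Control M} {stk : ∀ k, List (M.tm.Γ k)} {k : M.tm.K}
    (h : delta s (cells (d := d) stk 0) = (s', update (cells (d := d) stk 0) k none))
    (hm : motion s' = fun k' => if k' = k then .left else .stay)
    (hlen : (stk k).length ≤ d + 2) :
    RotMachine.step (config (d := d) s (cells stk)) =
      config s' (cells (update stk k (stk k).tail)) := by
  rw [step_config, h, hm]
  congr 1
  funext i k'
  by_cases hk : k' = k
  · subst hk
    by_cases hi : i = Fin.last (d + 1)
    · subst hi
      simp [cells, hlen, Shift.offset]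
    · have hne : i + 1 ≠ 0 := fun h0 => by
        simpa [Fin.val_add_one, hi] using congrArg Fin.val h0
      simp [cells, hne, Fin.val_add_one, hi, Shift.offset]
  · by_cases hi : i = 0
    · subst hi
      simp [cells, hk, Shift.offset]
    · simp [cells, hk, hi, Shift.offset]

theorem step_config_of_push {s s' s'' : Control M} {stk : ∀ k, List (M.tm.Γ k)} {k : M.tm.K}
    {a : M.tm.Γ k} (h : ∀ c, delta s c = (s', c))
    (h' : ∀ c, delta s' c = (s'', update c k (some a)))
    (hm : motion s' = fun k' => if k' = k then .right else .stay)
    (hm' : motion s'' = fun _ => .stay) :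
    RotMachine.step (RotMachine.step (config (d := d) s (cells stk))) =
      config s'' (cells (update stk k (a :: stk k))) := by
  rw [step_config, h, step_config, h', hm, hm']
  congr 1
  funext i k'
  by_cases hi : i = 0
  · subst hi
    by_cases hk : k' = k
    · subst hk
      simp [cells, Shift.offset]
    · simp [cells, hk, Shift.offset]
  · by_cases hk : k' = k
    · subst hk
      obtain ⟨j, rfl⟩ := Fin.exists_succ_eq.2 hi
      have hj : (j.succ + -1 : Fin (d + 2)) = j.castSucc := by
        rw [← Fin.coeSucc_eq_succ, add_neg_cancel_right]
      simp [cells, hj, Shift.offset]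
    · simp [cells, hk, hi, Shift.offset]

/-- The simulating machine, with the control state `s` and the stacks `stk` on its tapes, comes to a
configuration that represents `c`. -/
def Leads (d : ℕ) (s : Control M) (stk : ∀ k, List (M.tm.Γ k))
    (c : TM2.Cfg M.tm.Γ M.tm.Λ M.tm.σ) : Prop :=
  ∃ (n : ℕ) (o : Option M.tm.K), RotMachine.step^[n] (config (d := d) s (cells stk)) =
    config (.run (toStatement M (c.l.map M.tm.m)) c.var o) (cells c.stk)

theorem Leads.of_iterate {s s' : Control M} {stk stk' : ∀ k, List (M.tm.Γ k)}
    {c : TM2.Cfg M.tm.Γ M.tm.Λ M.tm.σ} (n : ℕ) (h : Leads d s' stk' c)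
    (hn : RotMachine.step^[n] (config (d := d) s (cells stk)) = config s' (cells stk')) :
    Leads d s stk c := by
  obtain ⟨n', o, hn'⟩ := h
  exact ⟨n' + n, o, by rw [iterate_add_apply, hn, hn']⟩

theorem Leads.of_stay {s s' : Control M} {stk : ∀ k, List (M.tm.Γ k)}
    {c : TM2.Cfg M.tm.Γ M.tm.Λ M.tm.σ} (hc : Leads d s' stk c)
    (h : delta s (cells (d := d) stk 0) = (s', cells (d := d) stk 0))
    (hm : motion s' = fun _ => .stay) : Leads d s stk c :=
  .of_iterate 1 hc (step_config_of_stay h hm)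

theorem leads_stepAux (q : TM2.Stmt M.tm.Γ M.tm.Λ M.tm.σ) (v : M.tm.σ) (o : Option M.tm.K)
    (stk : ∀ k, List (M.tm.Γ k)) (hq : some q ∈ TM2.stmts M.tm.m Finset.univ)
    (hlen : ∀ k, (stk k).length + pushes q ≤ d + 2) :
    Leads d (exec q v o) stk (TM2.stepAux q v stk) := by
  classical
  induction q generalizing v o stk with
  | push k f q ih =>
    have hq' := TM2.stmts_trans (Finset.mem_insert_of_mem TM2.stmts₁_self) hq
    have hlen' : ∀ k', (update stk k (f v :: stk k) k').length + pushes q ≤ d + 2 := by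
      rw [forall_update_iff stk fun _ (l : List _) => l.length + pushes q ≤ d + 2]
      exact ⟨(Nat.add_right_comm _ 1 _).trans_le (hlen k),
        fun k' _ => (Nat.le_succ _).trans (hlen k')⟩
    exact .of_iterate 2 (ih v none _ hq' hlen')
      (step_config_of_push (fun c => by rw [exec_eq hq]; rfl) (fun _ => rfl) rfl rfl)
  | peek k f q ih =>
    refine .of_stay (ih (f v (stk k).head?) none stk
      (TM2.stmts_trans (Finset.mem_insert_of_mem TM2.stmts₁_self) hq) hlen) ?_ rfl
    simp [exec_eq hq, delta, cells_zero]
  | pop k f q ih =>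
    have hq' := TM2.stmts_trans (Finset.mem_insert_of_mem TM2.stmts₁_self) hq
    have hlen' : ∀ k', (update stk k (stk k).tail k').length + pushes q ≤ d + 2 := by
      rw [forall_update_iff stk fun _ (l : List _) => l.length + pushes q ≤ d + 2]
      exact ⟨le_trans (by simp [pushes]) (hlen k), fun k' _ => hlen k'⟩
    refine .of_iterate 1 (ih (f v (stk k).head?) (some k) _ hq' hlen')
      (step_config_of_pop ?_ rfl (Nat.le_of_add_right_le (hlen k)))
    simp only [exec_eq hq, delta, cells_zero]
  | load f q ih =>
    refine .of_stay (ih (f v) none stk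
      (TM2.stmts_trans (Finset.mem_insert_of_mem TM2.stmts₁_self) hq) hlen) ?_ rfl
    rw [exec_eq hq, delta]
  | branch f q₁ q₂ ih₁ ih₂ =>
    refine .of_stay (s' := exec (cond (f v) q₁ q₂) v none) ?_ (by rw [exec_eq hq, delta]) rfl
    have hq₁ := TM2.stmts_trans
      (Finset.mem_insert_of_mem (Finset.mem_union_left _ TM2.stmts₁_self)) hq
    have hq₂ := TM2.stmts_trans
      (Finset.mem_insert_of_mem (Finset.mem_union_right _ TM2.stmts₁_self)) hq
    rw [TM2.stepAux]
    cases f v with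
    | true => exact ih₁ v none stk hq₁ fun k => le_trans (by simp [pushes]) (hlen k)
    | false => exact ih₂ v none stk hq₂ fun k => le_trans (by simp [pushes]) (hlen k)
  | goto f =>
    exact .of_stay (s' := exec (M.tm.m (f v)) v none) ⟨0, none, rfl⟩ (by rw [exec_eq hq, delta]) rfl
  | halt =>
    exact .of_stay (s' := .run (toStatement M none) v none) ⟨0, none, rfl⟩
      (by rw [exec_eq hq, delta]) rfl

theorem leads_of_reaches {c₀ c : M.tm.Cfg} {l : M.tm.Λ} (hl : c₀.l = some l) {s : ℕ}
    (hs : s + ∑ l, pushes (M.tm.m l) ≤ d + 2)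
    (hspace : ∀ c, StateTransition.Reaches M.tm.step c₀ c → ∀ k, (c.stk k).length ≤ s)
    (h : StateTransition.Reaches M.tm.step c₀ c) :
    Leads d (exec (M.tm.m l) c₀.var none) c₀.stk c := by
  induction h with
  | refl => exact ⟨0, none, by rw [hl]; rfl⟩
  | @tail c' c'' hr hc ih =>
    obtain ⟨n, o, hn⟩ := ih
    obtain ⟨_ | l, v, stk⟩ := c'
    · exact absurd hc (Option.not_mem_none _)
    · obtain rfl : TM2.stepAux (M.tm.m l) v stk = c'' := Option.some_injective _ hc
      have hpushes : pushes (M.tm.m l) ≤ ∑ l, pushes (M.tm.m l) :=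
        Finset.single_le_sum (f := fun l => pushes (M.tm.m l)) (fun _ _ => Nat.zero_le _)
          (Finset.mem_univ l)
      exact .of_iterate n (leads_stepAux (M.tm.m l) v o stk (some_mem_stmts l) fun k =>
        (add_le_add (hspace _ hr k) hpushes).trans hs) hn

theorem init_machine (x : List Bool) :
    (machine M).init d x =
      config (exec (M.tm.m M.tm.main) M.tm.initialState none) (cells (initCfg M x).stk) := by
  classical
  refine Prod.ext rfl (funext fun i => ?_)
  have hcells : cells (d := d) (initCfg M x).stk i =
      update (fun _ => none) M.tm.k₀ (x[i.val]?.map M.inputAlphabet.symm) := by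
    funext k
    by_cases hk : k = M.tm.k₀
    · subst hk
      simp [cells, initCfg, initList]
    · simp [cells, initCfg, initList, hk]
  simp only [config, hcells]
  by_cases hi : i.val < x.length
  · simp [RotMachine.init, RotMachine.startCell, machine, hi]
  · simp [RotMachine.init, RotMachine.startCell, machine, hi, cellCode_none]

theorem step_config_answer (b : Bool) (g : Fin (d + 2) → Cells M) :
    RotMachine.step (config (.answer b) g) = config (.answer b) g :=
  step_config_of_stay rfl rfl

theorem step_config_haltList (v : M.tm.σ) (o : Option M.tm.K) (b : Bool) :
    RotMachine.step (config (d := d) (.run (toStatement M none) v o)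
        (cells (haltList M.tm [M.outputAlphabet.symm b]).stk)) =
      config (.answer b) (cells (haltList M.tm [M.outputAlphabet.symm b]).stk) := by
  refine step_config_of_stay ?_ rfl
  have hnone : none ∈ TM2.stmts M.tm.m Finset.univ := Finset.none_mem_insertNone
  simp [toStatement, hnone, delta, cells_zero, haltList]

theorem accept_config_answer (b : Bool) (g : Fin (d + 2) → Cells M) :
    (machine M).accept (config (.answer b) g).1 = b := by
  cases b <;> simp [machine, config]

end

end Simulation

theorem reaches_of_iterate {σ : Type*} {f : σ → Option σ} {a b : σ} {n : ℕ}
    (h : (flip bind f)^[n] (some a) = some b) : StateTransition.Reaches f a b := by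
  induction n generalizing b with
  | zero => exact Option.some_injective _ h ▸ .refl
  | succ n ih =>
    rw [iterate_succ_apply'] at h
    obtain ⟨c, hc, hb⟩ := Option.bind_eq_some_iff.1 h
    exact (ih hc).tail hb

open Simulation in
theorem exists_rotMachine (M : Turing.TM2ComputableAux Bool Bool)
    (hfin : ∀ k, Finite (M.tm.Γ k)) :
    ∃ (R : RotMachine) (C : ℕ), ∀ x b s d, AnswersInSpace M x b s → s + C ≤ d + 2 →
      ∃ (n : ℕ) (c : R.Config d), RotMachine.step^[n] (R.init d x) = c ∧ RotMachine.step c = c ∧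
        R.accept c.1 = b := by
  let _ := M.tm.kFin
  let _ := M.tm.ΛFin
  refine ⟨machine M, ∑ l, pushes (M.tm.m l), ?_⟩
  rintro x b s d ⟨⟨⟨N, hN⟩⟩, hspace⟩ hs
  have hspace' : ∀ c, StateTransition.Reaches M.tm.step (initCfg M x) c →
      ∀ k, (c.stk k).length ≤ s := fun c hc k =>
    (Finset.single_le_sum (f := fun k => (c.stk k).length) (fun _ _ => Nat.zero_le _)
      (Finset.mem_univ k)).trans (hspace c hc)
  obtain ⟨n, o, hn⟩ := leads_of_reaches rfl hs hspace' (reaches_of_iterate hN)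
  refine ⟨n + 1, config (.answer b) (cells (Turing.haltList M.tm [M.outputAlphabet.symm b]).stk),
    ?_, step_config_answer b _, accept_config_answer b _⟩
  rw [iterate_succ_apply', init_machine]
  exact (congrArg RotMachine.step hn).trans (step_config_haltList _ o b)

/-! ### Structured stack programs and their compilation to Turing machines -/

/-- Structured programs over a family of binary stacks. `loop k P` pops the stack `k` until it is
empty, and runs `P b` for every popped bit `b`. -/
inductive Prog (K : Type) where
  | skip
  | push (k : K) (b : Bool)
  | seq (P Q : Prog K)
  | loop (k : K) (P : Bool → Prog K)

namespace Prog

variable {K L : Type}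

/-- The control points of a program. -/
def Label : Prog K → Type
  | skip => Empty
  | push _ _ => Unit
  | seq P Q => Label P ⊕ Label Q
  | loop _ P => Option (Σ b, Label (P b))

instance finite_label : ∀ P : Prog K, Finite P.Label
  | skip => inferInstanceAs (Finite Empty)
  | push _ _ => inferInstanceAs (Finite Unit)
  | seq P Q =>
    haveI := finite_label P
    haveI := finite_label Q
    inferInstanceAs (Finite (Label P ⊕ Label Q))
  | loop _ P =>
    haveI := fun b => finite_label (P b)
    inferInstanceAs (Finite (Option (Σ b, Label (P b))))

/-- The label at which the program is entered, if its control points are embedded by `e` and it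
leaves to the label `exit`. -/
def entry : (P : Prog K) → (P.Label → L) → L → L
  | skip, _, exit => exit
  | push _ _, e, _ => e ()
  | seq P Q, e, exit => entry P (fun l => e (.inl l)) (entry Q (fun l => e (.inr l)) exit)
  | loop _ _, e, _ => e none

/-- The statements of a machine that runs the program. The internal state of the machine holds the
last bit that was popped. -/
def code : (P : Prog K) → (P.Label → L) → L → P.Label →
    Turing.TM2.Stmt (fun _ : K => Bool) L (Option Bool)
  | skip, _, _, l => nomatch l
  | push k b, _, exit, _ => .push k (fun _ => b) (.goto fun _ => exit)
  | seq P Q, e, exit, .inl l =>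
    code P (fun l => e (.inl l)) (entry Q (fun l => e (.inr l)) exit) l
  | seq _ Q, e, exit, .inr l => code Q (fun l => e (.inr l)) exit l
  | loop k P, e, exit, none => .pop k (fun _ o => o) (.goto fun v =>
      v.elim exit fun b => entry (P b) (fun l => e (some ⟨b, l⟩)) (e none))
  | loop _ P, e, _, some ⟨b, l⟩ => code (P b) (fun l => e (some ⟨b, l⟩)) (e none) l

variable [DecidableEq K]

/-- Big-step semantics: `Exec P s s' t` says that `P` transforms `s` into `s'` in `t` steps. -/
inductive Exec : Prog K → (K → List Bool) → (K → List Bool) → ℕ → Prop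
  | skip (s) : Exec skip s s 0
  | push (k b s) : Exec (push k b) s (update s k (b :: s k)) 1
  | seq {P Q s s' s'' t t'} : Exec P s s' t → Exec Q s' s'' t' → Exec (seq P Q) s s'' (t + t')
  | loop_nil {k P s} : s k = [] → Exec (loop k P) s s 1
  | loop_cons {k P s b l s' s'' t u} : s k = b :: l → Exec (P b) (update s k l) s' t →
      Exec (loop k P) s' s'' u → Exec (loop k P) s s'' (1 + t + u)

theorem iterate_bind_trans {α : Type*} {f : α → Option α} {a b : α} {c : Option α} {m n : ℕ}
    (h : (flip bind f)^[m] (some a) = some b) (h' : (flip bind f)^[n] (some b) = c) :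
    (flip bind f)^[m + n] (some a) = c := by
  rw [add_comm, iterate_add_apply, h, h']

theorem Exec.exists_iterate_step
    {m : L → Turing.TM2.Stmt (fun _ : K => Bool) L (Option Bool)}
    {P : Prog K} {s s' : K → List Bool} {t : ℕ} (h : Exec P s s' t) (e : P.Label → L) (exit : L)
    (hm : ∀ l, m (e l) = code P e exit l) (v : Option Bool) :
    ∃ v', (flip bind (Turing.TM2.step m))^[t] (some ⟨some (entry P e exit), v, s⟩) =
      some ⟨some exit, v', s'⟩ := by
  induction h generalizing exit v with
  | skip s => exact ⟨v, rfl⟩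
  | push k b s => exact ⟨v, by simp [flip, entry, hm (), code]⟩
  | seq _ _ ihP ihQ =>
    obtain ⟨v', hP⟩ := ihP (fun l => e (.inl l)) _ (fun l => hm (.inl l)) v
    obtain ⟨v'', hQ⟩ := ihQ (fun l => e (.inr l)) exit (fun l => hm (.inr l)) v'
    exact ⟨v'', iterate_bind_trans hP hQ⟩
  | @loop_nil k P s hs =>
    have hupdate : update s k [] = s := by rw [← hs, update_eq_self]
    exact ⟨none, by simp [flip, entry, hm none, code, hs, hupdate]⟩
  | @loop_cons k P s b l s' s'' t u hs _ _ ihP ihloop =>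
    obtain ⟨v', hP⟩ := ihP (fun l => e (some ⟨b, l⟩)) (e none) (fun l => hm (some ⟨b, l⟩)) (some b)
    obtain ⟨v'', hloop⟩ := ihloop e exit hm v'
    have hpop : (flip bind (Turing.TM2.step m))^[1]
        (some ⟨some (entry (loop k P) e exit), v, s⟩) =
        some ⟨some (entry (P b) (fun l => e (some ⟨b, l⟩)) (e none)), some b, update s k l⟩ := by
      simp [flip, entry, hm none, code, hs]
    exact ⟨v'', iterate_bind_trans (iterate_bind_trans hpop hP) hloop⟩

theorem Exec.length_le {P : Prog K} {s s' : K → List Bool} {t : ℕ} (h : Exec P s s' t) (k : K) :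
    (s' k).length ≤ (s k).length + t := by
  induction h with
  | skip s => rfl
  | push k' b s =>
    rcases eq_or_ne k k' with rfl | hk
    · simp
    · simp [hk]
  | seq _ _ ih ih' => omega
  | loop_nil _ => exact Nat.le_succ _
  | @loop_cons k' P s b l s' s'' t u hs _ _ ih ih' =>
    rcases eq_or_ne k k' with rfl | hk
    · simp only [update_self, hs, List.length_cons] at ih ⊢
      omega
    · simp only [update_of_ne hk] at ih
      omega

/-- Stacks which are empty except for one. -/
def only (k : K) (x : List Bool) : K → List Bool := update (fun _ => []) k x

variable [Finite K]

open scoped Classical in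
/-- The machine that runs the program `P`, with input stack `k₀` and output stack `k₁`. Its label
`none` clears the internal state before halting. -/
noncomputable def machine (P : Prog K) (k₀ k₁ : K) : Turing.FinTM2 :=
  letI := Fintype.ofFinite K
  letI := Fintype.ofFinite P.Label
  { K := K
    k₀ := k₀
    k₁ := k₁
    Γ := fun _ => Bool
    Λ := Option P.Label
    main := entry P some none
    σ := Option Bool
    initialState := none
    m := fun l => l.elim (.load (fun _ => none) .halt) (code P some none) }

theorem initList_machine (P : Prog K) (k₀ k₁ : K) (x : List Bool) :
    Turing.initList (machine P k₀ k₁) x = (⟨some (entry P some none), none, only k₀ x⟩ :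
      Turing.TM2.Cfg (fun _ : K => Bool) (Option P.Label) (Option Bool)) := by
  refine congrArg (Turing.TM2.Cfg.mk _ _) (funext fun (k : K) => ?_)
  change (dite (k = k₀) _ _ : List Bool) = _
  by_cases hk : k = k₀
  · subst hk
    simp [only]
    rfl
  · simp [only, hk]
    rfl

theorem haltList_machine (P : Prog K) (k₀ k₁ : K) (x : List Bool) :
    Turing.haltList (machine P k₀ k₁) x = (⟨none, none, only k₁ x⟩ :
      Turing.TM2.Cfg (fun _ : K => Bool) (Option P.Label) (Option Bool)) := by
  refine congrArg (Turing.TM2.Cfg.mk _ _) (funext fun (k : K) => ?_)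
  change (dite (k = k₁) _ _ : List Bool) = _
  by_cases hk : k = k₁
  · subst hk
    simp [only]
    rfl
  · simp [only, hk]
    rfl

theorem polyTime_of_exec (P : Prog K) (k₀ k₁ : K) (f : List Bool → List Bool) (p : Polynomial ℕ)
    (h : ∀ x, ∃ t ≤ p.eval x.length, Exec P (only k₀ x) (only k₁ (f x)) t) : PolyTime f := by
  choose t ht hP using h
  have hrun : ∀ x, (flip bind (machine P k₀ k₁).step)^[t x + 1]
      (some (Turing.initList (machine P k₀ k₁) x)) =
        some (Turing.haltList (machine P k₀ k₁) (f x)) := fun x => by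
    obtain ⟨v, hv⟩ := (hP x).exists_iterate_step (m := (machine P k₀ k₁).m) some none
      (fun _ => rfl) none
    rw [initList_machine, haltList_machine]
    exact iterate_bind_trans hv rfl
  refine ⟨{ tm := machine P k₀ k₁, inputAlphabet := Equiv.refl Bool,
            outputAlphabet := Equiv.refl Bool, time := p + 1,
            outputsFun := fun x => ⟨⟨t x + 1, ?_⟩, ?_⟩ }, fun _ => (inferInstance : Finite Bool)⟩
  · have hid : ∀ y, List.map (Equiv.refl Bool).invFun (id y) = y := List.map_id
    exact (congrArg (fun y => (flip bind (machine P k₀ k₁).step)^[t x + 1]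
      (some (Turing.initList (machine P k₀ k₁) y))) (hid x)).trans ((hrun x).trans
        (congrArg (fun y => some (Turing.haltList (machine P k₀ k₁) y)) (hid (f x)).symm))
  · simpa using ht x

end Prog

/-! ### Programs that print texts with loops -/

namespace Prog

variable {K : Type} [DecidableEq K]

/-- `P` transforms `s` into `s'` in at most `T` steps. -/
def ExecLE (P : Prog K) (s s' : K → List Bool) (T : ℕ) : Prop := ∃ t ≤ T, Exec P s s' t

theorem ExecLE.mono {P : Prog K} {s s' : K → List Bool} {T T' : ℕ} (h : ExecLE P s s' T)
    (hT : T ≤ T') : ExecLE P s s' T' :=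
  let ⟨t, ht, h⟩ := h
  ⟨t, ht.trans hT, h⟩

theorem ExecLE.seq {P Q : Prog K} {s s' s'' : K → List Bool} {T T' : ℕ} (h : ExecLE P s s' T)
    (hQ : ExecLE Q s' s'' T') : ExecLE (seq P Q) s s'' (T + T') :=
  let ⟨_, ht, h⟩ := h
  let ⟨_, ht', hQ⟩ := hQ
  ⟨_, add_le_add ht ht', h.seq hQ⟩

theorem execLE_skip (s : K → List Bool) : ExecLE skip s s 0 := ⟨0, le_rfl, .skip s⟩

theorem execLE_push (k : K) (b : Bool) (s : K → List Bool) :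
    ExecLE (push k b) s (update s k (b :: s k)) 1 := ⟨1, le_rfl, .push k b s⟩

/-- `S d r` is the state in which the bits `d` have been processed and the bits `r` are left. -/
theorem execLE_loop {k : K} {P : Bool → Prog K} (S : List Bool → List Bool → K → List Bool)
    (hk : ∀ d r, S d r k = r) (c : ℕ) (l : List Bool)
    (h : ∀ d b r, d ++ b :: r = l → ExecLE (P b) (update (S d (b :: r)) k r) (S (d ++ [b]) r) c) :
    ExecLE (loop k P) (S [] l) (S l []) ((c + 1) * l.length + 1) := by
  suffices H : ∀ r d, d ++ r = l → ExecLE (loop k P) (S d r) (S l []) ((c + 1) * r.length + 1) from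
    H l [] rfl
  intro r
  induction r with
  | nil =>
    rintro d rfl
    rw [List.append_nil]
    exact ⟨1, by simp, .loop_nil (hk _ _)⟩
  | cons b r ih =>
    intro d hd
    obtain ⟨t, ht, hbody⟩ := h d b r hd
    obtain ⟨u, hu, hrest⟩ := ih (d ++ [b]) (by simpa using hd)
    refine ⟨_, ?_, .loop_cons (hk _ _) hbody hrest⟩
    rw [List.length_cons, mul_add]
    omega

/-- Run the programs of a list in turn. -/
def seqAll : List (Prog K) → Prog K := List.foldr seq skip

/-- Empty the stack `k`. -/
def clear (k : K) : Prog K := loop k fun _ => skip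

/-- Move the bits of the stack `k` to the stack `l`, in reverse order. -/
def pour (k l : K) : Prog K := loop k fun b => push l b

/-- Move the bits of the stack `k` to the stack `l`, and push the bits `f b` onto the stack `m`. -/
def fork (f : Bool → Bool) (k l m : K) : Prog K := loop k fun b => seq (push l b) (push m (f b))

theorem execLE_clear (k : K) (s : K → List Bool) :
    ExecLE (clear k) s (update s k []) ((s k).length + 1) := by
  have h := execLE_loop (k := k) (P := fun _ => skip) (fun _ r => update s k r) (by simp) 0 (s k)
    fun d b r _ => by simpa using execLE_skip (update s k r)
  simpa [clear] using h

theorem execLE_seqAll_clear (l : List K) (s : K → List Bool) :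
    ExecLE (seqAll (l.map clear)) s (fun k => if k ∈ l then [] else s k)
      (l.map fun k => (s k).length + 1).sum := by
  induction l generalizing s with
  | nil => simpa [seqAll] using execLE_skip s
  | cons k l ih =>
    have hle : ∀ j, (update s k [] j).length + 1 ≤ (s j).length + 1 := fun j => by
      rcases eq_or_ne j k with rfl | hj
      · simp
      · simp [hj]
    have h := (execLE_clear k s).seq ((ih (update s k [])).mono
      (List.sum_le_sum fun j _ => hle j))
    have hs : (fun j => if j ∈ l then [] else update s k [] j) =
        fun j => if j ∈ k :: l then [] else s j := by
      funext j
      rcases eq_or_ne j k with rfl | hj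
      · simp
      · simp [hj]
    rwa [hs] at h

theorem execLE_pour {k l : K} (hkl : k ≠ l) (s : K → List Bool) :
    ExecLE (pour k l) s (update (update s k []) l ((s k).reverse ++ s l))
      (2 * (s k).length + 1) := by
  have h := execLE_loop (k := k) (P := push l)
    (fun d r => update (update s k r) l (d.reverse ++ s l)) (by simp [hkl]) 1 (s k)
    fun d b r _ => by
      simpa [update_comm hkl] using execLE_push l b (update (update s k r) l (d.reverse ++ s l))
  simpa [pour] using h

theorem execLE_fork (f : Bool → Bool) {k l m : K} (hkl : k ≠ l) (hkm : k ≠ m) (hlm : l ≠ m)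
    (s : K → List Bool) :
    ExecLE (fork f k l m) s (update (update (update s k []) l ((s k).reverse ++ s l)) m
      ((s k).reverse.map f ++ s m)) (3 * (s k).length + 1) := by
  have h := execLE_loop (k := k) (P := fun b => seq (push l b) (push m (f b)))
    (fun d r => update (update (update s k r) l (d.reverse ++ s l)) m (d.reverse.map f ++ s m))
    (by simp [hkl, hkm]) 2 (s k) fun d b r _ => by
      have hl := execLE_push l b
        (update (update (update s k r) l (d.reverse ++ s l)) m (d.reverse.map f ++ s m))
      have hm := execLE_push m (f b)
        (update (update (update s k r) l (b :: d.reverse ++ s l)) m (d.reverse.map f ++ s m))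
      simp only [update_comm hlm.symm, update_idem, update_self, update_of_ne hlm] at hl hm
      simpa [update_comm hkl, update_comm hkm, update_comm hlm.symm] using hl.seq hm
  simpa [fork] using h

/-- Push the bits `f b`, for the bits `b` of the stack `k`, onto the stack `m`. The stack `l` is
used for intermediate storage. -/
def copy (f : Bool → Bool) (k l m : K) : Prog K := seq (pour k l) (fork f l k m)

theorem execLE_copy (f : Bool → Bool) {k l m : K} (hkl : k ≠ l) (hkm : k ≠ m) (hlm : l ≠ m)
    {s : K → List Bool} (hs : s l = []) :
    ExecLE (copy f k l m) s (update s m ((s k).map f ++ s m)) (5 * (s k).length + 2) := by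
  have h := (execLE_pour hkl s).seq (execLE_fork f hkl.symm hlm hkm _)
  have hupdate : update s l [] = s := by rw [← hs, update_eq_self]
  simp only [hs, List.append_nil, update_self, update_idem, List.reverse_reverse,
    List.length_reverse, update_of_ne hkl, update_of_ne hkm.symm, update_of_ne hlm.symm,
    update_comm hkl, hupdate, update_eq_self] at h
  exact h.mono (by omega)

end Prog

/-! ### Texts with parameters -/

/-- A symbol of a text: a bit, the length of a parameter in unary, or, in the body of a loop, the
number of the current round in unary. -/
inductive Atom (ι : Type) where
  | bit (b : Bool)
  | length (p : ι)
  | index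

/-- A part of a list with parameters: a single item, or a loop over the bits of a parameter. -/
inductive Part (ι α : Type) where
  | one (a : α)
  | loop (p : ι) (body : Bool → List α)

section expand

variable {ι α β : Type}

/-- The text of a symbol in round `i` of a loop. -/
def Atom.text (ρ : ι → List Bool) (i : ℕ) : Atom ι → List Bool
  | bit b => [b]
  | length p => List.replicate (ρ p).length true
  | index => List.replicate i true

/-- The items of a part, where `f i a` are the items which `a` stands for in round `i` of a loop.
Outside of loops, `i = 0`. -/
def Part.expand (ρ : ι → List Bool) (f : ℕ → α → List β) : Part ι α → List β
  | one a => f 0 a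
  | loop p body => (ρ p).zipIdx.flatMap fun c => (body c.1).flatMap (f c.2)

/-- The items of a list with parameters. -/
def expand (ρ : ι → List Bool) (f : ℕ → α → List β) (t : List (Part ι α)) : List β :=
  t.flatMap (Part.expand ρ f)

end expand

/-- The stacks of a program with the parameters `ι`. -/
inductive Reg (ι : Type) where
  | par (p : ι)
  | index
  | out
  | tmp
  | cnt
  | result
  deriving DecidableEq

namespace Reg

variable {ι : Type}

/-- The contents of all stacks. -/
def state (ρ : ι → List Bool) (i o u c r : List Bool) : Reg ι → List Bool
  | par p => ρ p
  | index => i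
  | out => o
  | tmp => u
  | cnt => c
  | result => r

instance [Finite ι] : Finite (Reg ι) :=
  Finite.of_surjective (fun a : ι ⊕ Fin 5 => a.elim par ![index, out, tmp, cnt, result]) fun
    | par p => ⟨.inl p, rfl⟩
    | index => ⟨.inr 0, rfl⟩
    | out => ⟨.inr 1, rfl⟩
    | tmp => ⟨.inr 2, rfl⟩
    | cnt => ⟨.inr 3, rfl⟩
    | result => ⟨.inr 4, rfl⟩

variable (ρ : ι → List Bool) (i o u c r l : List Bool)

@[simp] theorem state_par (p : ι) : state ρ i o u c r (par p) = ρ p := rfl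
@[simp] theorem state_index : state ρ i o u c r index = i := rfl
@[simp] theorem state_out : state ρ i o u c r out = o := rfl
@[simp] theorem state_tmp : state ρ i o u c r tmp = u := rfl
@[simp] theorem state_cnt : state ρ i o u c r cnt = c := rfl
@[simp] theorem state_result : state ρ i o u c r result = r := rfl

variable [DecidableEq ι]

@[simp] theorem update_state_par (p : ι) :
    update (state ρ i o u c r) (par p) l = state (update ρ p l) i o u c r := by
  funext k
  cases k with
  | par q => by_cases h : q = p <;> simp [h]
  | _ => simp [state]

@[simp] theorem update_state_index :
    update (state ρ i o u c r) index l = state ρ l o u c r := by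
  funext k; cases k <;> simp [state]

@[simp] theorem update_state_out : update (state ρ i o u c r) out l = state ρ i l u c r := by
  funext k; cases k <;> simp [state]

@[simp] theorem update_state_cnt : update (state ρ i o u c r) cnt l = state ρ i o u l r := by
  funext k; cases k <;> simp [state]

@[simp] theorem update_state_result :
    update (state ρ i o u c r) result l = state ρ i o u c l := by
  funext k; cases k <;> simp [state]

end Reg

section emit

open Prog Reg

variable {ι : Type} [DecidableEq ι]

/-- The program that appends the text of a symbol to the output, which is written in reverse. -/
def Atom.prog : Atom ι → Prog (Reg ι)
  | bit b => push out b
  | length p => copy (fun _ => true) (par p) tmp out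
  | index => copy (fun _ => true) .index tmp out

/-- The program that appends the text of a part to the output. -/
def Part.prog : Part ι (Atom ι) → Prog (Reg ι)
  | one a => a.prog
  | loop p body => seq (copy id (par p) tmp cnt)
      (seq (.loop cnt fun b => seq (seqAll ((body b).map Atom.prog)) (push index true))
        (clear index))

/-- The program that appends a text to the output. -/
def emit (t : List (Part ι (Atom ι))) : Prog (Reg ι) := seqAll (t.map Part.prog)

/-- The weight of a part in the bound for the running time of its program. -/
def Part.weight : Part ι (Atom ι) → ℕ
  | one _ => 1
  | loop _ body => (body true).length + (body false).length + 3

variable {ρ : ι → List Bool} {N : ℕ}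

theorem Atom.execLE_prog (hN : ∀ p, (ρ p).length ≤ N) {i : ℕ} (hi : i ≤ N) (a : Atom ι)
    (o c r : List Bool) :
    ExecLE a.prog (state ρ (List.replicate i true) o [] c r)
      (state ρ (List.replicate i true) ((a.text ρ i).reverse ++ o) [] c r) (5 * N + 2) := by
  cases a with
  | bit b =>
    have h := execLE_push out b (state ρ (List.replicate i true) o [] c r)
    simp only [state_out, update_state_out] at h
    exact h.mono (by omega)
  | length p =>
    have h := execLE_copy (fun _ => true) (k := par p) (l := tmp) (m := out) (by simp) (by simp)
      (by simp) (s := state ρ (List.replicate i true) o [] c r) rfl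
    have hp := hN p
    simp only [state_par, state_out, update_state_out, List.map_const'] at h
    simpa [Atom.text, Atom.prog] using h.mono (by omega)
  | index =>
    have h := execLE_copy (fun _ => true) (k := .index) (l := tmp) (m := out) (by simp) (by simp)
      (by simp) (s := state ρ (List.replicate i true) o [] c r) rfl
    simp only [state_index, state_out, update_state_out, List.map_const',
      List.length_replicate] at h
    simpa [Atom.text, Atom.prog] using h.mono (by omega)

theorem execLE_atoms (hN : ∀ p, (ρ p).length ≤ N) {i : ℕ} (hi : i ≤ N) (l : List (Atom ι))
    (o c r : List Bool) :
    ExecLE (seqAll (l.map Atom.prog)) (state ρ (List.replicate i true) o [] c r)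
      (state ρ (List.replicate i true) ((l.flatMap (Atom.text ρ i)).reverse ++ o) [] c r)
      ((5 * N + 2) * l.length) := by
  induction l generalizing o with
  | nil => exact execLE_skip _
  | cons a l ih =>
    have h := (a.execLE_prog hN hi o c r).seq (ih _)
    simp only [List.flatMap_cons, List.reverse_append, List.append_assoc, List.length_cons,
      List.map_cons, seqAll, List.foldr_cons] at h ⊢
    exact h.mono (by rw [mul_add]; omega)

theorem execLE_loop_atoms (hN : ∀ p, (ρ p).length ≤ N) (body : Bool → List (Atom ι))
    {l : List Bool} (hl : l.length ≤ N) (o r : List Bool) :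
    ExecLE (loop cnt fun b => seq (seqAll ((body b).map Atom.prog)) (push index true))
      (state ρ [] o [] l r)
      (state ρ (List.replicate l.length true)
        ((l.zipIdx.flatMap fun c => (body c.1).flatMap (Atom.text ρ c.2)).reverse ++ o) [] [] r)
      (((5 * N + 2) * ((body true).length + (body false).length) + 1 + 1) * l.length + 1) := by
  refine execLE_loop (k := cnt) (fun d r' => state ρ (List.replicate d.length true)
    ((d.zipIdx.flatMap fun c => (body c.1).flatMap (Atom.text ρ c.2)).reverse ++ o) [] r' r)
    (by simp) _ l ?_
  rintro d b r' rfl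
  have hd : d.length ≤ N := by
    simp only [List.length_append, List.length_cons] at hl
    omega
  have h := (execLE_atoms hN hd (body b)
    ((d.zipIdx.flatMap fun c => (body c.1).flatMap (Atom.text ρ c.2)).reverse ++ o) r' r).seq
    (execLE_push index true _)
  simp only [state_index, update_state_index] at h
  simpa [List.zipIdx_append, List.replicate_succ] using
    h.mono (T' := (5 * N + 2) * ((body true).length + (body false).length) + 1)
      (by cases b <;> nlinarith)

theorem Part.execLE_prog (hN : ∀ p, (ρ p).length ≤ N) (a : Part ι (Atom ι)) (o r : List Bool) :
    ExecLE a.prog (state ρ [] o [] [] r)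
      (state ρ [] ((a.expand ρ (Atom.text ρ)).reverse ++ o) [] [] r)
      ((5 * N + 2) * (N + 1) * a.weight) := by
  cases a with
  | one a =>
    exact (a.execLE_prog hN (Nat.zero_le N) o [] r).mono (by simp only [Part.weight]; nlinarith)
  | loop p body =>
    have hcopy := execLE_copy id (k := par p) (l := tmp) (m := cnt) (by simp) (by simp)
      (by simp) (s := state ρ [] o [] [] r) rfl
    simp only [state_par, state_cnt, update_state_cnt, List.map_id, List.append_nil] at hcopy
    have hloop := execLE_loop_atoms hN body (hN p) o r
    have hclear := execLE_clear index (state ρ (List.replicate (ρ p).length true)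
      (((ρ p).zipIdx.flatMap fun c => (body c.1).flatMap (Atom.text ρ c.2)).reverse ++ o) [] [] r)
    simp only [state_index, update_state_index, List.length_replicate] at hclear
    refine (hcopy.seq (hloop.seq hclear)).mono ?_
    have hp := hN p
    set n := (ρ p).length
    set B := (body true).length + (body false).length
    have hmul : ((5 * N + 2) * B + 1 + 1) * n ≤ ((5 * N + 2) * B + 2) * N :=
      Nat.mul_le_mul le_rfl hp
    change _ ≤ (5 * N + 2) * (N + 1) * (B + 3)
    nlinarith [Nat.zero_le ((5 * N + 2) * B), Nat.zero_le N]

theorem execLE_emit (hN : ∀ p, (ρ p).length ≤ N) (t : List (Part ι (Atom ι)))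
    (o r : List Bool) :
    ExecLE (emit t) (state ρ [] o [] [] r)
      (state ρ [] ((expand ρ (Atom.text ρ) t).reverse ++ o) [] [] r)
      ((5 * N + 2) * (N + 1) * (t.map Part.weight).sum) := by
  induction t generalizing o with
  | nil => exact execLE_skip _
  | cons a t ih =>
    have h := (a.execLE_prog hN o r).seq (ih _)
    simp only [expand, List.flatMap_cons, List.reverse_append, List.append_assoc,
      List.map_cons, seqAll, emit, List.sum_cons, List.foldr_cons] at h ⊢
    exact h.mono (mul_add _ _ _).ge

end emit

/-! ### Polynomial time -/

/-- The function is bounded by a polynomial in the length of the string. -/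
def PolyBdd (f : List Bool → ℕ) : Prop := ∃ q : Polynomial ℕ, ∀ x, f x ≤ q.eval x.length

theorem polyBdd_const (c : ℕ) : PolyBdd fun _ => c := ⟨Polynomial.C c, fun x => by simp⟩

theorem polyBdd_length : PolyBdd List.length := ⟨Polynomial.X, fun x => by simp⟩

theorem PolyBdd.add {f g : List Bool → ℕ} (hf : PolyBdd f) (hg : PolyBdd g) :
    PolyBdd fun x => f x + g x :=
  let ⟨q, hq⟩ := hf
  let ⟨r, hr⟩ := hg
  ⟨q + r, fun x => by simpa using add_le_add (hq x) (hr x)⟩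

theorem PolyBdd.mul {f g : List Bool → ℕ} (hf : PolyBdd f) (hg : PolyBdd g) :
    PolyBdd fun x => f x * g x :=
  let ⟨q, hq⟩ := hf
  let ⟨r, hr⟩ := hg
  ⟨q * r, fun x => by simpa using Nat.mul_le_mul (hq x) (hr x)⟩

section preparable

open Prog Reg

variable {ι : Type} [DecidableEq ι]

/-- The parameters `ρ x` can be computed in polynomial time from the string `x`, which is
initially the value of the parameter `p₀`. -/
def Preparable (p₀ : ι) (ρ : List Bool → ι → List Bool) : Prop :=
  ∃ (P : Prog (Reg ι)) (T : List Bool → ℕ), PolyBdd T ∧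
    ∀ x, ExecLE P (only (par p₀) x) (state (ρ x) [] [] [] [] []) (T x)

variable {p₀ : ι} {ρ : List Bool → ι → List Bool}

theorem preparable_update (p₀ : ι) : Preparable p₀ fun x => update (fun _ => []) p₀ x := by
  refine ⟨skip, fun _ => 0, polyBdd_const 0, fun x => ?_⟩
  have h : only (par p₀) x = state (update (fun _ => []) p₀ x) [] [] [] [] [] := by
    rw [← update_state_par]
    refine congrArg (update · _ _) (funext fun k => ?_)
    cases k <;> rfl
  rw [← h]
  exact execLE_skip _

theorem Preparable.exists_length_le (h : Preparable p₀ ρ) :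
    ∃ N, PolyBdd N ∧ ∀ x p, (ρ x p).length ≤ N x := by
  obtain ⟨P, T, hT, hP⟩ := h
  refine ⟨_, polyBdd_length.add hT, fun x p => ?_⟩
  obtain ⟨t, ht, hx⟩ := hP x
  have hstart : (only (par p₀) x (par p)).length ≤ x.length := by
    rcases eq_or_ne p p₀ with rfl | hp
    · simp [only]
    · simp [only, hp]
  exact (hx.length_le (par p)).trans (add_le_add hstart ht)

theorem Preparable.exists_emit (h : Preparable p₀ ρ) (t : List (Part ι (Atom ι))) :
    ∃ (P : Prog (Reg ι)) (T : List Bool → ℕ), PolyBdd T ∧ ∀ x, (∀ p, (ρ x p).length ≤ T x) ∧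
      (expand (ρ x) (Atom.text (ρ x)) t).length ≤ T x ∧ ExecLE P (only (par p₀) x)
        (state (ρ x) [] (expand (ρ x) (Atom.text (ρ x)) t).reverse [] [] []) (T x) := by
  obtain ⟨N, hN, hlen⟩ := h.exists_length_le
  obtain ⟨P, T, hT, hP⟩ := h
  have hemit : PolyBdd fun x => (5 * N x + 2) * (N x + 1) * (t.map Part.weight).sum :=
    ((((polyBdd_const 5).mul hN).add (polyBdd_const 2)).mul (hN.add (polyBdd_const 1))).mul
      (polyBdd_const _)
  refine ⟨seq P (emit t), _, hN.add (hT.add hemit),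
    fun x => ⟨fun p => (hlen x p).trans (Nat.le_add_right _ _), ?_, ?_⟩⟩
  · obtain ⟨u, hu, hx⟩ := execLE_emit (hlen x) t [] []
    have hout := hx.length_le out
    simp only [state_out, List.append_nil, List.length_reverse, List.length_nil, zero_add] at hout
    omega
  · have hx := execLE_emit (hlen x) t [] []
    rw [List.append_nil] at hx
    exact ((hP x).seq hx).mono (Nat.le_add_left _ _)

theorem Preparable.assign (h : Preparable p₀ ρ) (p : ι) (t : List (Part ι (Atom ι))) :
    Preparable p₀ fun x => update (ρ x) p (expand (ρ x) (Atom.text (ρ x)) t) := by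
  obtain ⟨P, T, hT, hP⟩ := h.exists_emit t
  refine ⟨seq P (seq (clear (par p)) (pour out (par p))), _,
    hT.add ((hT.add (polyBdd_const 1)).add (((polyBdd_const 2).mul hT).add (polyBdd_const 1))),
    fun x => ?_⟩
  obtain ⟨hlen, htext, hx⟩ := hP x
  set text := expand (ρ x) (Atom.text (ρ x)) t
  have hclear := (execLE_clear (par p) (state (ρ x) [] text.reverse [] [] [])).mono
    (Nat.add_le_add_right (hlen p) 1)
  have hpour := (execLE_pour (k := out) (l := par p) (by simp)
    (state (update (ρ x) p []) [] text.reverse [] [] [])).mono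
      (T' := 2 * T x + 1) (by simpa using htext)
  simp only [update_state_par, update_state_out, state_out, state_par, update_self,
    List.reverse_reverse, List.append_nil, update_idem] at hclear hpour
  exact hx.seq (hclear.seq hpour)

theorem Preparable.polyTime [Finite ι] (h : Preparable p₀ ρ) (t : List (Part ι (Atom ι))) :
    PolyTime fun x => expand (ρ x) (Atom.text (ρ x)) t := by
  obtain ⟨P, T, hT, hP⟩ := h.exists_emit t
  let _ := Fintype.ofFinite ι
  set pars : List (Reg ι) := Finset.univ.toList.map par
  have hQ : PolyBdd fun x => T x + (2 * T x + 1 + pars.length * (T x + 1)) :=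
    hT.add ((((polyBdd_const 2).mul hT).add (polyBdd_const 1)).add
      ((polyBdd_const _).mul (hT.add (polyBdd_const 1))))
  obtain ⟨q, hq⟩ := hQ
  refine polyTime_of_exec (seq P (seq (pour out result) (seqAll (pars.map clear)))) (par p₀) result
    _ q fun x => ?_
  suffices H : ExecLE (seq P (seq (pour out result) (seqAll (pars.map clear)))) (only (par p₀) x)
      (only result (expand (ρ x) (Atom.text (ρ x)) t)) _ from H.mono (hq x)
  obtain ⟨hlen, htext, hx⟩ := hP x
  set text := expand (ρ x) (Atom.text (ρ x)) t
  have hpour := (execLE_pour (k := out) (l := result) (by simp)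
    (state (ρ x) [] text.reverse [] [] [])).mono (T' := 2 * T x + 1) (by simpa using htext)
  simp only [update_state_out, update_state_result, state_out, state_result, List.reverse_reverse,
    List.append_nil] at hpour
  have hclear := (execLE_seqAll_clear pars (state (ρ x) [] [] [] [] text)).mono
    (T' := pars.length * (T x + 1)) (by
      refine (List.sum_le_card_nsmul _ (T x + 1) ?_).trans (by simp)
      simp only [pars, List.mem_map]
      rintro _ ⟨_, ⟨p, -, rfl⟩, rfl⟩
      exact Nat.add_le_add_right (hlen p) 1)
  have hfinal : (fun k => if k ∈ pars then [] else state (ρ x) [] [] [] [] text k) =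
      only result text := by
    funext k
    cases k <;> simp [pars, only, state]
  rw [hfinal] at hclear
  exact hx.seq (hpour.seq hclear)

end preparable

/-! ### Circuits with parameters -/

section expand

variable {ι α β γ : Type} (ρ : ι → List Bool)

theorem expand_append (f : ℕ → α → List β) (t t' : List (Part ι α)) :
    expand ρ f (t ++ t') = expand ρ f t ++ expand ρ f t' := List.flatMap_append

theorem expand_map_one (f : ℕ → α → List β) (l : List α) :
    expand ρ f (l.map .one) = l.flatMap (f 0) := by
  simp [expand, List.flatMap_map, Part.expand]

theorem flatMap_expand (f : ℕ → α → List β) (g : β → List γ) (t : List (Part ι α)) :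
    (expand ρ f t).flatMap g = expand ρ (fun i a => (f i a).flatMap g) t := by
  rw [expand, List.flatMap_assoc]
  refine congrArg t.flatMap (funext fun a => ?_)
  cases a <;> simp [Part.expand, List.flatMap_assoc]

/-- Substitution of lists for the items of a part. -/
def Part.bind (g : α → List γ) : Part ι α → List (Part ι γ)
  | one a => (g a).map .one
  | loop p body => [.loop p fun b => (body b).flatMap g]

theorem expand_flatMap_bind (f : ℕ → γ → List β) (g : α → List γ) (t : List (Part ι α)) :
    expand ρ f (t.flatMap (Part.bind g)) = expand ρ (fun i a => (g a).flatMap (f i)) t := by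
  rw [expand, List.flatMap_assoc]
  refine congrArg t.flatMap (funext fun a => ?_)
  cases a with
  | one a => exact expand_map_one ρ f (g a)
  | loop p body => simp [Part.bind, Part.expand, List.flatMap_assoc]

end expand

/-- The parameters of the circuits: the input, two numbers for the computation of the dimension, the
bits of the initial configuration and a list with one item for each cell between the first and the
last one. -/
inductive Par where
  | inp
  | base
  | pow
  | pat
  | cols
  deriving DecidableEq

instance : Finite Par :=
  Finite.of_surjective (![.inp, .base, .pow, .pat, .cols] : Fin 5 → Par) fun p => by
    cases p
    exacts [⟨0, rfl⟩, ⟨1, rfl⟩, ⟨2, rfl⟩, ⟨3, rfl⟩, ⟨4, rfl⟩]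

/-- The wire number `pat * |ρ pat| + cols * |ρ cols| + index * i + const`, where `i` is the number
of the round of a loop. -/
structure Lin where
  pat : ℕ
  cols : ℕ
  index : ℕ
  const : ℕ

/-- A gate whose arguments have parameters. -/
inductive SGate where
  | const (b : Bool)
  | not (a : Lin)
  | and (a b : Lin)
  | or (a b : Lin)

/-- A circuit with parameters. -/
structure SCircuit where
  arity : Lin
  gates : List (Part Par SGate)
  outputs : List (Part Par Lin)

section parameters

variable (ρ : Par → List Bool) (i : ℕ)

/-- The number of the wire in round `i` of a loop. -/
def Lin.val (a : Lin) : ℕ :=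
  a.pat * (ρ .pat).length + a.cols * (ρ .cols).length + a.index * i + a.const

/-- The gate in round `i` of a loop. -/
def SGate.gate : SGate → Gate
  | const b => .const b
  | not a => .not (a.val ρ i)
  | and a b => .and (a.val ρ i) (b.val ρ i)
  | or a b => .or (a.val ρ i) (b.val ρ i)

/-- The circuit for given parameters. -/
def SCircuit.circuit (C : SCircuit) : Circuit where
  arity := C.arity.val ρ 0
  gates := expand ρ (fun i g => [g.gate ρ i]) C.gates
  outputs := expand ρ (fun i a => [a.val ρ i]) C.outputs

/-- The code of a wire number. -/
def Lin.code (a : Lin) : List (Atom Par) :=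
  List.replicate a.pat (.length .pat) ++ List.replicate a.cols (.length .cols) ++
    List.replicate a.index .index ++ List.replicate a.const (.bit true) ++ [.bit false]

/-- The code of a gate. -/
def SGate.code : SGate → List (Atom Par)
  | const b => [.bit false, .bit false, .bit b]
  | not a => [.bit false, .bit true] ++ a.code
  | and a b => [.bit true, .bit false] ++ (a.code ++ b.code)
  | or a b => [.bit true, .bit true] ++ (a.code ++ b.code)

/-- The code of a circuit. -/
def SCircuit.code (C : SCircuit) : List (Part Par (Atom Par)) :=
  C.arity.code.map .one ++
    (C.gates.flatMap (Part.bind fun g => .bit true :: g.code) ++ [.one (.bit false)] ++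
      (C.outputs.flatMap (Part.bind fun a => .bit true :: a.code) ++ [.one (.bit false)]))

theorem Lin.flatMap_text_code (a : Lin) :
    a.code.flatMap (Atom.text ρ i) = encodeNat (a.val ρ i) := by
  have hones : ∀ n (b : Atom Par) m, b.text ρ i = List.replicate m true →
      (List.replicate n b).flatMap (Atom.text ρ i) = List.replicate (n * m) true := by
    intro n b m hb
    rw [List.flatMap_replicate, hb, List.flatten_replicate_replicate]
  rw [encodeNat, val, code]
  simp only [List.flatMap_append, List.replicate_add, List.append_assoc]
  rw [hones _ _ _ rfl, hones _ _ _ rfl, hones _ _ _ rfl, hones _ (.bit true) 1 rfl, mul_one]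
  rfl

theorem SGate.flatMap_text_code (g : SGate) :
    g.code.flatMap (Atom.text ρ i) = (g.gate ρ i).encode := by
  cases g <;>
    simp [code, gate, Gate.encode, Lin.flatMap_text_code, Atom.text]

theorem encodeList_eq_flatMap {α : Type} (e : α → List Bool) (l : List α) :
    encodeList e l = (l.flatMap fun a => true :: e a) ++ [false] := by
  induction l with
  | nil => rfl
  | cons a l ih => simp [encodeList, ih]

theorem SCircuit.expand_text_code (C : SCircuit) :
    expand ρ (Atom.text ρ) C.code = (C.circuit ρ).encode := by
  simp only [code, circuit, Circuit.encode, encodeList_eq_flatMap, expand_append, expand_map_one,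
    expand_flatMap_bind, flatMap_expand, List.flatMap_cons, List.flatMap_nil, List.append_nil,
    Lin.flatMap_text_code, SGate.flatMap_text_code]
  rfl

end parameters

/-! ### Evaluation of circuits -/

/-- The values of all wires, after some more gates. -/
def runGates (w : List Bool) (gs : List Gate) : List Bool :=
  gs.foldl (fun w g => w ++ [g.eval w]) w

theorem runGates_cons (w : List Bool) (g : Gate) (gs : List Gate) :
    runGates w (g :: gs) = runGates (w ++ [g.eval w]) gs := rfl

theorem prefix_runGates (w : List Bool) (gs : List Gate) : w <+: runGates w gs := by
  induction gs generalizing w with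
  | nil => exact List.prefix_rfl
  | cons g gs ih => exact (List.prefix_append w _).trans (ih _)

theorem getD_runGates (w : List Bool) (gs : List Gate) {p : ℕ} (hp : p < w.length) :
    (runGates w gs).getD p false = w.getD p false := by
  obtain ⟨v, hv⟩ := prefix_runGates w gs
  rw [← hv, List.getD_append _ _ _ _ hp]

/-- Every item `a` of the list satisfies `P k a`, where `k` is its position, counted from the given
number. -/
def ForallFrom {α : Type} (P : ℕ → α → Prop) : ℕ → List α → Prop
  | _, [] => True
  | n, a :: l => P n a ∧ ForallFrom P (n + 1) l

section forallFrom

variable {α : Type} {P : ℕ → α → Prop} {n : ℕ}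

theorem forallFrom_append {l l' : List α} :
    ForallFrom P n (l ++ l') ↔ ForallFrom P n l ∧ ForallFrom P (n + l.length) l' := by
  induction l generalizing n with
  | nil => simp [ForallFrom]
  | cons a l ih =>
    simp only [List.cons_append, ForallFrom, ih, and_assoc, List.length_cons, add_assoc, add_comm 1]

theorem forallFrom_iff {l : List α} :
    ForallFrom P n l ↔ ∀ k (hk : k < l.length), P (n + k) l[k] := by
  induction l generalizing n with
  | nil => simp [ForallFrom]
  | cons a l ih =>
    have hshift : ∀ k, n + (k + 1) = n + 1 + k := fun k => by ring
    rw [ForallFrom, ih]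
    constructor
    · rintro ⟨ha, hl⟩ (_ | k) hk
      · exact ha
      · rw [hshift]
        exact hl k (by simpa using hk)
    · refine fun h => ⟨h 0 (by simp), fun k hk => ?_⟩
      rw [← hshift]
      exact h (k + 1) (by simpa using hk)

theorem forallFrom_flatMap_zipIdx {β : Type} {c : ℕ} {f : ℕ → β → List α}
    (hf : ∀ i b, (f i b).length = c) {l : List β} {i : ℕ} :
    ForallFrom P n ((l.zipIdx i).flatMap fun b => f b.2 b.1) ↔
      ∀ k (hk : k < l.length), ForallFrom P (n + c * k) (f (i + k) l[k]) := by
  induction l generalizing n i with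
  | nil => simp [ForallFrom]
  | cons b l ih =>
    rw [List.zipIdx_cons, List.flatMap_cons, forallFrom_append, hf, ih]
    have hshift : ∀ k, n + c * (k + 1) = n + c + c * k := fun k => by ring
    have hindex : ∀ k, i + (k + 1) = i + 1 + k := fun k => by ring
    constructor
    · rintro ⟨hb, hl⟩ (_ | k) hk
      · exact hb
      · rw [hshift, hindex]
        exact hl k (by simpa using hk)
    · refine fun h => ⟨h 0 (by simp), fun k hk => ?_⟩
      have hk' := h (k + 1) (by simpa using hk)
      rwa [hshift, hindex] at hk'

theorem forallFrom_ofFn {c : ℕ} {f : Fin c → α} :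
    ForallFrom P n (List.ofFn f) ↔ ∀ r : Fin c, P (n + r) (f r) := by
  induction c generalizing n with
  | zero => simp [ForallFrom]
  | succ c ih =>
    simp [ForallFrom, ih, Fin.forall_fin_succ, add_assoc, add_comm 1]

end forallFrom

/-- The arguments of the gates are earlier wires, where the first gate has number `n`. -/
abbrev GatesBelow (n : ℕ) (gs : List Gate) : Prop := ForallFrom (fun k g => g.ArgsBelow k) n gs

/-- The wires with the numbers `n, n + 1, …` carry the values of the gates. -/
abbrev Holds (W : List Bool) (n : ℕ) (gs : List Gate) : Prop :=
  ForallFrom (fun k g => W.getD k false = g.eval W) n gs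

theorem Gate.eval_runGates {g : Gate} {w : List Bool} (h : g.ArgsBelow w.length)
    (gs : List Gate) : g.eval (runGates w gs) = g.eval w := by
  cases g with
  | const b => rfl
  | not i => simp only [Gate.eval, getD_runGates _ _ h]
  | and i j | or i j => simp only [Gate.eval, getD_runGates _ _ h.1, getD_runGates _ _ h.2]

theorem holds_runGates {gs : List Gate} {w : List Bool} (h : GatesBelow w.length gs) :
    Holds (runGates w gs) w.length gs := by
  induction gs generalizing w with
  | nil => trivial
  | cons g gs ih =>
    have hw : (w ++ [g.eval w]).length = w.length + 1 := by simp
    refine ⟨?_, hw ▸ ih (hw ▸ h.2)⟩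
    beta_reduce
    rw [Gate.eval_runGates h.1, runGates_cons, getD_runGates _ _ (by omega)]
    simp

/-! ### Formulas -/

/-- Boolean formulas with variables in `V`. -/
inductive Fml (V : Type) where
  | const (b : Bool)
  | var (i : V)
  | not (F : Fml V)
  | and (F G : Fml V)
  | or (F G : Fml V)

namespace Fml

variable {V : Type}

/-- The value of a formula. -/
def eval (η : V → Bool) : Fml V → Bool
  | const b => b
  | var i => η i
  | not F => !eval η F
  | and F G => eval η F && eval η G
  | or F G => eval η F || eval η G

/-- The formula that says that the variable `i` has the value `b`. -/
def literal (i : V) (b : Bool) : Fml V := if b then var i else not (var i)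

/-- The disjunctive normal form of a Boolean function. -/
noncomputable def ofFun [Finite V] (f : (V → Bool) → Bool) : Fml V :=
  ((Set.toFinite {η | f η = true}).toFinset.toList.map fun η =>
    ((Set.toFinite (Set.univ : Set V)).toFinset.toList.map fun i => literal i (η i)).foldr
      and (const true)).foldr or (const false)

theorem eval_literal (η : V → Bool) (i : V) (b : Bool) : eval η (literal i b) = (b == η i) := by
  cases b <;> simp [literal, eval]

theorem eval_foldr_and (η : V → Bool) (l : List (Fml V)) :
    eval η (l.foldr and (const true)) = l.all (eval η) := by
  induction l with
  | nil => rfl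
  | cons F l ih => simp [eval, ih]

theorem eval_foldr_or (η : V → Bool) (l : List (Fml V)) :
    eval η (l.foldr or (const false)) = l.any (eval η) := by
  induction l with
  | nil => rfl
  | cons F l ih => simp [eval, ih]

theorem eval_ofFun [Finite V] (η : V → Bool) (f : (V → Bool) → Bool) :
    eval η (ofFun f) = f η := by
  rw [Bool.eq_iff_iff, ofFun, eval_foldr_or]
  simp only [List.any_map, List.any_eq_true, Function.comp_apply, eval_foldr_and, List.all_map,
    List.all_eq_true, eval_literal, Finset.mem_toList, Set.Finite.mem_toFinset, Set.mem_univ,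
    Set.mem_ofPred_eq, forall_const, beq_iff_eq, ← funext_iff, exists_eq_right]

/-- The number of gates of a formula. -/
def size : Fml V → ℕ
  | const _ => 1
  | var _ => 1
  | not F => size F + 1
  | and F G => size F + size G + 1
  | or F G => size F + size G + 1

theorem size_pos (F : Fml V) : 0 < F.size := by cases F <;> simp [size]

/-- The gates of a formula. The variable `i` is on the wire `var i`, and the gates are those with
the numbers `o, o + 1, …` on the wires `wire o, wire (o + 1), …`. -/
def gates (var : V → Lin) (wire : ℕ → Lin) : Fml V → ℕ → List SGate
  | const b, _ => [.const b]
  | .var i, _ => [.and (var i) (var i)]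
  | not F, o => gates var wire F o ++ [.not (wire (o + F.size - 1))]
  | and F G, o => gates var wire F o ++ (gates var wire G (o + F.size) ++
      [.and (wire (o + F.size - 1)) (wire (o + F.size + G.size - 1))])
  | or F G, o => gates var wire F o ++ (gates var wire G (o + F.size) ++
      [.or (wire (o + F.size - 1)) (wire (o + F.size + G.size - 1))])

variable {var : V → Lin} {wire : ℕ → Lin} {ρ : Par → List Bool} {B : ℕ}

theorem length_gates (F : Fml V) (o : ℕ) : (gates var wire F o).length = F.size := by
  induction F generalizing o with
  | const b => rfl
  | var i => rfl
  | not F ih => simp [gates, size, ih]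
  | and F G ihF ihG | or F G ihF ihG => simp [gates, size, ihF, ihG, add_assoc]

theorem gatesBelow (hvar : ∀ i, (var i).val ρ 0 < B) (hwire : ∀ o, (wire o).val ρ 0 = B + o)
    (F : Fml V) (o : ℕ) : GatesBelow (B + o) ((gates var wire F o).map (SGate.gate ρ 0)) := by
  induction F generalizing o with
  | const b => exact ⟨trivial, trivial⟩
  | var i =>
    have hi := (hvar i).trans_le (Nat.le_add_right B o)
    exact ⟨⟨hi, hi⟩, trivial⟩
  | not F ih =>
    have hF := F.size_pos
    simp only [gates, List.map_append, forallFrom_append, List.map_cons, List.map_nil, ForallFrom,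
      SGate.gate, Gate.ArgsBelow, hwire, List.length_map, length_gates]
    exact ⟨ih o, by omega, trivial⟩
  | and F G ihF ihG | or F G ihF ihG =>
    have hF := F.size_pos
    have hG := G.size_pos
    simp only [gates, List.map_append, forallFrom_append, List.map_cons, List.map_nil, ForallFrom,
      SGate.gate, Gate.ArgsBelow, hwire, List.length_map, length_gates]
    exact ⟨ihF o, by rw [add_assoc]; exact ihG _, ⟨by omega, by omega⟩, trivial⟩

theorem getD_of_holds (hwire : ∀ o, (wire o).val ρ 0 = B + o) {W : List Bool} {η : V → Bool}
    (hη : ∀ i, W.getD ((var i).val ρ 0) false = η i) (F : Fml V) (o : ℕ)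
    (h : Holds W (B + o) ((gates var wire F o).map (SGate.gate ρ 0))) :
    W.getD (B + (o + F.size - 1)) false = F.eval η := by
  induction F generalizing o with
  | const b => exact h.1
  | var i =>
    refine h.1.trans ?_
    change (W.getD ((var i).val ρ 0) false && W.getD ((var i).val ρ 0) false) = η i
    rw [hη, Bool.and_self]
  | not F ih =>
    simp only [gates, List.map_append, forallFrom_append, List.map_cons, List.map_nil, ForallFrom,
      List.length_map, length_gates, SGate.gate, Gate.eval, hwire, add_assoc] at h
    rw [eval, ← ih o h.1, size, ← add_assoc, Nat.add_sub_cancel]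
    exact h.2.1
  | and F G ihF ihG | or F G ihF ihG =>
    simp only [gates, List.map_append, forallFrom_append, List.map_cons, List.map_nil, ForallFrom,
      List.length_map, length_gates, SGate.gate, Gate.eval, hwire, add_assoc] at h
    rw [eval, ← ihF o h.1, ← ihG _ h.2.1, size, ← add_assoc o, Nat.add_sub_cancel]
    simpa only [add_assoc] using h.2.2.1

end Fml

/-! ### The bits of a vertex -/

section chunks

variable {α β : Type}

theorem length_flatMap_of_forall_length {f : α → List β} {c : ℕ} (hf : ∀ a, (f a).length = c)
    (l : List α) : (l.flatMap f).length = l.length * c := by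
  simp [List.length_flatMap, hf]

theorem getD_append_add {l l' : List α} {n : ℕ} (hl : l.length = n) (k : ℕ) (a : α) :
    (l ++ l').getD (n + k) a = l'.getD k a := by
  rw [List.getD_append_right _ _ _ _ (by omega), hl, Nat.add_sub_cancel_left]

theorem getD_flatMap_of_forall_length {f : α → List β} {c : ℕ} (hf : ∀ a, (f a).length = c)
    {l : List α} {s j : ℕ} (hs : s < l.length) (hj : j < c) (b : β) :
    (l.flatMap f).getD (s * c + j) b = (f l[s]).getD j b := by
  induction l generalizing s with
  | nil => simp at hs
  | cons a l ih =>
    cases s with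
    | zero =>
      rw [List.flatMap_cons, zero_mul, zero_add, List.getD_append _ _ _ _ (by rwa [hf])]
      rfl
    | succ s =>
      have hindex : (s + 1) * c + j = c + (s * c + j) := by ring
      rw [List.flatMap_cons, hindex, getD_append_add (hf a), ih (by simpa using hs)]
      rfl

theorem getD_ofFn {n : ℕ} (g : Fin n → α) (j : Fin n) (a : α) : (List.ofFn g).getD j a = g j := by
  simp [List.getD]

end chunks

namespace RotMachine

variable {M : RotMachine} {d : ℕ}

/-- The bits of a phase and a configuration. -/
def configBits (phase : Bool) (c : M.Config d) : List Bool :=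
  phase :: (List.ofFn c.1 ++ (List.finRange (d + 2)).flatMap fun i => List.ofFn (c.2 i))

theorem length_configBits (phase : Bool) (c : M.Config d) :
    (configBits phase c).length = M.len d := by
  have hcells := length_flatMap_of_forall_length (f := fun i => List.ofFn (c.2 i)) (c := M.w)
    (by simp) (List.finRange (d + 2))
  rw [configBits, List.length_cons, List.length_append, hcells, List.length_finRange,
    List.length_ofFn, len]
  ring

theorem getD_configBits_ctrl (phase : Bool) (c : M.Config d) (j : Fin M.q) :
    (configBits phase c).getD (1 + j) false = c.1 j := by
  rw [configBits, add_comm 1, List.getD_cons_succ, List.getD_append _ _ _ _ (by simp), getD_ofFn]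

theorem getD_configBits_cell (phase : Bool) (c : M.Config d) (i : Fin (d + 2)) (j : Fin M.w) :
    (configBits phase c).getD (1 + M.q + M.w * i + j) false = c.2 i j := by
  have hindex : 1 + M.q + M.w * i + j = (M.q + (i * M.w + j)) + 1 := by ring
  rw [configBits, hindex, List.getD_cons_succ, getD_append_add (by simp),
    getD_flatMap_of_forall_length (by simp) (by simp) j.2, List.getElem_finRange, getD_ofFn]
  rfl

theorem configBits_inj {phase phase' : Bool} {c c' : M.Config d} :
    configBits phase c = configBits phase' c' ↔ phase = phase' ∧ c = c' := by
  refine ⟨fun h => ⟨(List.cons.inj h).1, Prod.ext (funext fun j => ?_) (funext₂ fun i j => ?_)⟩,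
    fun h => by rw [h.1, h.2]⟩
  · rw [← getD_configBits_ctrl phase, h, getD_configBits_ctrl]
  · rw [← getD_configBits_cell phase, h, getD_configBits_cell]

variable (M) in
/-- The wire with the bit `j` of the column `i` of the tape. -/
def cellWire (i j : ℕ) : ℕ := 2 + M.q + M.w * i + j

theorem cellWire_lt (i : Fin (d + 2)) (j : Fin M.w) : M.cellWire i j < M.len d + 1 := by
  have hi : M.w * (i + 1) ≤ M.w * (d + 2) := Nat.mul_le_mul_left _ i.2
  have hj := j.2
  rw [mul_add] at hi
  unfold cellWire len
  omega

namespace Vertex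

/-- The bits of a vertex, in the order in which they are the inputs of a circuit. -/
def bits (v : M.Vertex d) : List Bool :=
  v.aux :: (configBits v.phase v.config ++ List.ofFn v.timer)

theorem length_bits (v : M.Vertex d) : v.bits.length = 2 * M.len d + 1 := by
  rw [bits, List.length_cons, List.length_append, length_configBits, List.length_ofFn]
  ring

theorem bits_injective : Injective (bits : M.Vertex d → List Bool) := by
  intro v v' h
  obtain ⟨haux, htail⟩ := List.cons.inj h
  obtain ⟨hconfig, htimer⟩ := List.append_inj htail (by simp only [length_configBits])
  obtain ⟨hphase, hconfig⟩ := configBits_inj.1 hconfig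
  exact Vertex.ext haux hphase hconfig (List.ofFn_injective htimer)

theorem getD_bits_config (v : M.Vertex d) {k : ℕ} (hk : k < M.len d) :
    v.bits.getD (1 + k) false = (configBits v.phase v.config).getD k false := by
  rw [bits, add_comm, List.getD_cons_succ, List.getD_append _ _ _ _ (by rwa [length_configBits])]

theorem getD_bits_ctrl (v : M.Vertex d) (j : Fin M.q) :
    v.bits.getD (2 + j) false = v.config.1 j := by
  have hj : 1 + (j : ℕ) < M.len d := by rw [len]; omega
  rw [← getD_configBits_ctrl v.phase, ← getD_bits_config v hj, ← add_assoc]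

theorem getD_bits_cell (v : M.Vertex d) (i : Fin (d + 2)) (j : Fin M.w) :
    v.bits.getD (M.cellWire i j) false = v.config.2 i j := by
  have hindex : M.cellWire i j = 1 + (1 + M.q + M.w * i + j) := by rw [cellWire]; ring
  have hlt := cellWire_lt i j
  rw [hindex, getD_bits_config v (by omega), getD_configBits_cell]

theorem getD_bits_timer (v : M.Vertex d) (k : Fin (M.len d)) :
    v.bits.getD (M.len d + 1 + k) false = v.timer k := by
  rw [bits, add_right_comm, List.getD_cons_succ, getD_append_add (length_configBits _ _),
    getD_ofFn]

/-- The components of a vertex. -/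
def equivProd : M.Vertex d ≃ Bool × Bool × M.Config d × (Fin (M.len d) → Bool) where
  toFun v := (v.aux, v.phase, v.config, v.timer)
  invFun p := ⟨p.1, p.2.1, p.2.2.1, p.2.2.2⟩

instance : Fintype (M.Vertex d) := Fintype.ofEquiv _ equivProd.symm

theorem card_vertex : Fintype.card (M.Vertex d) = 2 ^ (2 * M.len d + 1) := by
  rw [Fintype.card_congr equivProd]
  simp only [Fintype.card_prod, Fintype.card_bool, Fintype.card_pi, Finset.prod_const,
    Finset.card_univ, Fintype.card_fin]
  rw [len]
  ring

/-- The vertices correspond to the strings of `2 * M.len d + 1` bits. -/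
noncomputable def equivIndex {m : ℕ} (hm : m = 2 * M.len d + 1) : M.Vertex d ≃ (Fin m → Bool) :=
  Equiv.ofBijective (fun v b => v.bits[b]'(by rw [length_bits]; omega)) <| by
    rw [Fintype.bijective_iff_injective_and_card, card_vertex]
    refine ⟨fun v v' h => bits_injective ?_, by simp [hm]⟩
    refine List.ext_getElem (by simp only [length_bits]) fun k hk _ => ?_
    exact congrFun h ⟨k, by rwa [length_bits, ← hm] at hk⟩

theorem ofFn_equivIndex {m : ℕ} (hm : m = 2 * M.len d + 1) (v : M.Vertex d) :
    List.ofFn (equivIndex hm v) = v.bits :=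
  List.ext_getElem (by rw [length_bits, List.length_ofFn, hm]) fun k _ _ => by simp [equivIndex]

end Vertex

/-! ### The slots of a row -/

instance : Finite M.LocalPart :=
  Finite.of_injective (fun u => (u.aux, u.phase, u.ctrl, u.col)) fun u u' h => by
    simp only [Prod.mk.injEq] at h
    exact LocalPart.ext h.1 h.2.1 h.2.2.1 h.2.2.2

variable (M) in
/-- The slots of a row of the matrix: the entries in the row `v` can be nonzero only in the columns
of the vertices that differ from `v` in the local part, or that are reached from `v` by a rotation
in one of the two directions. As the control may change after the rotation, all possible controls
are listed. -/
inductive Slot where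
  | inner (u : M.LocalPart)
  | forward (q : Fin M.q → Bool)
  | backward (q : Fin M.q → Bool)

instance : Finite M.Slot :=
  Finite.of_surjective
    (Sum.elim .inner (Sum.elim .forward .backward) :
      M.LocalPart ⊕ (Fin M.q → Bool) ⊕ (Fin M.q → Bool) → M.Slot)
    fun
      | .inner u => ⟨.inl u, rfl⟩
      | .forward q => ⟨.inr (.inl q), rfl⟩
      | .backward q => ⟨.inr (.inr q), rfl⟩

variable (M) in
/-- All slots in some order. -/
noncomputable def slots : List M.Slot := (Set.finite_univ (α := M.Slot)).toFinset.toList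

theorem mem_slots (s : M.Slot) : s ∈ M.slots := by simp [slots]

namespace Slot

/-- The column of a slot in the row of `v`. -/
def column (v : M.Vertex d) : M.Slot → M.Vertex d
  | inner u => v.setLocal u
  | forward q => v.forward q
  | backward q => v.backward q

open scoped Classical in
/-- The value of a slot, where the flags tell whether the timer is maximal, whether it is zero, and
whether the vertex is the initial one up to `aux`. -/
noncomputable def value (last first start : Bool) (p : M.LocalPart) : M.Slot → ℕ
  | inner u => p.entry last start u
  | forward q => if p.HasForward last q then 1 else 0
  | backward q => if p.HasBackward first q then 1 else 0

theorem value_le_two (last first start : Bool) (p : M.LocalPart) (s : M.Slot) :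
    s.value last first start p ≤ 2 := by
  cases s with
  | inner u => exact LocalPart.entry_le_two ..
  | forward q | backward q => rw [value]; split_ifs <;> norm_num

/-- The value of a slot in the row of `v`. -/
noncomputable def entry (x : List Bool) (v : M.Vertex d) (s : M.Slot) : ℕ :=
  s.value v.isLast v.isFirst (v.isStart x) v.localPart

end Slot

theorem overlap_eq_iff_exists_slot (x : List Bool) (v v' : M.Vertex d) {k : ℕ} (hk : k ≠ 0) :
    (M.forest d x).graph.overlap v v' = k ↔ ∃ s : M.Slot, s.column v = v' ∧ s.entry x v = k := by
  classical
  have hite : ∀ P : Prop, (if P then 1 else 0) = k ↔ P ∧ k = 1 := by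
    intro P
    split_ifs with h <;> simp [h, eq_comm, hk]
  rw [overlap_eq_iff x hk]
  constructor
  · rintro (⟨u, h⟩ | ⟨q, hq, h⟩ | ⟨q, hq, h⟩)
    exacts [⟨.inner u, h⟩, ⟨.forward q, hq, (hite _).2 h⟩, ⟨.backward q, hq, (hite _).2 h⟩]
  · rintro ⟨u | q | q, hcol, h⟩
    exacts [.inl ⟨u, hcol, h⟩, .inr (.inl ⟨q, hcol, (hite _).1 h⟩),
      .inr (.inr ⟨q, hcol, (hite _).1 h⟩)]

end RotMachine

theorem Circuit.represents_of_eval {α : Type} {C : Circuit} {A : Matrix C.Index C.Index ℕ}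
    (hC : C.WellFormed) (l : List α) (entry : C.Index → α → ℕ) (column : C.Index → α → C.Index)
    (hentry : ∀ i s, entry i s < 4)
    (heval : ∀ i, C.eval i = l.flatMap fun s =>
      (entry i s).testBit 0 :: (entry i s).testBit 1 :: List.ofFn (column i s))
    (hA : ∀ i j k, k ≠ 0 → (A i j = k ↔ ∃ s ∈ l, column i s = j ∧ entry i s = k)) :
    C.Represents A := by
  have hchunk : ∀ (i : C.Index) (s : α), ((entry i s).testBit 0 :: (entry i s).testBit 1 ::
      List.ofFn (column i s)).length = C.arity + 2 := by simp
  have hlen : C.outputs.length = l.length * (C.arity + 2) := by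
    have := congrArg List.length (heval fun _ => false)
    rwa [length_flatMap_of_forall_length (hchunk _), eval, List.length_map] at this
  have hnum : C.numSlots = l.length := by
    rw [numSlots, hlen, Nat.mul_div_cancel _ (by positivity)]
  have hget : ∀ (i : C.Index) (s : ℕ) (hs : s < l.length), ∀ j < C.arity + 2,
      (C.eval i).getD (s * (C.arity + 2) + j) false = ((entry i l[s]).testBit 0 ::
        (entry i l[s]).testBit 1 :: List.ofFn (column i l[s])).getD j false := by
    intro i s hs j hj
    rw [heval, getD_flatMap_of_forall_length (hchunk i) hs hj]
  have hvalue : ∀ (i : C.Index) (s : ℕ) (hs : s < l.length), C.slotValue i s = entry i l[s] := by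
    intro i s hs
    have h0 := hget i s hs 0 (by omega)
    rw [add_zero] at h0
    rw [slotValue, h0, hget i s hs 1 (by omega)]
    have := hentry i l[s]
    generalize entry i l[s] = k at *
    interval_cases k <;> rfl
  have hcolumn : ∀ (i : C.Index) (s : ℕ) (hs : s < l.length),
      C.slotColumn i s = column i l[s] := by
    intro i s hs
    funext b
    rw [slotColumn, add_assoc, hget i s hs _ (by omega), add_comm 2, List.getD_cons_succ,
      List.getD_cons_succ, getD_ofFn]
  refine ⟨hC, ⟨l.length, by rw [hlen, mul_comm]⟩, fun i j k hk => ?_⟩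
  rw [hA i j k hk, hnum, List.exists_mem_iff_getElem]
  refine exists_congr fun s => ⟨fun ⟨hs, h⟩ => ⟨hs, ?_⟩, fun ⟨hs, h⟩ => ⟨hs, ?_⟩⟩
  · rwa [hcolumn i s hs, hvalue i s hs]
  · rwa [hcolumn i s hs, hvalue i s hs] at h

/-! ### The gates for the timer and the comparison with the initial configuration -/

namespace Chain

/-- The gate `r` of the block for the preceding bit. -/
def prev (r : ℕ) : Lin := ⟨2, 0, 12, 1 + r⟩

/-- The gate `r` of the block for the current bit. -/
def this (r : ℕ) : Lin := ⟨2, 0, 12, 13 + r⟩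

/-- The gate `r` of the last block. -/
def final (r : ℕ) : Lin := ⟨14, 0, 0, 1 + r⟩

/-- The current bit of the timer. -/
def timerBit : Lin := ⟨1, 0, 1, 1⟩

/-- The current bit of the configuration. -/
def configBit : Lin := ⟨0, 0, 1, 1⟩

/-- The block of gates for a bit of the timer and the bit `b` of the pattern. The gates `1`, `2` and
`4` continue the chains of the carries, of the borrows and of the comparison of the configuration
with the pattern, and the gates `8` and `11` give the bits of the incremented and of the decremented
timer. -/
def block (b : Bool) : Fin 12 → SGate :=
  ![.not timerBit,
    .and (prev 1) timerBit,
    .and (prev 2) (this 0),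
    .not configBit,
    .and (prev 4) (if b then configBit else this 3),
    .not (prev 1),
    .and timerBit (this 5),
    .and (this 0) (prev 1),
    .or (this 6) (this 7),
    .not (prev 2),
    .and timerBit (this 9),
    .or (this 10) (this 2)]

/-- The block of constants from which the chains start. -/
def start (r : Fin 12) : SGate := .const (decide (r ≠ 0))

/-- The gates for the timer and the comparison with the initial configuration. -/
def gates : List (Part Par SGate) :=
  (List.ofFn start).map .one ++ [.loop .pat fun b => List.ofFn (block b)]

section bounds

variable {ρ : Par → List Bool} {T : ℕ}

theorem expand_gates : expand ρ (fun i g => [g.gate ρ i]) gates =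
    (List.ofFn fun r => (start r).gate ρ 0) ++
      (ρ .pat).zipIdx.flatMap fun c => List.ofFn fun r => (block c.1 r).gate ρ c.2 := by
  have hmap : ∀ (i : ℕ) (f : Fin 12 → SGate),
      (List.ofFn f).flatMap (fun g => [g.gate ρ i]) = List.ofFn fun r => (f r).gate ρ i :=
    fun i f => List.map_eq_flatMap.symm.trans (List.map_ofFn ..)
  rw [gates, expand_append, expand_map_one, hmap]
  simp only [expand, List.flatMap_singleton, Part.expand, hmap]

theorem forallFrom_expand_gates {P : ℕ → Gate → Prop} {n : ℕ} :
    ForallFrom P n (expand ρ (fun i g => [g.gate ρ i]) gates) ↔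
      (∀ r : Fin 12, P (n + r) ((start r).gate ρ 0)) ∧
        ∀ i (hi : i < (ρ .pat).length) (r : Fin 12),
          P (n + 12 + 12 * i + r) ((block (ρ .pat)[i] r).gate ρ i) := by
  rw [expand_gates, forallFrom_append, List.length_ofFn, forallFrom_ofFn,
    forallFrom_flatMap_zipIdx (f := fun i b => List.ofFn fun r => (block b r).gate ρ i)
      fun _ _ => List.length_ofFn]
  simp only [forallFrom_ofFn, zero_add]

theorem length_expand_gates (hT : (ρ .pat).length = T) :
    (expand ρ (fun i g => [g.gate ρ i]) gates).length = 12 * T + 12 := by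
  rw [expand_gates, List.length_append, List.length_ofFn,
    length_flatMap_of_forall_length fun _ => List.length_ofFn, List.length_zipIdx, hT]
  ring

theorem gatesBelow_expand_gates (hT : (ρ .pat).length = T) :
    GatesBelow (2 * T + 1) (expand ρ (fun i g => [g.gate ρ i]) gates) := by
  refine forallFrom_expand_gates.2 ⟨fun _ => trivial, fun i hi r => ?_⟩
  rw [hT] at hi
  cases (ρ .pat)[i] <;> fin_cases r <;>
    simp [block, SGate.gate, Gate.ArgsBelow, Lin.val, prev, this, timerBit, configBit, hT] <;>
    omega

end bounds

/-- The value of the gate `r` in the block `i`, where the timer has `T` bits and `W` are the values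
of all wires. -/
def value (W : List Bool) (T i r : ℕ) : Bool := W.getD (2 * T + 1 + 12 * i + r) false

/-- The wires carry the timer `t` and the values of the gates. -/
structure Values (ρ : Par → List Bool) (W : List Bool) {T : ℕ} (t : Fin T → Bool) : Prop where
  length_pat : (ρ .pat).length = T
  timer : ∀ k : Fin T, W.getD (T + 1 + k) false = t k
  holds : Holds W (2 * T + 1) (expand ρ (fun i g => [g.gate ρ i]) gates)

namespace Values

variable {ρ : Par → List Bool} {W : List Bool} {T : ℕ} {t : Fin T → Bool} (h : Values ρ W t)

include h

theorem value_start (r : Fin 12) : value W T 0 r = decide (r ≠ 0) :=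
  (forallFrom_expand_gates.1 h.holds).1 r

theorem value_succ (i : Fin T) (r : Fin 12) : value W T (i + 1) r =
    ((block ((ρ .pat)[i]'(h.length_pat ▸ i.2)) r).gate ρ i).eval W := by
  refine Eq.trans ?_ ((forallFrom_expand_gates.1 h.holds).2 i (h.length_pat ▸ i.2) r)
  rw [value, mul_add, mul_one, ← add_assoc, add_right_comm _ (12 * (i : ℕ))]

theorem getD_prev (i r : ℕ) : W.getD ((prev r).val ρ i) false = value W T i r := by
  simp only [prev, Lin.val, value, h.length_pat]
  ring_nf

theorem getD_this (i r : ℕ) : W.getD ((this r).val ρ i) false = value W T (i + 1) r := by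
  simp only [this, Lin.val, value, h.length_pat]
  ring_nf

theorem getD_final (r : ℕ) : W.getD ((final r).val ρ 0) false = value W T T r := by
  simp only [final, Lin.val, value, h.length_pat]
  ring_nf

theorem getD_timerBit (i : Fin T) : W.getD (timerBit.val ρ i) false = t i := by
  rw [← h.timer i]
  simp only [timerBit, Lin.val, h.length_pat]
  ring_nf

theorem value_not_timer (i : Fin T) : value W T (i + 1) 0 = !t i :=
  (h.value_succ i 0).trans (congrArg not (h.getD_timerBit i))

theorem carry_succ (i : Fin T) : value W T (i + 1) 1 = (value W T i 1 && t i) :=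
  (h.value_succ i 1).trans (congrArg₂ and (h.getD_prev i 1) (h.getD_timerBit i))

theorem carry_eq {i : ℕ} (hi : i ≤ T) : value W T i 1 = Timer.carry t i := by
  induction i with
  | zero => exact h.value_start 1
  | succ i ih => rw [Timer.carry, ← ih (by omega), Timer.bit, dif_pos (Nat.lt_of_succ_le hi),
      h.carry_succ ⟨i, hi⟩]

theorem borrow_succ (i : Fin T) : value W T (i + 1) 2 = (value W T i 2 && !t i) :=
  (h.value_succ i 2).trans
    (congrArg₂ and (h.getD_prev i 2) ((h.getD_this i 0).trans (h.value_not_timer i)))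

theorem borrow_eq {i : ℕ} (hi : i ≤ T) : value W T i 2 = Timer.borrow t i := by
  induction i with
  | zero => exact h.value_start 2
  | succ i ih => rw [Timer.borrow, ← ih (by omega), Timer.bit, dif_pos (Nat.lt_of_succ_le hi),
      h.borrow_succ ⟨i, hi⟩]

theorem agree_succ (i : Fin T) : value W T (i + 1) 4 =
    (value W T i 4 && ((ρ .pat).getD i false == W.getD (i + 1) false)) := by
  have hi : (i : ℕ) < (ρ .pat).length := h.length_pat ▸ i.2
  have hconfig : W.getD (configBit.val ρ i) false = W.getD (i + 1) false := by
    simp [configBit, Lin.val]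
  have hnot : W.getD ((this 3).val ρ i) false = !W.getD (i + 1) false := by
    rw [h.getD_this, ← hconfig]
    exact h.value_succ i 3
  refine (h.value_succ i 4).trans (congrArg₂ and (h.getD_prev i 4) ?_)
  rw [List.getD_eq_getElem _ _ hi]
  change W.getD ((if (ρ .pat)[i] = true then configBit else this 3).val ρ i) false = _
  cases (ρ .pat)[i]
  exacts [hnot.trans (Bool.false_beq _).symm, hconfig.trans (Bool.true_beq _).symm]

theorem agree_iff {i : ℕ} (hi : i ≤ T) :
    value W T i 4 = true ↔ ∀ k < i, (ρ .pat).getD k false = W.getD (k + 1) false := by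
  induction i with
  | zero => exact iff_of_true (h.value_start 4) fun k hk => absurd hk k.not_lt_zero
  | succ i ih =>
    rw [h.agree_succ ⟨i, hi⟩, Bool.and_eq_true, beq_iff_eq, ih (by omega), Nat.forall_lt_succ_right]

theorem inc_eq (i : Fin T) : value W T (i + 1) 8 = Timer.inc t i := by
  have hnot : value W T (i + 1) 5 = !value W T i 1 :=
    (h.value_succ i 5).trans (congrArg not (h.getD_prev i 1))
  have hleft : value W T (i + 1) 6 = (t i && !value W T i 1) :=
    (h.value_succ i 6).trans
      (congrArg₂ and (h.getD_timerBit i) ((h.getD_this i 5).trans hnot))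
  have hright : value W T (i + 1) 7 = (!t i && value W T i 1) :=
    (h.value_succ i 7).trans
      (congrArg₂ and ((h.getD_this i 0).trans (h.value_not_timer i)) (h.getD_prev i 1))
  have hxor : value W T (i + 1) 8 = (t i && !value W T i 1 || !t i && value W T i 1) :=
    (h.value_succ i 8).trans
      (congrArg₂ or ((h.getD_this i 6).trans hleft) ((h.getD_this i 7).trans hright))
  rw [hxor, h.carry_eq i.2.le, Timer.inc]
  cases t i <;> simp

theorem dec_eq (i : Fin T) : value W T (i + 1) 11 = Timer.dec t i := by
  have hnot : value W T (i + 1) 9 = !value W T i 2 :=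
    (h.value_succ i 9).trans (congrArg not (h.getD_prev i 2))
  have hleft : value W T (i + 1) 10 = (t i && !value W T i 2) :=
    (h.value_succ i 10).trans
      (congrArg₂ and (h.getD_timerBit i) ((h.getD_this i 9).trans hnot))
  have hxor : value W T (i + 1) 11 = (t i && !value W T i 2 || value W T i 2 && !t i) :=
    (h.value_succ i 11).trans
      (congrArg₂ or ((h.getD_this i 10).trans hleft) ((h.getD_this i 2).trans (h.borrow_succ i)))
  rw [hxor, h.borrow_eq i.2.le, Timer.dec]
  cases t i <;> simp

end Values

end Chain


/-! ### Tables -/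

/-- A row of a table of slots: formulas for the two bits of the value, and the wires of the
column. -/
structure TableRow (V : Type) where
  lo : Fml V
  hi : Fml V
  col : List (Part Par Lin)

section table

variable {V : Type} (var : V → Lin) (wire : ℕ → Lin)

/-- The gates of a table, where `o` is the number of the first gate. -/
def tableGates : List (TableRow V) → ℕ → List SGate
  | [], _ => []
  | s :: l, o => s.lo.gates var wire o ++ (s.hi.gates var wire (o + s.lo.size) ++
      tableGates l (o + s.lo.size + s.hi.size))

/-- The outputs of a table. -/
def tableOutputs : List (TableRow V) → ℕ → List (Part Par Lin)
  | [], _ => []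
  | s :: l, o =>
    [wire (o + s.lo.size - 1), wire (o + s.lo.size + s.hi.size - 1)].map .one ++
      (s.col ++ tableOutputs l (o + s.lo.size + s.hi.size))

variable {var wire} {ρ : Par → List Bool} {B : ℕ}

theorem gatesBelow_tableGates (hvar : ∀ i, (var i).val ρ 0 < B)
    (hwire : ∀ o, (wire o).val ρ 0 = B + o) (l : List (TableRow V)) (o : ℕ) :
    GatesBelow (B + o) ((tableGates var wire l o).map (SGate.gate ρ 0)) := by
  induction l generalizing o with
  | nil => trivial
  | cons s l ih =>
    simp only [tableGates, List.map_append, forallFrom_append, List.length_map, Fml.length_gates,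
      add_assoc]
    exact ⟨Fml.gatesBelow hvar hwire _ _, Fml.gatesBelow hvar hwire _ _, ih _⟩

theorem lt_of_mem_tableOutputs (hwire : ∀ o, (wire o).val ρ 0 = B + o) {l : List (TableRow V)}
    (hl : ∀ s ∈ l, ∀ p ∈ expand ρ (fun i a => [a.val ρ i]) s.col, p < B) (o : ℕ) {p : ℕ}
    (hp : p ∈ expand ρ (fun i a => [a.val ρ i]) (tableOutputs wire l o)) :
    p < B + o + (tableGates var wire l o).length := by
  induction l generalizing o with
  | nil => simp [tableOutputs, expand] at hp
  | cons s l ih =>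
    have hlo := s.lo.size_pos
    have hhi := s.hi.size_pos
    rw [tableOutputs, expand_append, expand_append, expand_map_one, List.mem_append,
      List.mem_append] at hp
    rw [tableGates, List.length_append, List.length_append, Fml.length_gates, Fml.length_gates]
    rcases hp with hvalue | hcol | hrest
    · simp only [List.flatMap_cons, List.flatMap_nil, List.cons_append, List.nil_append,
        List.mem_cons, List.not_mem_nil, or_false, hwire] at hvalue
      omega
    · have := hl s List.mem_cons_self p hcol
      omega
    · have := ih (fun s hs => hl s (List.mem_cons_of_mem _ hs)) _ hrest
      omega

theorem map_tableOutputs (hwire : ∀ o, (wire o).val ρ 0 = B + o) {W : List Bool} {η : V → Bool}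
    (hη : ∀ i, W.getD ((var i).val ρ 0) false = η i) (l : List (TableRow V)) (o : ℕ)
    (h : Holds W (B + o) ((tableGates var wire l o).map (SGate.gate ρ 0))) :
    (expand ρ (fun i a => [a.val ρ i]) (tableOutputs wire l o)).map (fun p => W.getD p false) =
      l.flatMap fun s => s.lo.eval η :: s.hi.eval η ::
        (expand ρ (fun i a => [a.val ρ i]) s.col).map fun p => W.getD p false := by
  induction l generalizing o with
  | nil => rfl
  | cons s l ih =>
    simp only [tableGates, List.map_append, forallFrom_append, List.length_map, Fml.length_gates,
      add_assoc] at h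
    have hlo := Fml.getD_of_holds hwire hη _ _ h.1
    have hhi := Fml.getD_of_holds hwire hη _ _ h.2.1
    rw [tableOutputs, expand_append, expand_append, expand_map_one, List.map_append,
      List.map_append, ih _ (by rw [add_assoc]; exact h.2.2)]
    simp only [List.flatMap_cons, List.flatMap_nil, List.map_cons, List.map_nil, List.cons_append,
      List.nil_append, hwire, hlo, hhi]

end table

/-! ### The wires of the columns -/

namespace Shift

/-- The opposite motion. -/
def rev : Shift → Shift
  | stay => stay
  | left => right
  | right => left

theorem offset_rev {d : ℕ} (s : Shift) : (s.rev.offset : Fin (d + 2)) = -s.offset := by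
  cases s <;> simp [rev, offset]

/-- The column whose contents move to the column `0`. -/
def first : Shift → Lin
  | stay => ⟨0, 0, 0, 0⟩
  | left => ⟨0, 0, 0, 1⟩
  | right => ⟨0, 1, 0, 1⟩

/-- The column whose contents move to the column `i + 1`, where `i` is the index of a loop. -/
def inner : Shift → Lin
  | stay => ⟨0, 0, 1, 1⟩
  | left => ⟨0, 0, 1, 2⟩
  | right => ⟨0, 0, 1, 0⟩

/-- The column whose contents move to the last column. -/
def last : Shift → Lin
  | stay => ⟨0, 1, 0, 1⟩
  | left => ⟨0, 0, 0, 0⟩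
  | right => ⟨0, 1, 0, 0⟩

variable {ρ : Par → List Bool} {d : ℕ}

theorem val_first (hcols : (ρ .cols).length = d) (s : Shift) :
    s.first.val ρ 0 = (0 + s.offset : Fin (d + 2)) := by
  cases s <;> simp [first, Lin.val, offset, hcols]

theorem val_inner (s : Shift) (i : Fin d) :
    s.inner.val ρ i = (i.castSucc.succ + s.offset : Fin (d + 2)) := by
  cases s with
  | stay => simp [inner, Lin.val, offset]
  | left =>
    rw [offset, Fin.val_add_one_of_lt (by simp [Fin.lt_def])]
    simp [inner, Lin.val]
  | right =>
    rw [offset, ← sub_eq_add_neg, Fin.coe_sub_one, if_neg (Fin.succ_ne_zero _)]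
    simp [inner, Lin.val]

theorem val_last (hcols : (ρ .cols).length = d) (s : Shift) :
    s.last.val ρ 0 = (Fin.last (d + 1) + s.offset : Fin (d + 2)) := by
  cases s with
  | stay => simp [last, Lin.val, offset, hcols]
  | left => simp [last, Lin.val, offset]
  | right =>
    rw [offset, ← sub_eq_add_neg, Fin.coe_sub_one, if_neg Fin.last_pos.ne']
    simp [last, Lin.val, hcols]

end Shift

namespace RotMachine

variable {M : RotMachine} {d : ℕ}

theorem unrot_eq_rot (σ : Fin M.w → Shift) (cell : M.Tape d) :
    unrot σ cell = rot (fun j => (σ j).rev) cell := by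
  funext i j
  rw [unrot, rot, Shift.offset_rev, sub_eq_add_neg]

/-- The wire with the given value. -/
def constWire (b : Bool) : Lin := ⟨2, 0, 0, if b then 2 else 1⟩

variable (M)

/-- The wire with the bit `j` of the control. -/
def ctrlLin (j : ℕ) : Lin := ⟨0, 0, 0, 2 + j⟩

/-- The wire with the bit `j` of the column `c` of the tape. -/
def cellLin (c : Lin) (j : ℕ) : Lin :=
  ⟨M.w * c.pat, M.w * c.cols, M.w * c.index, 2 + M.q + M.w * c.const + j⟩

theorem val_cellLin (ρ : Par → List Bool) (i : ℕ) (c : Lin) (j : ℕ) :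
    (M.cellLin c j).val ρ i = M.cellWire (c.val ρ i) j := by
  simp only [cellLin, Lin.val, cellWire]
  ring

variable {M}

/-- The wires with the bits of a vertex. The bits of the local part are on the given wires, the
other columns of the tape are those of the current vertex after a rotation, and `timer` are the
wires of the timer. -/
def columnParts (aux phase : Bool) (ctrl : Fin M.q → Lin) (col : Fin M.w → Lin)
    (σ : Fin M.w → Shift) (timer : Lin) : List (Part Par Lin) :=
  ([constWire aux, constWire phase] ++ (List.ofFn ctrl ++ List.ofFn col)).map .one ++
    ([.loop .cols fun _ => List.ofFn fun j => M.cellLin (σ j).inner j] ++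
      ((List.ofFn fun j => M.cellLin (σ j).last j).map .one ++ [.loop .pat fun _ => [timer]]))

/-- The wires with the bits of a vertex that is reached by a rotation. -/
def rotParts (phase : Bool) (σ : Fin M.w → Shift) (timer : Lin) : List (Part Par Lin) :=
  columnParts false phase (fun j => ctrlLin j) (fun j => M.cellLin (σ j).first j) σ timer

/-- The wires of the column of a slot. -/
def Slot.parts : M.Slot → List (Part Par Lin)
  | inner u => columnParts u.aux u.phase (fun j => constWire (u.ctrl j))
      (fun j => constWire (u.col j)) (fun _ => .stay) Chain.timerBit
  | forward q => rotParts false (M.shift q) (Chain.this 8)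
  | backward q => rotParts true (fun j => (M.shift q j).rev) (Chain.this 11)

theorem flatMap_zipIdx_snd {α β : Type} {l : List α} {n : ℕ} (hl : l.length = n)
    (g : ℕ → List β) :
    (l.zipIdx.flatMap fun b => g b.2) = (List.finRange n).flatMap fun i : Fin n => g i := by
  rw [← List.flatMap_map Prod.snd, List.zipIdx_map_snd, hl, ← List.range_eq_range',
    ← List.map_coe_finRange_eq_range, List.flatMap_map]

section columns

variable {ρ : Par → List Bool}

theorem expand_columnParts (hcols : (ρ .cols).length = d) (hpat : (ρ .pat).length = M.len d)
    (aux phase : Bool) (ctrl : Fin M.q → Lin) (col : Fin M.w → Lin) (σ : Fin M.w → Shift)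
    (timer : Lin) :
    expand ρ (fun i a => [a.val ρ i]) (columnParts aux phase ctrl col σ timer) =
      ([(constWire aux).val ρ 0, (constWire phase).val ρ 0] ++
        (List.ofFn (fun j => (ctrl j).val ρ 0) ++ List.ofFn fun j => (col j).val ρ 0)) ++
      ((List.finRange d).flatMap fun i => List.ofFn fun j =>
        M.cellWire (i.castSucc.succ + (σ j).offset : Fin (d + 2)) j) ++
      (List.ofFn fun j => M.cellWire (Fin.last (d + 1) + (σ j).offset : Fin (d + 2)) j) ++
      List.ofFn fun i : Fin (M.len d) => timer.val ρ i := by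
  have hloop : ∀ {p : Par} {n : ℕ} (_ : (ρ p).length = n) (l : List Lin),
      expand ρ (fun i a => [a.val ρ i]) [.loop p fun _ => l] =
        (List.finRange n).flatMap fun i : Fin n => l.map (Lin.val ρ i) := by
    intro p n hp l
    rw [expand, List.flatMap_singleton, Part.expand]
    exact (flatMap_zipIdx_snd hp fun i => l.flatMap fun a => [a.val ρ i]).trans
      (congrArg (List.flatMap · _) (funext fun i => List.map_eq_flatMap.symm))
  rw [columnParts, expand_append, expand_append, expand_append, expand_map_one, expand_map_one,
    hloop hcols, hloop hpat]
  simp only [← List.map_eq_flatMap, List.map_append, List.ofFn_eq_map, List.map_map,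
    Function.comp_def, val_cellLin, Shift.val_inner, Shift.val_last hcols, List.map_cons,
    List.map_nil, List.append_assoc]

theorem forall_mem_columnParts {P : ℕ → Prop} (hcols : (ρ .cols).length = d)
    (hpat : (ρ .pat).length = M.len d) (hconst : ∀ b, P ((constWire b).val ρ 0))
    (hcell : ∀ (i : Fin (d + 2)) (j : Fin M.w), P (M.cellWire i j)) {aux phase : Bool}
    {ctrl : Fin M.q → Lin} (hctrl : ∀ j, P ((ctrl j).val ρ 0)) {col : Fin M.w → Lin}
    (hcol : ∀ j, P ((col j).val ρ 0)) {timer : Lin}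
    (htimer : ∀ i : Fin (M.len d), P (timer.val ρ i)) (σ : Fin M.w → Shift) :
    ∀ p ∈ expand ρ (fun i a => [a.val ρ i]) (columnParts aux phase ctrl col σ timer), P p := by
  simp only [expand_columnParts hcols hpat, List.forall_mem_append, List.forall_mem_cons,
    List.forall_mem_flatMap, List.forall_mem_ofFn_iff]
  exact ⟨⟨⟨⟨⟨hconst _, hconst _, by simp⟩, hctrl, hcol⟩, fun _ _ _ => hcell _ _⟩,
    fun _ => hcell _ _⟩, htimer⟩

theorem constWire_lt (hpat : (ρ .pat).length = M.len d) (b : Bool) :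
    (constWire b).val ρ 0 < 14 * M.len d + 13 := by
  cases b <;> simp [constWire, Lin.val, hpat] <;> omega

theorem rotParts_lt (hcols : (ρ .cols).length = d) (hpat : (ρ .pat).length = M.len d)
    (phase : Bool) (σ : Fin M.w → Shift) {r : ℕ} (hr : r < 12) :
    ∀ p ∈ expand ρ (fun i a => [a.val ρ i]) (rotParts phase σ (Chain.this r)),
      p < 14 * M.len d + 13 := by
  have hcell : ∀ (i : Fin (d + 2)) (j : Fin M.w), M.cellWire i j < 14 * M.len d + 13 :=
    fun i j => (cellWire_lt i j).trans (by omega)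
  refine forall_mem_columnParts hcols hpat (constWire_lt hpat) hcell (fun j => ?_) (fun j => ?_)
    (fun i => ?_) σ
  · have hj := j.2
    simp only [ctrlLin, Lin.val, len]
    omega
  · rw [val_cellLin, Shift.val_first hcols]
    exact hcell _ j
  · have hi := i.2
    simp only [Chain.this, Lin.val, hpat]
    omega

theorem Slot.parts_lt (hcols : (ρ .cols).length = d) (hpat : (ρ .pat).length = M.len d)
    (s : M.Slot) :
    ∀ p ∈ expand ρ (fun i a => [a.val ρ i]) s.parts, p < 14 * M.len d + 13 := by
  cases s with
  | inner u =>
    refine forall_mem_columnParts hcols hpat (constWire_lt hpat)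
      (fun i j => (cellWire_lt i j).trans (by omega)) (fun _ => constWire_lt hpat _)
      (fun _ => constWire_lt hpat _) (fun i => ?_) _
    have hi := i.2
    simp only [Chain.timerBit, Lin.val, hpat]
    omega
  | forward q | backward q => exact rotParts_lt hcols hpat _ _ (by norm_num)

end columns

theorem Vertex.bits_eq (v : M.Vertex d) :
    v.bits = ([v.aux, v.phase] ++ (List.ofFn v.config.1 ++ List.ofFn (v.config.2 0))) ++
      ((List.finRange d).flatMap fun i => List.ofFn (v.config.2 i.castSucc.succ)) ++
      List.ofFn (v.config.2 (Fin.last (d + 1))) ++ List.ofFn v.timer := by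
  rw [bits, configBits, List.finRange_succ, List.flatMap_cons, List.flatMap_map,
    List.finRange_succ_last, List.flatMap_append, List.flatMap_map]
  simp

/-- The wires carry the bits of the vertex `v` and the values of the gates for the chains. -/
structure RowWires (ρ : Par → List Bool) (W : List Bool) (v : M.Vertex d) : Prop where
  length_cols : (ρ .cols).length = d
  length_pat : (ρ .pat).length = M.len d
  bits : ∀ p < 2 * M.len d + 1, W.getD p false = v.bits.getD p false
  holds : Holds W (2 * M.len d + 1) (expand ρ (fun i g => [g.gate ρ i]) Chain.gates)

namespace RowWires

variable {ρ : Par → List Bool} {W : List Bool} {v : M.Vertex d} (h : RowWires ρ W v)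

include h

theorem chain : Chain.Values ρ W v.timer where
  length_pat := h.length_pat
  timer k := by rw [h.bits _ (by omega), v.getD_bits_timer]
  holds := h.holds

theorem getD_constWire (b : Bool) : W.getD ((constWire b).val ρ 0) false = b := by
  have hvalue : ∀ r : Fin 12, W.getD (2 * M.len d + 1 + r) false = decide (r ≠ 0) :=
    h.chain.value_start
  cases b
  · simpa [constWire, Lin.val, h.length_pat] using hvalue 0
  · simpa [constWire, Lin.val, h.length_pat] using hvalue 1

theorem getD_cellWire (i : Fin (d + 2)) (j : Fin M.w) :
    W.getD (M.cellWire i j) false = v.config.2 i j := by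
  rw [h.bits _ ((cellWire_lt i j).trans_le (by omega)), v.getD_bits_cell]

theorem getD_ctrlLin (j : Fin M.q) : W.getD ((ctrlLin j).val ρ 0) false = v.config.1 j := by
  have hval : (ctrlLin j).val ρ 0 = 2 + j := by simp [ctrlLin, Lin.val]
  rw [hval, h.bits _ (by rw [len]; omega), v.getD_bits_ctrl]

theorem map_columnParts {v' : M.Vertex d} {ctrl : Fin M.q → Lin} {col : Fin M.w → Lin}
    {σ : Fin M.w → Shift} {timer : Lin}
    (hctrl : ∀ j, W.getD ((ctrl j).val ρ 0) false = v'.config.1 j)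
    (hcol : ∀ j, W.getD ((col j).val ρ 0) false = v'.config.2 0 j)
    (hcell : ∀ i ≠ 0, ∀ j, v.config.2 (i + (σ j).offset) j = v'.config.2 i j)
    (htimer : ∀ i : Fin (M.len d), W.getD (timer.val ρ i) false = v'.timer i) :
    (expand ρ (fun i a => [a.val ρ i]) (columnParts v'.aux v'.phase ctrl col σ timer)).map
      (fun p => W.getD p false) = v'.bits := by
  rw [expand_columnParts h.length_cols h.length_pat, v'.bits_eq]
  simp only [List.map_append, List.map_cons, List.map_nil, List.map_ofFn, List.map_flatMap,
    Function.comp_def, h.getD_constWire, h.getD_cellWire, hctrl, hcol, htimer,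
    hcell _ (Fin.succ_ne_zero _), hcell _ Fin.last_pos.ne']

theorem map_rotParts {phase : Bool} {σ : Fin M.w → Shift} {timer : Lin}
    {t : Fin (M.len d) → Bool}
    (htimer : ∀ i : Fin (M.len d), W.getD (timer.val ρ i) false = t i) :
    (expand ρ (fun i a => [a.val ρ i]) (rotParts phase σ timer)).map (fun p => W.getD p false) =
      Vertex.bits ⟨false, phase, (v.config.1, rot σ v.config.2), t⟩ := by
  refine h.map_columnParts (v' := ⟨false, phase, (v.config.1, rot σ v.config.2), t⟩)
    h.getD_ctrlLin (fun j => ?_) (fun _ _ _ => rfl) htimer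
  rw [val_cellLin, Shift.val_first h.length_cols, h.getD_cellWire]
  rfl

theorem map_parts (s : M.Slot) :
    (expand ρ (fun i a => [a.val ρ i]) s.parts).map (fun p => W.getD p false) =
      (s.column v).bits := by
  cases s with
  | inner u =>
    refine h.map_columnParts (v' := v.setLocal u) (fun _ => h.getD_constWire _) (fun j => ?_)
      (fun i hi j => ?_) h.chain.getD_timerBit
    · simp only [h.getD_constWire, Vertex.setLocal, update_self]
    · simp only [Shift.offset, add_zero, Vertex.setLocal, update_of_ne hi]
  | forward q =>
    exact h.map_rotParts fun i => (h.chain.getD_this i 8).trans (h.chain.inc_eq i)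
  | backward q =>
    refine (h.map_rotParts fun i => (h.chain.getD_this i 11).trans (h.chain.dec_eq i)).trans ?_
    rw [← unrot_eq_rot]
    rfl

end RowWires

end RotMachine

/-! ### The circuit of the rows -/

namespace RotMachine

variable {M : RotMachine} {d : ℕ}

variable (M) in
/-- The bits that determine the values of the slots in a row: the local part of the vertex, whether
its timer is maximal or zero, and whether its phase and its configuration are the initial ones. -/
inductive RowVar where
  | aux
  | phase
  | ctrl (j : Fin M.q)
  | col (j : Fin M.w)
  | last
  | first
  | agree

instance : Finite M.RowVar :=
  Finite.of_surjective
    (Sum.elim ![.aux, .phase, .last, .first, .agree] (Sum.elim .ctrl .col) :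
      Fin 5 ⊕ Fin M.q ⊕ Fin M.w → M.RowVar)
    fun
      | .aux => ⟨.inl 0, rfl⟩
      | .phase => ⟨.inl 1, rfl⟩
      | .ctrl j => ⟨.inr (.inl j), rfl⟩
      | .col j => ⟨.inr (.inr j), rfl⟩
      | .last => ⟨.inl 2, rfl⟩
      | .first => ⟨.inl 3, rfl⟩
      | .agree => ⟨.inl 4, rfl⟩

/-- The wires of the variables. -/
def RowVar.wire : M.RowVar → Lin
  | aux => ⟨0, 0, 0, 0⟩
  | phase => ⟨0, 0, 0, 1⟩
  | ctrl j => ctrlLin j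
  | col j => M.cellLin ⟨0, 0, 0, 0⟩ j
  | last => Chain.final 1
  | first => Chain.final 2
  | agree => Chain.final 4

/-- The values of the variables for the vertex `v` and the input `x`. -/
def Vertex.assignment (x : List Bool) (v : M.Vertex d) : M.RowVar → Bool
  | .aux => v.aux
  | .phase => v.phase
  | .ctrl j => v.config.1 j
  | .col j => v.config.2 0 j
  | .last => v.isLast
  | .first => v.isFirst
  | .agree => decide (v.phase = false ∧ v.config = M.init d x)

namespace Slot

/-- The value of a slot as a function of the variables. -/
noncomputable def valueOf (s : M.Slot) (η : M.RowVar → Bool) : ℕ :=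
  s.value (η .last) (η .first) (η .agree && η .first)
    ⟨η .aux, η .phase, fun j => η (.ctrl j), fun j => η (.col j)⟩

theorem valueOf_assignment (x : List Bool) (v : M.Vertex d) (s : M.Slot) :
    s.valueOf (v.assignment x) = s.entry x v := by
  have hstart : v.isStart x =
      (decide (v.phase = false ∧ v.config = M.init d x) && v.isFirst) := by
    rw [Vertex.isStart, Bool.eq_iff_iff]
    simp [and_assoc]
  rw [entry, hstart]
  rfl

/-- The row of the table for a slot. -/
noncomputable def row (s : M.Slot) : TableRow M.RowVar where
  lo := .ofFun fun η => (s.valueOf η).testBit 0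
  hi := .ofFun fun η => (s.valueOf η).testBit 1
  col := s.parts

end Slot

/-- The wire of the gate `o` of the table. -/
def tableWire (o : ℕ) : Lin := ⟨14, 0, 0, 13 + o⟩

variable (M) in
/-- The circuit that outputs the rows of the matrix. -/
noncomputable def rowCircuit : SCircuit where
  arity := ⟨2, 0, 0, 1⟩
  gates := Chain.gates ++ (tableGates RowVar.wire tableWire (M.slots.map Slot.row) 0).map .one
  outputs := tableOutputs tableWire (M.slots.map Slot.row) 0

section wellFormed

theorem gates_rowCircuit (ρ : Par → List Bool) : (M.rowCircuit.circuit ρ).gates =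
    expand ρ (fun i g => [g.gate ρ i]) Chain.gates ++
      (tableGates RowVar.wire tableWire (M.slots.map Slot.row) 0).map (SGate.gate ρ 0) := by
  rw [rowCircuit, SCircuit.circuit, expand_append, expand_map_one, ← List.map_eq_flatMap]

variable {ρ : Par → List Bool} (hpat : (ρ .pat).length = M.len d)

include hpat

theorem val_tableWire (o : ℕ) : (tableWire o).val ρ 0 = 14 * M.len d + 13 + o := by
  simp [tableWire, Lin.val, hpat, add_assoc]

theorem RowVar.val_wire_lt (i : M.RowVar) : i.wire.val ρ 0 < 14 * M.len d + 13 := by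
  cases i with
  | ctrl j =>
    have hj := j.2
    simp only [wire, ctrlLin, Lin.val, len]
    omega
  | col j =>
    have hj := cellWire_lt (0 : Fin (d + 2)) j
    have hval : (⟨0, 0, 0, 0⟩ : Lin).val ρ 0 = ((0 : Fin (d + 2)) : ℕ) := by simp [Lin.val]
    rw [wire, val_cellLin, hval]
    exact hj.trans (by omega)
  | _ => simp only [wire, Chain.final, Lin.val, hpat]; omega

theorem arity_rowCircuit : (M.rowCircuit.circuit ρ).arity = 2 * M.len d + 1 := by
  simp [rowCircuit, SCircuit.circuit, Lin.val, hpat]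

theorem forallFrom_gates_rowCircuit {P : ℕ → Gate → Prop} :
    ForallFrom P (2 * M.len d + 1) (M.rowCircuit.circuit ρ).gates ↔
      ForallFrom P (2 * M.len d + 1) (expand ρ (fun i g => [g.gate ρ i]) Chain.gates) ∧
        ForallFrom P (14 * M.len d + 13 + 0)
          ((tableGates RowVar.wire tableWire (M.slots.map Slot.row) 0).map (SGate.gate ρ 0)) := by
  have hstart : 2 * M.len d + 1 + (12 * M.len d + 12) = 14 * M.len d + 13 + 0 := by ring
  rw [gates_rowCircuit, forallFrom_append, Chain.length_expand_gates hpat, hstart]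

theorem gatesBelow_rowCircuit :
    GatesBelow (2 * M.len d + 1) (M.rowCircuit.circuit ρ).gates :=
  (forallFrom_gates_rowCircuit hpat).2 ⟨Chain.gatesBelow_expand_gates hpat,
    gatesBelow_tableGates (RowVar.val_wire_lt hpat) (val_tableWire hpat) _ _⟩

theorem wellFormed_rowCircuit (hcols : (ρ .cols).length = d) :
    (M.rowCircuit.circuit ρ).WellFormed := by
  rw [Circuit.WellFormed, arity_rowCircuit hpat]
  refine ⟨forallFrom_iff.1 (gatesBelow_rowCircuit hpat), fun p hp => ?_⟩
  have hcol : ∀ s ∈ M.slots.map Slot.row, ∀ p ∈ expand ρ (fun i a => [a.val ρ i]) s.col,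
      p < 14 * M.len d + 13 :=
    List.forall_mem_map.2 fun s _ => s.parts_lt hcols hpat
  have hlt := lt_of_mem_tableOutputs (var := RowVar.wire) (val_tableWire hpat) hcol 0 hp
  rw [gates_rowCircuit, List.length_append, Chain.length_expand_gates hpat, List.length_map]
  omega

end wellFormed

section eval

variable {ρ : Par → List Bool} {x : List Bool}

theorem RowWires.agree_iff {W : List Bool} {v : M.Vertex d} (h : RowWires ρ W v)
    (hpat : ρ .pat = configBits false (M.init d x)) :
    Chain.value W (M.len d) (M.len d) 4 = true ↔ v.phase = false ∧ v.config = M.init d x := by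
  rw [h.chain.agree_iff le_rfl, ← configBits_inj, ← hpat]
  have hbit : ∀ k < M.len d,
      W.getD (k + 1) false = (configBits v.phase v.config).getD k false := by
    intro k hk
    rw [h.bits _ (by omega), add_comm, v.getD_bits_config hk]
  refine ⟨fun heq => List.ext_getElem ?_ fun k hk hk' => ?_, fun heq k hk => ?_⟩
  · rw [length_configBits, h.length_pat]
  · rw [length_configBits] at hk
    rw [← List.getD_eq_getElem _ false, ← List.getD_eq_getElem _ false, heq k hk, hbit k hk]
  · rw [hbit k hk, heq]

theorem RowWires.getD_wire {W : List Bool} {v : M.Vertex d} (h : RowWires ρ W v)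
    (hpat : ρ .pat = configBits false (M.init d x)) (i : M.RowVar) :
    W.getD (i.wire.val ρ 0) false = v.assignment x i := by
  cases i with
  | aux =>
    have hval : (RowVar.aux : M.RowVar).wire.val ρ 0 = 0 := by simp [RowVar.wire, Lin.val]
    rw [hval]
    exact h.bits 0 (by omega)
  | phase =>
    have hval : (RowVar.phase : M.RowVar).wire.val ρ 0 = 1 := by simp [RowVar.wire, Lin.val]
    rw [hval]
    exact h.bits 1 (by rw [len]; omega)
  | ctrl j => exact h.getD_ctrlLin j
  | col j =>
    have hval : (⟨0, 0, 0, 0⟩ : Lin).val ρ 0 = ((0 : Fin (d + 2)) : ℕ) := by simp [Lin.val]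
    rw [RowVar.wire, val_cellLin, hval]
    exact h.getD_cellWire 0 j
  | last => exact (h.chain.getD_final 1).trans (h.chain.carry_eq le_rfl)
  | first => exact (h.chain.getD_final 2).trans (h.chain.borrow_eq le_rfl)
  | agree =>
    rw [RowVar.wire, h.chain.getD_final, Vertex.assignment, Bool.eq_iff_iff, decide_eq_true_iff,
      h.agree_iff hpat]

theorem eval_rowCircuit (hcols : (ρ .cols).length = d)
    (hpat : ρ .pat = configBits false (M.init d x)) (v : M.Vertex d)
    {i : (M.rowCircuit.circuit ρ).Index} (hi : List.ofFn i = v.bits) :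
    (M.rowCircuit.circuit ρ).eval i = M.slots.flatMap fun s =>
      (s.entry x v).testBit 0 :: (s.entry x v).testBit 1 :: (s.column v).bits := by
  have hlen : (ρ .pat).length = M.len d := by rw [hpat, length_configBits]
  set W := (M.rowCircuit.circuit ρ).wires i
  have hW : W = runGates v.bits (M.rowCircuit.circuit ρ).gates := by rw [← hi]; rfl
  have hholds : Holds W (2 * M.len d + 1) (M.rowCircuit.circuit ρ).gates := by
    have hbelow := gatesBelow_rowCircuit hlen
    rw [hW]
    rw [← v.length_bits] at hbelow ⊢
    exact holds_runGates hbelow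
  rw [Holds, forallFrom_gates_rowCircuit hlen] at hholds
  have hrow : RowWires ρ W v :=
    { length_cols := hcols
      length_pat := hlen
      bits p hp := by rw [hW, getD_runGates _ _ (by rwa [v.length_bits])]
      holds := hholds.1 }
  refine (map_tableOutputs (val_tableWire hlen) (hrow.getD_wire hpat) _ _ hholds.2).trans ?_
  simp only [List.flatMap_map, Slot.row, Fml.eval_ofFun, Slot.valueOf_assignment, hrow.map_parts]

theorem exists_equiv_represents_rowCircuit (hcols : (ρ .cols).length = d)
    (hpat : ρ .pat = configBits false (M.init d x)) :
    ∃ φ : (M.rowCircuit.circuit ρ).Index ≃ M.Vertex d,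
      (M.rowCircuit.circuit ρ).Represents ((M.forest d x).graph.overlap.submatrix φ φ) := by
  have hlen : (ρ .pat).length = M.len d := by rw [hpat, length_configBits]
  let φ := (Vertex.equivIndex (M := M) (arity_rowCircuit hlen)).symm
  have hφ : ∀ v, List.ofFn (φ.symm v) = v.bits := Vertex.ofFn_equivIndex (arity_rowCircuit hlen)
  refine ⟨φ, Circuit.represents_of_eval (wellFormed_rowCircuit hlen hcols) M.slots
    (fun i s => s.entry x (φ i)) (fun i s => φ.symm (s.column (φ i)))
    (fun i s => (s.value_le_two ..).trans_lt (by norm_num)) (fun i => ?_) fun i j k hk => ?_⟩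
  · simp only [hφ]
    exact eval_rowCircuit hcols hpat (φ i) (by rw [← hφ, φ.symm_apply_apply])
  · simp only [submatrix_apply, overlap_eq_iff_exists_slot x _ _ hk, mem_slots, true_and,
      φ.symm_apply_eq]

end eval

end RotMachine

/-! ### The reduction -/

section eigenvalue

variable {ι κ : Type} [Fintype ι] [DecidableEq ι] [Fintype κ] [DecidableEq κ]

theorem isSmallestEigenvalue_iff_isLeast_spectrum {A : Matrix ι ι ℝ} {r : ℝ} :
    IsSmallestEigenvalue A r ↔ IsLeast (spectrum ℝ A) r := by
  simp only [IsSmallestEigenvalue, Module.End.hasEigenvalue_iff_mem_spectrum, spectrum_toLin',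
    Set.ofPred_mem_eq]

theorem IsSmallestEigenvalue.submatrix {A : Matrix ι ι ℝ} {r : ℝ} (h : IsSmallestEigenvalue A r)
    (φ : κ ≃ ι) : IsSmallestEigenvalue (A.submatrix φ φ) r := by
  rw [isSmallestEigenvalue_iff_isLeast_spectrum] at h ⊢
  rwa [← AlgEquiv.spectrum_eq (reindexAlgEquiv ℝ ℝ φ.symm) A] at h

end eigenvalue

theorem Circuit.arity_lt_length_encode (C : Circuit) : C.arity < C.encode.length := by
  simp [encode, encodeNat]

namespace RotMachine

variable {M : RotMachine} {d n : ℕ} {ρ : Par → List Bool} {x : List Bool} {c : M.Config d}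

theorem encodes_rowCircuit [DecidableEq (M.Vertex d)] (hcols : (ρ .cols).length = d)
    (hpat : ρ .pat = configBits false (M.init d x)) {r : ℝ}
    (hr : IsSmallestEigenvalue ((M.forest d x).graph.overlap.map (Nat.cast : ℕ → ℝ)) r) :
    EncodesPSDWithSmallestEigenvalue (M.rowCircuit.circuit ρ).encode r := by
  obtain ⟨φ, hφ⟩ := exists_equiv_represents_rowCircuit hcols hpat
  refine ⟨_, _, rfl, hφ, fun i j => ?_, (M.forest d x).graph.overlap_isSymm.submatrix φ,
    (M.forest d x).graph.posSemidef_map_overlap.submatrix φ, hr.submatrix φ⟩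
  have hle := (M.forest d x).graph.overlap_le_two (M.forest d x).graph_head_ne_tail (φ i) (φ j)
  rw [submatrix_apply]
  omega

theorem encode_rowCircuit_mem_yes (hcols : (ρ .cols).length = d)
    (hpat : ρ .pat = configBits false (M.init d x)) (hn : step^[n] (M.init d x) = c)
    (hc : step c = c) (hacc : M.accept c.1 = true) (g : Polynomial ℕ) :
    (M.rowCircuit.circuit ρ).encode ∈ (GappedSuccinctDet g).yes := by
  classical
  obtain ⟨v, hroot, hreach, hv⟩ := exists_reach_root_of_fixed hn hc
  exact encodes_rowCircuit hcols hpat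
    ((M.forest d x).isSmallestEigenvalue_zero_of_accept hreach hroot (by rwa [← hv] at hacc))

theorem encode_rowCircuit_mem_no (hcols : (ρ .cols).length = d)
    (hpat : ρ .pat = configBits false (M.init d x)) (hn : step^[n] (M.init d x) = c)
    (hc : step c = c) (hrej : M.accept c.1 = false) :
    (M.rowCircuit.circuit ρ).encode ∈ (GappedSuccinctDet (2 * .X + 3)).no := by
  classical
  obtain ⟨v, hroot, hreach, hv⟩ := exists_reach_root_of_fixed hn hc
  have hrejecting : (M.forest d x).Rejecting v := ⟨hroot, by
    rw [← hv] at hrej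
    exact ne_true_of_eq_false hrej⟩
  obtain ⟨r, hr, hle⟩ := (M.forest d x).exists_isSmallestEigenvalue_ge_of_reject hreach hrejecting
  refine ⟨r, encodes_rowCircuit hcols hpat hr, le_trans ?_ hle⟩
  have hlen := (M.rowCircuit.circuit ρ).arity_lt_length_encode
  rw [arity_rowCircuit (by rw [hpat, length_configBits])] at hlen
  have hpow : (8 : ℝ) * (Fintype.card (M.Vertex d) : ℝ) ^ 2 = 2 ^ (2 * (2 * M.len d + 1) + 3) := by
    rw [Vertex.card_vertex]
    push_cast
    ring
  rw [hpow]
  refine inv_anti₀ (by positivity) (pow_le_pow_right₀ one_le_two ?_)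
  simp only [Polynomial.eval_add, Polynomial.eval_mul, Polynomial.eval_ofNat, Polynomial.eval_X]
  omega

end RotMachine

theorem exists_eval_le_pow (p : Polynomial ℕ) : ∃ C k, ∀ n, p.eval n ≤ (n + C) ^ k := by
  refine ⟨p.eval 1 + 1, p.natDegree + 1, fun n => ?_⟩
  calc p.eval n ≤ p.eval 1 * (n + 1) ^ p.natDegree := by
        rw [p.eval_eq_sum_range, p.eval_eq_sum_range, Finset.sum_mul]
        refine Finset.sum_le_sum fun i hi => ?_
        rw [one_pow, mul_one]
        have hi : i ≤ p.natDegree := Nat.lt_succ_iff.1 (Finset.mem_range.1 hi)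
        exact Nat.mul_le_mul_left _
          ((Nat.pow_le_pow_left n.le_succ i).trans (Nat.pow_le_pow_right n.succ_pos hi))
    _ ≤ (n + (p.eval 1 + 1)) * (n + (p.eval 1 + 1)) ^ p.natDegree := by gcongr <;> omega
    _ = (n + (p.eval 1 + 1)) ^ (p.natDegree + 1) := (pow_succ' _ _).symm

theorem exists_preparable_pow (C k : ℕ) :
    ∃ ρ : List Bool → Par → List Bool, Preparable .inp ρ ∧ ∀ x, ρ x .inp = x ∧
      (ρ x .base).length = x.length + C ∧ (ρ x .pow).length = (x.length + C) ^ k := by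
  induction k with
  | zero =>
    refine ⟨_, ((preparable_update Par.inp).assign .base
      (.one (.length .inp) :: List.replicate C (.one (.bit true)))).assign .pow [.one (.bit true)],
        fun x => ?_⟩
    simp [expand, Part.expand, Atom.text, List.flatMap_replicate]
  | succ k ih =>
    obtain ⟨ρ, hρ, h⟩ := ih
    refine ⟨_, hρ.assign .pow [.loop .pow fun _ => [.length .base]], fun x => ?_⟩
    simp [expand, Part.expand, Atom.text, h, pow_succ, List.length_flatMap]

section bits

variable {ι : Type} (ρ : ι → List Bool)

theorem expand_text_bits (l : List Bool) :
    expand ρ (Atom.text ρ) (l.map fun b => .one (.bit b)) = l := by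
  simp [expand, List.flatMap_map, Part.expand, Atom.text]

theorem expand_text_loop_bits (p : ι) (f : Bool → List Bool) :
    expand ρ (Atom.text ρ) [.loop p fun b => (f b).map .bit] = (ρ p).flatMap f := by
  conv_rhs => rw [← List.zipIdx_map_fst 0 (ρ p), List.flatMap_map]
  simp [expand, Part.expand, List.flatMap_map, Atom.text]

end bits

namespace RotMachine

variable (M : RotMachine)

theorem configBits_init (x : List Bool) (N : ℕ) :
    configBits false (M.init (x.length + N) x) = [false] ++ (List.ofFn M.start ++
      ((x.flatMap fun b => List.ofFn (M.code b)) ++ List.replicate ((N + 2) * M.w) false)) := by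
  have hcells : ((List.finRange (x.length + N + 2)).flatMap fun i =>
      List.ofFn ((M.init (x.length + N) x).2 i)) =
      (List.range (x.length + (N + 2))).flatMap fun i => List.ofFn (M.startCell x i) := by
    rw [← add_assoc, ← List.map_coe_finRange_eq_range, List.flatMap_map]
    rfl
  have hinput : ((List.range x.length).flatMap fun i => List.ofFn (M.startCell x i)) =
      x.flatMap fun b => List.ofFn (M.code b) := by
    rw [← List.map_coe_finRange_eq_range, List.flatMap_map]
    conv_rhs => rw [← List.map_get_finRange x, List.flatMap_map]
    simp [startCell]
  have hblank : ((List.range (N + 2)).flatMap fun i => List.ofFn (M.startCell x (x.length + i))) =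
      List.replicate ((N + 2) * M.w) false := by
    simp [startCell, List.ofFn_const, List.flatMap, List.map_const']
  rw [configBits, hcells, List.range_add, List.flatMap_append, hinput, List.flatMap_map, hblank]
  rfl

theorem exists_preparable (C k : ℕ) :
    ∃ (ρ : List Bool → Par → List Bool) (d : List Bool → ℕ), Preparable .inp ρ ∧ ∀ x,
      (x.length + C) ^ k ≤ d x ∧ (ρ x .cols).length = d x ∧
        ρ x .pat = configBits false (M.init (d x) x) := by
  obtain ⟨ρ, hρ, h⟩ := exists_preparable_pow C k
  refine ⟨_, fun x => x.length + (x.length + C) ^ k,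
    (hρ.assign .cols [.one (.length .inp), .one (.length .pow)]).assign .pat
      ([false].map (fun b => .one (.bit b)) ++ ((List.ofFn M.start).map (fun b => .one (.bit b)) ++
        ([.loop .inp fun b => (List.ofFn (M.code b)).map .bit] ++
          ([.loop .pow fun _ => (List.replicate M.w false).map .bit] ++
            (List.replicate (2 * M.w) false).map fun b => .one (.bit b))))),
    fun x => ⟨Nat.le_add_left _ _, ?_, ?_⟩⟩
  · simp [expand, Part.expand, Atom.text, h x]
  · have hblank : ((ρ x .pow).flatMap fun _ => List.replicate M.w false) =
        List.replicate ((x.length + C) ^ k * M.w) false := by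
      simp [List.flatMap, List.map_const', (h x).2.2]
    simp only [update_self, expand_append, expand_text_bits, expand_text_loop_bits]
    rw [update_of_ne (by decide), update_of_ne (by decide), (h x).1, hblank, configBits_init,
      add_mul, List.replicate_add]

end RotMachine

end GappedSuccinct

theorem mainTheorem4 :
    ∃ g : Polynomial ℕ, GappedSuccinct.PSPACEHard (GappedSuccinct.GappedSuccinctDet g) := by
  refine ⟨2 * .X + 3, ?_⟩
  rintro L ⟨M, p, hfin, hyes, hno⟩
  obtain ⟨R, C, hR⟩ := GappedSuccinct.exists_rotMachine M hfin
  obtain ⟨D, k, hpow⟩ := GappedSuccinct.exists_eval_le_pow (p + Polynomial.C C)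
  obtain ⟨ρ, d, hρ, h⟩ := R.exists_preparable D k
  have hspace (x : List Bool) : p.eval x.length + C ≤ d x + 2 := by
    have hle := (hpow x.length).trans (h x).1
    rw [Polynomial.eval_add, Polynomial.eval_C] at hle
    omega
  refine ⟨_, hρ.polyTime R.rowCircuit.code, fun x hx => ?_, fun x hx => ?_⟩ <;>
    rw [GappedSuccinct.SCircuit.expand_text_code]
  · obtain ⟨n, c, hn, hc, hacc⟩ := hR x true _ (d x) (hyes x hx) (hspace x)
    exact R.encode_rowCircuit_mem_yes (h x).2.1 (h x).2.2 hn hc hacc _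
  · obtain ⟨n, c, hn, hc, hrej⟩ := hR x false _ (d x) (hno x hx) (hspace x)
    exact R.encode_rowCircuit_mem_no (h x).2.1 (h x).2.2 hn hc hrej
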